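/- Two sensors observe a process and send status updates to a monitor in parallel. Each sensor follows the zero-wait policy: its first update is generated at time $0$, and each later update is generated at the moment its previous one is delivered. The age of information (AoI) at the monitor is the time elapsed since the generation of the freshest update received so far. An update is valid if, at its delivery, it is strictly fresher than everything received before (of several updates received simultaneously at most one counts as valid), and the corresponding AoI peak is the AoI immediately before this delivery. The average AoI is the limit, as the horizon tends to infinity, of the expected time average of the AoI; the average peak AoI (PAoI) is the limit of the expected sum of the AoI peaks up to the horizon divided by the expected number of valid updates up to the horizon. Geo-D system (discrete time, in slots): the service times of sensor A are i.i.d. geometric on $\{1,2,\dots\}$ with parameter $\mu_A\in(0,1]$, and the service time of sensor B is the constant $T=1/\mu_B$ slots (rounded up to $\lceil 1/\mu_B\rceil$ if $1/\mu_B$ is not an integer). With $G$ the generation time of an update, the AoI evolves by letting $\Delta[t+1]$ be the minimum of $\Delta[t]+1$ and of the numbers $t-G+1$ over the updates delivered at $t$, and an update delivered at $t$ is fresh if $t-G<\Delta[t]$, with AoI peak $\Delta[t]$. Its average AoI and PAoI, in slots, are $\overline\Delta_{\text{Geo-D}}(\mu_A,\mu_B)$ and $\overline\Delta^{\mathrm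 p}_{\text{Geo-D}}(\mu_A,\mu_B)$. M-D system (continuous time, in seconds): the service times of sensor A are i.i.d. exponential with rate $\mu_A>0$, and that of sensor B is the constant $1/\mu_B>0$. Its average AoI and PAoI are $\overline\Delta_{\text{M-D}}(\mu_A,\mu_B)$ and $\overline\Delta^{\mathrm p}_{\text{M-D}}(\mu_A,\mu_B)$. Theorem. Let $\lambda>0$ and $T_M>0$. For every real $\delta\ge\lambda$ the averages of the Geo-D system with $\mu_A=\lambda/\delta$ and $\mu_B=1/(\delta T_M)$ exist and are finite, and so do the averages of the M-D system with $\mu_A=\lambda$ and $\mu_B=1/T_M$. With slots of length $1/\delta$, $$\lim_{\delta\to\infty}\frac1\delta\,\overline\Delta_{\text{Geo-D}}\Big(\frac\lambda\delta,\frac1{\delta T_M}\Big)=\overline\Delta_{\text{M-D}}\Big(\lambda,\frac1{T_M}\Big),\qquad \lim_{\delta\to\infty}\frac1\delta\,\overline\Delta^{\mathrm p}_{\text{Geo-D}}\Big(\frac\lambda\delta,\frac1{\delta T_M}\Big)=\overline\Delta^{\mathrm p}_{\text{M-D}}\Big(\lambda,\frac1{T_M}\Big),$$ where $\delta\to\infty$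 through all real numbers. -/

import Mathlib

open MeasureTheory ProbabilityTheory Filter Topology
open scoped ENNReal

namespace AoI

noncomputable section

/-! ### Zero-wait queues

A sensor under the zero-wait policy is described by the service times `s 0, s 1, …` of its
successive updates.  Its first update is generated at time `0`, and update `i + 1` is generated at
the very moment update `i` is delivered. -/

/-- Generation time of the `i`-th update of a zero-wait queue with service times `s`. -/
def genTime {α : Type} [AddCommMonoid α] (s : ℕ → α) (i : ℕ) : α :=
  ∑ j ∈ Finset.range i, s j

/-- Delivery time of the `i`-th update: its generation time plus its service time. -/
def delTime {α : Type} [AddCommMonoid α] (s : ℕ → α) (i : ℕ) : α :=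
  genTime s i + s i

/-- Two parallel zero-wait queues: queue `0` (sensor A) has service times `a`, and queue `1`
(sensor B) has the deterministic service time `T`. -/
def services {α : Type} (a : ℕ → α) (T : α) : Fin 2 → ℕ → α :=
  ![a, fun _ => T]

/-- The long-run value of a quantity `m τ` as the horizon `τ` tends to infinity (the limit of `m`
whenever that limit exists and is finite). -/
def longRun {ι : Type} [Preorder ι] (m : ι → ℝ≥0∞) : ℝ :=
  (limsup m atTop).toReal

/-! ### The discrete-time (Geo-D) system -/

/-- The ages `t - G` of the updates (of either queue) that are served at time `t`, where `G` is the
generation time. -/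
def servedAges (s : Fin 2 → ℕ → ℕ) (t : ℕ) : Set ℕ :=
  {a | ∃ (q : Fin 2) (i : ℕ), delTime (s q) i = t ∧ a = t - genTime (s q) i}

/-- The age of information `Δ[t]` at the monitor, in slots: `Δ[t + 1]` is the minimum of
`Δ[t] + 1` and of the numbers `t - G + 1` over the updates served at `t`.  The initial age is
`0`. -/
def age (s : Fin 2 → ℕ → ℕ) : ℕ → ℕ
  | 0 => 0
  | t + 1 => sInf (insert (age s t + 1) ((fun a => a + 1) '' servedAges s t))

/-- A valid (fresh) update is received at time `t`: some update served at `t` satisfies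
`t - G < Δ[t]`.  (If two updates are received at the same time, at most one of them counts as
fresh.) -/
def Fresh (s : Fin 2 → ℕ → ℕ) (t : ℕ) : Prop :=
  ∃ a ∈ servedAges s t, a < age s t

/-- The geometric law on `{1, 2, …}` with parameter `p`, `0 < p ≤ 1`: the mass of `n + 1` is
`(1 - p) ^ n * p`.  (Mathlib's geometric law counts failures and takes its parameter in the unit
interval.) -/
def geoLaw (p : ℝ) : Measure ℕ :=
  (geometricMeasure (Set.projIcc 0 1 zero_le_one p)).map (fun n => n + 1)

/-- The law of the i.i.d. geometric service times of sensor A. -/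
def geoPathLaw (p : ℝ) : Measure (ℕ → ℕ) :=
  Measure.infinitePi fun _ => geoLaw p

/-- The services of the Geo-D system in which sensor B has rate `μB`: its service time is `1 / μB`
slots, rounded up to a whole number of slots if `1 / μB` is not an integer. -/
def geoDServices (μB : ℝ) (ω : ℕ → ℕ) : Fin 2 → ℕ → ℕ :=
  services ω ⌈1 / μB⌉₊

/-- Expected time average of the age over the first `n` slots of the Geo-D system. -/
def geoDMeanAoI (μA μB : ℝ) (n : ℕ) : ℝ≥0∞ :=
  ∫⁻ ω, (∑ t ∈ Finset.range n, (age (geoDServices μB ω) t : ℝ≥0∞)) / n ∂(geoPathLaw μA)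

open Classical in
/-- Expected number of valid updates (equivalently, of age peaks) before time `n`. -/
def geoDNumPeaks (μA μB : ℝ) (n : ℕ) : ℝ≥0∞ :=
  ∫⁻ ω, ∑ t ∈ Finset.range n,
    (if Fresh (geoDServices μB ω) t then 1 else 0) ∂(geoPathLaw μA)

open Classical in
/-- Expected sum of the age peaks before time `n`: the peak belonging to a valid update received at
time `t` is the age `Δ[t]` right before it is reset. -/
def geoDSumPeaks (μA μB : ℝ) (n : ℕ) : ℝ≥0∞ :=
  ∫⁻ ω, ∑ t ∈ Finset.range n,
    (if Fresh (geoDServices μB ω) t then (age (geoDServices μB ω) t : ℝ≥0∞) else 0)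
    ∂(geoPathLaw μA)

/-- Average peak age over the horizon `n`. -/
def geoDMeanPAoI (μA μB : ℝ) (n : ℕ) : ℝ≥0∞ :=
  geoDSumPeaks μA μB n / geoDNumPeaks μA μB n

/-- The average AoI of the Geo-D system, in slots, as a function of the two service rates. -/
def geoDAvgAoI (μA μB : ℝ) : ℝ :=
  longRun (geoDMeanAoI μA μB)

/-- The average peak AoI of the Geo-D system, in slots, as a function of the two service rates. -/
def geoDAvgPAoI (μA μB : ℝ) : ℝ :=
  longRun (geoDMeanPAoI μA μB)

/-! ### The continuous-time (M-D) system -/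

/-- The time stamp `u(t)` of the freshest update received up to time `t` (it is `0` as long as
nothing has been received). -/
def stamp (s : Fin 2 → ℕ → ℝ) (t : ℝ) : ℝ :=
  ⨆ x : Fin 2 × ℕ, if delTime (s x.1) x.2 ≤ t then genTime (s x.1) x.2 else 0

/-- The time stamp `u(t-)` of the freshest update received strictly before time `t`. -/
def stampBefore (s : Fin 2 → ℕ → ℝ) (t : ℝ) : ℝ :=
  ⨆ x : Fin 2 × ℕ, if delTime (s x.1) x.2 < t then genTime (s x.1) x.2 else 0

/-- The age of information `Δ(t) = t - u(t)`. -/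
def ctsAge (s : Fin 2 → ℕ → ℝ) (t : ℝ) : ℝ :=
  t - stamp s t

/-- The age `Δ(t-)` immediately before time `t`. -/
def ctsAgeBefore (s : Fin 2 → ℕ → ℝ) (t : ℝ) : ℝ :=
  t - stampBefore s t

/-- Update `i` of queue `q` is valid (fresh): at its delivery time `D` it satisfies
`D - G < Δ(D-)`.  (Simultaneous deliveries of the two queues have probability zero.) -/
def CtsFresh (s : Fin 2 → ℕ → ℝ) (q : Fin 2) (i : ℕ) : Prop :=
  delTime (s q) i - genTime (s q) i < ctsAgeBefore s (delTime (s q) i)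

/-- The law of the i.i.d. exponential service times of sensor A with rate `μA`. -/
def expPathLaw (μA : ℝ) : Measure (ℕ → ℝ) :=
  Measure.infinitePi fun _ => expMeasure μA

/-- The services of the M-D system in which sensor B has the deterministic service time
`1 / μB`. -/
def mdServices (μB : ℝ) (ω : ℕ → ℝ) : Fin 2 → ℕ → ℝ :=
  services ω (1 / μB)

/-- Expected time average of the age over `(0, τ]` of the M-D system. -/
def mdMeanAoI (μA μB : ℝ) (τ : ℝ) : ℝ≥0∞ :=
  ∫⁻ ω, (∫⁻ t in Set.Ioc 0 τ, ENNReal.ofReal (ctsAge (mdServices μB ω) t)) / ENNReal.ofReal τ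
    ∂(expPathLaw μA)

open Classical in
/-- Expected number of valid updates (equivalently, of age peaks) up to time `τ`. -/
def mdNumPeaks (μA μB : ℝ) (τ : ℝ) : ℝ≥0∞ :=
  ∫⁻ ω, ∑' x : Fin 2 × ℕ,
    (if delTime (mdServices μB ω x.1) x.2 ≤ τ ∧ CtsFresh (mdServices μB ω) x.1 x.2
      then 1 else 0) ∂(expPathLaw μA)

open Classical in
/-- Expected sum of the age peaks up to time `τ`: the peak belonging to a valid update delivered at
time `D` is the age `Δ(D-)` right before it is reset. -/
def mdSumPeaks (μA μB : ℝ) (τ : ℝ) : ℝ≥0∞ :=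
  ∫⁻ ω, ∑' x : Fin 2 × ℕ,
    (if delTime (mdServices μB ω x.1) x.2 ≤ τ ∧ CtsFresh (mdServices μB ω) x.1 x.2
      then ENNReal.ofReal (ctsAgeBefore (mdServices μB ω) (delTime (mdServices μB ω x.1) x.2))
      else 0) ∂(expPathLaw μA)

/-- Average peak age over the horizon `τ`. -/
def mdMeanPAoI (μA μB : ℝ) (τ : ℝ) : ℝ≥0∞ :=
  mdSumPeaks μA μB τ / mdNumPeaks μA μB τ

/-- The average AoI of the M-D system, in seconds, as a function of the two service rates. -/
def mdAvgAoI (μA μB : ℝ) : ℝ :=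
  longRun (mdMeanAoI μA μB)

/-- The average peak AoI of the M-D system, in seconds, as a function of the two service rates. -/
def mdAvgPAoI (μA μB : ℝ) : ℝ :=
  longRun (mdMeanPAoI μA μB)

end

end AoI

/-!
Both systems are periodic in expectation with the period `T` of sensor B, because the renewal
measure of sensor A is flat: the generation times of sensor A after time `0` have constant
intensity `p` per slot (geometric services, `renewal_geoLaw_singleton`) or `r` per unit of time
(exponential services, `lintegral_renewal_exp`).

At a given time the freshest delivered update of sensor B has a known age `w`, and the last
delivered update of sensor A has an age distributed like the sum of two service times, whatever
the time, as long as this age is not larger than the time itself. So the age just before a time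
exceeds `x < w` with the probability that the sum of two service times exceeds `x`
(`measure_lt_age`, `measure_le_ctsAgeBefore`). An update of sensor A is fresh if and only if its
service time is smaller than `w`, its peak is the minimum of `w` and of its service time plus the
preceding one, and an update of sensor B is fresh if and only if the age just before its delivery
exceeds `T`. The Geo-D model allows simultaneous deliveries, so there the slot in which sensor B
delivers is treated through the complementary event that nothing fresh arrives
(`not_fresh_on_delivery_iff`).

Hence from the second period on each period adds the same amount to the expected cumulative age,
sum of peaks and number of peaks, and the long-run averages exist and are quotients of these
amounts (`tendsto_div_of_periodic_increments`). For Geo-D the amounts are the finite sums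
`geoAgePerPeriod`, `geoPeakSumPerPeriod` and `geoPeaksPerPeriod`; for M-D they are integrals over
`[0, 1]`, with `u` the fraction of the period that has elapsed. With `p = r / δ` and `⌈δ * T⌉₊`
slots per period the sums are Riemann sums of these integrals, whose summands converge since `(1 -
r / δ) ^ n` tends to `Real.exp (-(r * y))` when `n / δ` tends to `y`; dominated convergence
finishes the proof (`tendsto_sum_range_div_integral`).
-/

namespace AoI

noncomputable section

/-! ### Renewal structure of i.i.d. service times -/

section Renewal

variable {α : Type} [AddCommMonoid α]

lemma genTime_succ (ω : ℕ → α) (i : ℕ) : genTime ω (i + 1) = genTime ω i + ω i := by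
  simp [genTime, Finset.sum_range_succ]

lemma delTime_eq (ω : ℕ → α) (i : ℕ) : delTime ω i = genTime ω (i + 1) := by
  rw [genTime_succ]; rfl

variable [MeasurableSpace α]

/-- The renewal measure of i.i.d. service times with law `ν`: the expected number of updates
generated in a set. -/
def renewal (ν : Measure α) : Measure α :=
  Measure.sum fun i => (Measure.infinitePi fun _ : ℕ => ν).map fun ω => genTime ω i

variable [MeasurableAdd₂ α]

@[fun_prop]
lemma measurable_genTime (i : ℕ) : Measurable fun ω : ℕ → α => genTime ω i := by
  unfold genTime; fun_prop

@[fun_prop]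
lemma measurable_delTime (i : ℕ) : Measurable fun ω : ℕ → α => delTime ω i := by
  unfold delTime; fun_prop

variable (ν : Measure α) [IsProbabilityMeasure ν]

/-- The generation time of update `i` is independent of the service times of the updates `i` and
`i + 1`. -/
lemma lintegral_genTime_pair (i : ℕ) {f : α × α × α → ℝ≥0∞} (hf : Measurable f) :
    ∫⁻ ω, f (genTime ω i, ω i, ω (i + 1)) ∂(Measure.infinitePi fun _ : ℕ => ν) =
      ∫⁻ x, ∫⁻ s, ∫⁻ s', f (x, s, s') ∂ν ∂ν
        ∂((Measure.infinitePi fun _ : ℕ => ν).map fun ω => genTime ω i) := by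
  set P := Measure.infinitePi fun _ : ℕ => ν
  have hind : iIndepFun (fun (j : ℕ) (ω : ℕ → α) => ω j) P :=
    iIndepFun_infinitePi (P := fun _ : ℕ => ν) (X := fun _ => id) (fun _ => measurable_id)
  have h1 : IndepFun (fun ω : ℕ → α => genTime ω i) (fun ω : ℕ → α => (ω i, ω (i + 1))) P := by
    have := hind.indepFun_finset (Finset.range i) {i, i + 1}
      (by rw [Finset.disjoint_left]; intro a; simp; omega) (fun j => measurable_pi_apply j)
    have h5 : Measurable fun v : ({i, i + 1} : Finset ℕ) → α =>
        (v ⟨i, by simp⟩, v ⟨i + 1, by simp⟩) :=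
      (measurable_pi_apply _).prodMk (measurable_pi_apply _)
    have := this.comp (φ := fun v => ∑ j, v j) (by fun_prop) h5
    refine this.congr (Eventually.of_forall fun ω => ?_) (Eventually.of_forall fun ω => rfl)
    simp only [genTime, Function.comp]
    exact Finset.sum_coe_sort (Finset.range i) ω
  have h2 : IndepFun (fun ω : ℕ → α => ω i) (fun ω : ℕ → α => ω (i + 1)) P :=
    hind.indepFun (by omega)
  have e : ∀ j, P.map (fun ω => ω j) = ν := fun j =>
    Measure.infinitePi_map_eval (fun _ : ℕ => ν) j
  have h3 := (indepFun_iff_map_prod_eq_prod_map_map (measurable_pi_apply i).aemeasurable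
    (measurable_pi_apply (i + 1)).aemeasurable).1 h2
  have h4 := (indepFun_iff_map_prod_eq_prod_map_map (by fun_prop) (by fun_prop)).1 h1
  rw [e, e] at h3
  rw [h3] at h4
  have : IsProbabilityMeasure (P.map fun ω => genTime ω i) :=
    Measure.isProbabilityMeasure_map (by fun_prop)
  rw [← lintegral_map (f := f) (g := fun ω : ℕ → α => (genTime ω i, ω i, ω (i + 1)))
    hf (by fun_prop), h4, lintegral_prod _ hf.aemeasurable]
  refine lintegral_congr fun x => ?_
  rw [lintegral_prod _ (by fun_prop)]

/-- Expected sums over all updates are integrals against the renewal measure. -/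
lemma tsum_lintegral_genTime_pair {f : α × α × α → ℝ≥0∞} (hf : Measurable f) :
    ∑' i, ∫⁻ ω, f (genTime ω i, ω i, ω (i + 1)) ∂(Measure.infinitePi fun _ : ℕ => ν) =
      ∫⁻ x, ∫⁻ s, ∫⁻ s', f (x, s, s') ∂ν ∂ν ∂(renewal ν) := by
  simp_rw [lintegral_genTime_pair ν _ hf, renewal, lintegral_sum_measure]

/-- The law of a generation time is obtained from the previous one by adding an independent
service time. -/
lemma lintegral_map_genTime_succ (i : ℕ) {f : α → ℝ≥0∞} (hf : Measurable f) :
    ∫⁻ x, f x ∂((Measure.infinitePi fun _ : ℕ => ν).map fun ω => genTime ω (i + 1)) =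
      ∫⁻ x, ∫⁻ s, f (x + s) ∂ν
        ∂((Measure.infinitePi fun _ : ℕ => ν).map fun ω => genTime ω i) := by
  have := lintegral_genTime_pair ν i (f := fun p => f (p.1 + p.2.1)) (by fun_prop)
  rw [lintegral_map hf (by fun_prop)]
  simpa [genTime_succ] using this

lemma lintegral_map_genTime_zero {f : α → ℝ≥0∞} (hf : Measurable f) :
    ∫⁻ x, f x ∂((Measure.infinitePi fun _ : ℕ => ν).map fun ω => genTime ω 0) = f 0 := by
  rw [lintegral_map hf (by fun_prop)]
  simp [genTime]

/-- The renewal equation. -/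
lemma lintegral_renewal {f : α → ℝ≥0∞} (hf : Measurable f) :
    ∫⁻ x, f x ∂(renewal ν) = f 0 + ∫⁻ x, ∫⁻ s, f (x + s) ∂ν ∂(renewal ν) := by
  simp only [renewal, lintegral_sum_measure]
  rw [tsum_eq_zero_add' ENNReal.summable, lintegral_map_genTime_zero ν hf]
  simp_rw [lintegral_map_genTime_succ ν _ hf]

end Renewal

lemma ae_forall_infinitePi {α : Type} [MeasurableSpace α] (ν : Measure α)
    [IsProbabilityMeasure ν] {p : α → Prop} (hp : ∀ᵐ x ∂ν, p x) :
    ∀ᵐ ω ∂(Measure.infinitePi fun _ : ℕ => ν), ∀ i, p (ω i) := by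
  rw [ae_all_iff]
  intro i
  have h := Measure.infinitePi_map_eval (fun _ : ℕ => ν) i
  rw [← h] at hp
  exact ae_of_ae_map (measurable_pi_apply i).aemeasurable hp

/-! ### Sample paths of two zero-wait queues -/

section Paths

variable {α : Type} [AddCommMonoid α] [LinearOrder α] [IsOrderedCancelAddMonoid α]

lemma strictMono_genTime {ω : ℕ → α} (hω : ∀ i, 0 < ω i) : StrictMono (genTime ω) :=
  strictMono_nat_of_lt_succ fun i => by
    rw [genTime_succ]; exact lt_add_of_pos_right _ (hω i)

end Paths

lemma services_zero {α : Type} (a : ℕ → α) (T : α) : services a T 0 = a := rfl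

lemma services_one {α : Type} (a : ℕ → α) (T : α) : services a T 1 = fun _ => T := rfl

lemma genTime_const (T : ℕ) (i : ℕ) : genTime (fun _ => T) i = i * T := by
  simp [genTime]

lemma le_genTime_nat {ω : ℕ → ℕ} (hω : ∀ i, 0 < ω i) (n : ℕ) : n ≤ genTime ω n :=
  (strictMono_genTime hω).le_apply

/-- An unbounded sequence starting below `t` has a last term below `t`. -/
lemma exists_last_lt {α : Type} [LinearOrder α] {g : ℕ → α} {t : α} {i : ℕ}
    (hi : g i < t) (hg : ∃ n, t ≤ g n) (hmono : Monotone g) :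
    ∃ j, i ≤ j ∧ g j < t ∧ t ≤ g (j + 1) := by
  classical
  have h0 : i < Nat.find hg := by
    by_contra h
    exact absurd (Nat.find_spec hg) (not_le.2 ((hmono (not_lt.1 h)).trans_lt hi))
  refine ⟨Nat.find hg - 1, by omega, ?_, ?_⟩
  · exact not_le.1 (Nat.find_min hg (by omega))
  · rw [Nat.sub_add_cancel (by omega)]; exact Nat.find_spec hg

/-- An increasing sequence crosses a level at most once. -/
lemma eq_of_crossing {α : Type} [LinearOrder α] {g : ℕ → α} {t : α} (hmono : Monotone g)
    {i j : ℕ} (hi : g i < t) (hi' : t ≤ g (i + 1)) (hj : g j < t) (hj' : t ≤ g (j + 1)) :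
    i = j := by
  rcases lt_trichotomy i j with h | h | h
  · exact absurd (hi'.trans (hmono h)) (not_le.2 hj)
  · exact h
  · exact absurd (hj'.trans (hmono h)) (not_le.2 hi)

/-! ### The discrete age of information -/

/-- The age exceeds `x` if and only if every update delivered earlier was generated more than `x`
slots ago. -/
lemma lt_age_iff (s : Fin 2 → ℕ → ℕ) (t x : ℕ) :
    x < age s t ↔ x < t ∧ ∀ q i, delTime (s q) i < t → genTime (s q) i + x < t := by
  induction t generalizing x with
  | zero => simp [age]
  | succ t ih =>
    have hs : ∀ S : Set ℕ, S.Nonempty → (x < sInf S ↔ ∀ a ∈ S, x < a) := fun S hS =>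
      ⟨fun h a ha => h.trans_le (Nat.sInf_le ha), fun h => h _ (Nat.sInf_mem hS)⟩
    rw [age, hs _ (Set.insert_nonempty _ _)]
    simp only [Set.mem_insert_iff, Set.mem_image, servedAges, Set.mem_ofPred_eq]
    have hgd : ∀ q i, genTime (s q) i ≤ delTime (s q) i := fun q i => Nat.le_add_right _ _
    rcases x with _ | x
    · refine iff_of_true ?_ ⟨Nat.succ_pos _, fun q i h => ?_⟩
      · rintro a (rfl | ⟨b, -, rfl⟩) <;> exact Nat.succ_pos _
      · exact (hgd q i).trans_lt h
    · constructor
      · intro h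
        have h1 := (ih x).1 (by have := h _ (Or.inl rfl); omega)
        refine ⟨by omega, fun q i hd => ?_⟩
        rcases Nat.lt_succ_iff_lt_or_eq.1 hd with hd | hd
        · have := h1.2 q i hd; omega
        · have := h _ (Or.inr ⟨_, ⟨q, i, hd, rfl⟩, rfl⟩); omega
      · rintro ⟨h1, h2⟩ a (rfl | ⟨b, ⟨q, i, hd, rfl⟩, rfl⟩)
        · have := (ih x).2 ⟨by omega, fun q i hd => by have := h2 q i (by omega); omega⟩
          omega
        · have := h2 q i (by omega); omega

lemma fresh_iff (s : Fin 2 → ℕ → ℕ) (t : ℕ) :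
    Fresh s t ↔ ∃ q i, delTime (s q) i = t ∧ t - genTime (s q) i < age s t := by
  simp only [Fresh, servedAges, Set.mem_ofPred_eq]
  constructor
  · rintro ⟨a, ⟨q, i, h, rfl⟩, h'⟩; exact ⟨q, i, h, h'⟩
  · rintro ⟨q, i, h, h'⟩; exact ⟨_, ⟨q, i, h, rfl⟩, h'⟩

/-- Every update that the queue with service times `ω` delivers before slot `t` was generated more
than `x` slots before `t`. -/
def Older (ω : ℕ → ℕ) (t x : ℕ) : Prop :=
  ∀ i, delTime ω i < t → genTime ω i + x < t

/-- Sensor B alone keeps the age in slot `k * T + 1 + j` at most `T + 1 + j`. -/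
lemma lt_age_services_iff {ω : ℕ → ℕ} {T k j : ℕ} (hj : j < T) (hk : 1 ≤ k) (x : ℕ) :
    x < age (services ω T) (k * T + 1 + j) ↔ x < T + 1 + j ∧ Older ω (k * T + 1 + j) x := by
  rw [lt_age_iff, Fin.forall_fin_two]
  simp only [services_zero, services_one, delTime_eq, genTime_const, Older]
  obtain ⟨k, rfl⟩ : ∃ l, k = l + 1 := ⟨k - 1, by omega⟩
  constructor
  · rintro ⟨-, h, hB⟩
    refine ⟨?_, h⟩
    have := hB k (by omega)
    nlinarith
  · rintro ⟨hx, h⟩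
    refine ⟨by nlinarith, h, fun i hi => ?_⟩
    have : i + 1 < k + 2 := by
      by_contra hc
      have : (k + 2) * T ≤ (i + 1) * T := Nat.mul_le_mul_right _ (by omega)
      nlinarith
    have : i * T ≤ k * T := Nat.mul_le_mul_right _ (by omega)
    nlinarith

/-- Between two deliveries of sensor B, an update of sensor A is fresh precisely when its service
started after the latest delivered update of sensor B was generated. -/
lemma fresh_off_delivery_iff {ω : ℕ → ℕ} (hω : ∀ i, 0 < ω i) {T k j : ℕ} (hj : j + 1 < T)
    (hk : 1 ≤ k) :
    Fresh (services ω T) (k * T + 1 + j) ↔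
      ∃ i, delTime ω i = k * T + 1 + j ∧ ω i < T + 1 + j := by
  have hB : ∀ i, delTime (services ω T 1) i ≠ k * T + 1 + j := by
    intro i hi
    simp only [services_one, delTime_eq, genTime_const] at hi
    rcases le_or_gt (i + 1) k with h | h
    · have := Nat.mul_le_mul_right T h; omega
    · have : (k + 1) * T ≤ (i + 1) * T := Nat.mul_le_mul_right T h
      nlinarith
  have hkT : T ≤ k * T := Nat.le_mul_of_pos_left T hk
  rw [fresh_iff, Fin.exists_fin_two]
  constructor
  · rintro (⟨i, hi, ha⟩ | ⟨i, hi, -⟩)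
    · refine ⟨i, hi, ?_⟩
      rw [lt_age_services_iff (by omega) hk] at ha
      have := ha.1
      simp only [services_zero, delTime] at hi this
      omega
    · exact absurd hi (hB i)
  · rintro ⟨i, hi, hw⟩
    refine Or.inl ⟨i, hi, ?_⟩
    rw [lt_age_services_iff (by omega) hk]
    simp only [services_zero]
    rw [delTime] at hi
    refine ⟨by omega, fun l hl => ?_⟩
    rw [delTime_eq, ← hi, ← genTime_succ, (strictMono_genTime hω).lt_iff_lt] at hl
    have := strictMono_genTime hω (show l < i by omega)
    omega

lemma lt_age_and_fresh_off_delivery_iff {ω : ℕ → ℕ} (hω : ∀ i, 0 < ω i) {T k j x : ℕ}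
    (hj : j + 1 < T) (hk : 1 ≤ k) (hx : x < T + 1 + j) :
    (x < age (services ω T) (k * T + 1 + j) ∧ Fresh (services ω T) (k * T + 1 + j)) ↔
      (∃ i, delTime ω i = k * T + 1 + j ∧ ω i < T + 1 + j) ∧
        ¬ ∃ i, delTime ω (i + 1) = k * T + 1 + j ∧ ω i + ω (i + 1) ≤ x := by
  rw [fresh_off_delivery_iff hω hj hk, lt_age_services_iff (by omega) hk, and_comm]
  refine and_congr_right fun ⟨n, hn, hn'⟩ => ?_
  constructor
  · rintro ⟨-, ho⟩ ⟨i, hi, hi'⟩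
    rw [delTime_eq, genTime_succ, genTime_succ] at hi
    have := ho i (by rw [delTime_eq, genTime_succ]; have := hω (i + 1); omega)
    omega
  · intro h
    refine ⟨hx, fun l hl => ?_⟩
    rw [delTime_eq, ← hn, delTime_eq, (strictMono_genTime hω).lt_iff_lt] at hl
    obtain ⟨i, rfl⟩ : ∃ i, n = i + 1 := ⟨n - 1, by omega⟩
    have h2 : x < ω i + ω (i + 1) := by
      by_contra hc
      exact h ⟨i, hn, not_lt.1 hc⟩
    have h3 := (strictMono_genTime hω).monotone (show l ≤ i by omega)
    rw [delTime_eq, genTime_succ, genTime_succ] at hn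
    omega

/-- In a slot in which sensor B delivers, nothing fresh arrives precisely when sensor A delivers
nothing and has already delivered an update that is at least as fresh as the one of sensor B. -/
lemma not_fresh_on_delivery_iff {ω : ℕ → ℕ} (hω : ∀ i, 0 < ω i) {T k : ℕ} (hT : 0 < T)
    (hk : 1 ≤ k) :
    ¬ Fresh (services ω T) (k * T + T) ↔
      ¬ Older ω (k * T + T) T ∧ ∀ i, delTime ω i ≠ k * T + T := by
  have ht : k * T + T = k * T + 1 + (T - 1) := by omega
  have hkT : T ≤ k * T := Nat.le_mul_of_pos_left T hk
  have hage : ∀ x, x < age (services ω T) (k * T + T) ↔ x < 2 * T ∧ Older ω (k * T + T) x := by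
    intro x
    rw [ht, lt_age_services_iff (by omega) hk, show T + 1 + (T - 1) = 2 * T by omega]
  rw [fresh_iff, Fin.exists_fin_two, not_or]
  constructor
  · rintro ⟨hA, hB⟩
    have hO : ¬ Older ω (k * T + T) T := by
      intro ho
      refine hB ⟨k, ?_, ?_⟩
      · simp only [services_one, delTime_eq, genTime_const]; ring
      · rw [hage]
        simp only [services_one, genTime_const, Nat.add_sub_cancel_left]
        exact ⟨by omega, ho⟩
    refine ⟨hO, fun n hn => hA ⟨n, hn, ?_⟩⟩
    simp only [Older, not_forall, not_lt] at hO
    obtain ⟨l, hl, hl'⟩ := hO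
    rw [hage]
    simp only [services_zero]
    rw [delTime_eq, ← hn, delTime_eq, (strictMono_genTime hω).lt_iff_lt] at hl
    have h3 := (strictMono_genTime hω) (show l < n by omega)
    rw [delTime_eq, genTime_succ] at hn
    have := hω n
    refine ⟨by omega, fun i hi => ?_⟩
    rw [delTime_eq, ← hn, ← genTime_succ, (strictMono_genTime hω).lt_iff_lt] at hi
    have h4 := (strictMono_genTime hω) (show i < n by omega)
    omega
  · rintro ⟨hO, hn⟩
    refine ⟨fun ⟨i, hi, _⟩ => hn i hi, fun ⟨i, hi, hi'⟩ => hO ?_⟩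
    simp only [services_one, delTime_eq, genTime_const] at hi hi'
    have : i = k := by
      have : (i + 1) * T = (k + 1) * T := by rw [hi]; ring
      have := Nat.eq_of_mul_eq_mul_right hT this
      omega
    subst this
    have := ((hage _).1 hi').2
    rwa [Nat.add_sub_cancel_left] at this

/-- Some update delivered before `t` is at most `x` slots old if and only if the last delivered one
is. Singling out the last one turns a union of events into a disjoint union. -/
lemma not_older_iff {ω : ℕ → ℕ} (hω : ∀ i, 0 < ω i) (t x : ℕ) :
    ¬ Older ω t x ↔
      ∃ i, genTime ω i + ω i < t ∧ t ≤ genTime ω i + ω i + ω (i + 1) ∧ t ≤ genTime ω i + x := by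
  simp only [Older, not_forall, not_lt]
  constructor
  · rintro ⟨i, hi, hx⟩
    rw [delTime_eq] at hi
    obtain ⟨j, hij, hj, hj'⟩ := exists_last_lt hi ⟨t, le_genTime_nat hω t⟩
      (strictMono_genTime hω).monotone
    obtain ⟨j, rfl⟩ : ∃ l, j = l + 1 := ⟨j - 1, by omega⟩
    have := (strictMono_genTime hω).monotone (show i ≤ j by omega)
    rw [genTime_succ (i := j + 1)] at hj'
    rw [genTime_succ] at hj hj'
    exact ⟨j, hj, hj', by omega⟩
  · rintro ⟨i, h1, -, h3⟩
    exact ⟨i, h1, h3⟩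

/-! ### Probabilities for geometric service times -/

/-- The probability that one of countably many mutually exclusive events occurs. -/
lemma measure_exists_eq_tsum {Ω : Type*} [MeasurableSpace Ω] (μ : Measure Ω) {p : ℕ → Ω → Prop}
    (hp : ∀ i, MeasurableSet {ω | p i ω}) (hu : ∀ᵐ ω ∂μ, ∀ i j, p i ω → p j ω → i = j) :
    μ {ω | ∃ i, p i ω} = ∑' i, μ {ω | p i ω} := by
  rw [Set.ofPred_exists]
  refine measure_iUnion₀ (fun i j hij => ?_) fun i => (hp i).nullMeasurableSet
  refine measure_mono_null ?_ (ae_iff.1 hu)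
  rintro ω ⟨h1, h2⟩ h
  exact hij (h i j h1 h2)

lemma lintegral_ite_one {Ω : Type*} [MeasurableSpace Ω] (μ : Measure Ω) {p : Ω → Prop}
    [DecidablePred p] (hp : MeasurableSet {ω | p ω}) :
    ∫⁻ ω, (if p ω then 1 else 0) ∂μ = μ {ω | p ω} := by
  rw [← lintegral_indicator_one hp]
  refine lintegral_congr fun ω => ?_
  by_cases h : p ω <;> simp [h]

section Geometric

variable {p : ℝ}

lemma geoLaw_apply (hp : 0 < p) (hp1 : p ≤ 1) (s : Set ℕ) :
    geoLaw p s = ∑' n, ENNReal.ofReal ((1 - p) ^ n * p) * s.indicator 1 (n + 1) := by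
  classical
  have h : (Set.projIcc 0 1 zero_le_one p : ℝ) = p := by
    rw [Set.projIcc_of_mem zero_le_one ⟨hp.le, hp1⟩]
  have h0 : Set.projIcc 0 1 zero_le_one p ≠ 0 := by
    intro h'
    have := congrArg Subtype.val h'
    rw [h] at this
    exact hp.ne' this
  rw [geoLaw, Measure.map_apply (by fun_prop) (by measurability), geometricMeasure_eq h0,
    Measure.sum_apply _ (by measurability)]
  refine tsum_congr fun n => ?_
  rw [Measure.smul_apply, Measure.dirac_apply' _ (by measurability), h]
  rfl

lemma isProbabilityMeasure_geoLaw : IsProbabilityMeasure (geoLaw p) :=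
  Measure.isProbabilityMeasure_map (by fun_prop)

attribute [local instance] isProbabilityMeasure_geoLaw

lemma geoLaw_singleton_succ (hp : 0 < p) (hp1 : p ≤ 1) (n : ℕ) :
    geoLaw p {n + 1} = ENNReal.ofReal ((1 - p) ^ n * p) := by
  rw [geoLaw_apply hp hp1, tsum_eq_single n (by intro m hm; simp [hm])]
  simp

lemma geoLaw_singleton_zero (hp : 0 < p) (hp1 : p ≤ 1) : geoLaw p {0} = 0 := by
  rw [geoLaw_apply hp hp1]; simp

lemma geoLaw_pos (hp : 0 < p) (hp1 : p ≤ 1) : ∀ᵐ x ∂(geoLaw p), 0 < x := by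
  rw [ae_iff]
  convert geoLaw_singleton_zero hp hp1 using 2
  ext; simp

lemma lintegral_geoLaw (hp : 0 < p) (hp1 : p ≤ 1) (f : ℕ → ℝ≥0∞) :
    ∫⁻ x, f x ∂(geoLaw p) = ∑' n, f (n + 1) * ENNReal.ofReal ((1 - p) ^ n * p) := by
  rw [lintegral_countable', tsum_eq_zero_add' ENNReal.summable, geoLaw_singleton_zero hp hp1]
  simp [geoLaw_singleton_succ hp hp1]

/-- The tail of the geometric law. -/
lemma geoLaw_Ioi (hp : 0 < p) (hp1 : p ≤ 1) (n : ℕ) :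
    geoLaw p {s | n < s} = ENNReal.ofReal ((1 - p) ^ n) := by
  have h : {s | n < s} = (Finset.range (n + 1) : Set ℕ)ᶜ := by ext; simp
  have h2 : geoLaw p (Finset.range (n + 1) : Set ℕ) = ENNReal.ofReal (1 - (1 - p) ^ n) := by
    rw [← sum_measure_singleton, Finset.sum_range_succ', geoLaw_singleton_zero hp hp1, add_zero]
    simp_rw [geoLaw_singleton_succ hp hp1]
    rw [← ENNReal.ofReal_sum_of_nonneg fun i _ => mul_nonneg (pow_nonneg (by linarith) _) hp.le]
    congr 1
    induction n with
    | zero => simp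
    | succ n ih =>
      rw [Finset.sum_range_succ, ih (by ext; simp)]; ring
  rw [h, prob_compl_eq_one_sub (by measurability), h2, ← ENNReal.ofReal_one,
    ← ENNReal.ofReal_sub]
  · congr 1; ring
  · have : (1 - p) ^ n ≤ 1 := pow_le_one₀ (by linarith) (by linarith)
    linarith

/-- The renewal measure of a Bernoulli process charges every positive slot with mass `p`. -/
lemma renewal_geoLaw_singleton (hp : 0 < p) (hp1 : p ≤ 1) (n : ℕ) :
    renewal (geoLaw p) {n + 1} = ENNReal.ofReal p := by
  set u := fun g : ℕ => renewal (geoLaw p) {g} with hu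
  have hrec : ∀ m, u m = (if m = 0 then 1 else 0) +
      ∑ x ∈ Finset.range m, u x * ENNReal.ofReal ((1 - p) ^ (m - 1 - x) * p) := by
    intro m
    have := lintegral_renewal (geoLaw p) (f := fun x => if x = m then 1 else 0)
      (Measurable.of_discrete)
    have h1 : ∫⁻ x, (if x = m then 1 else 0) ∂(renewal (geoLaw p)) = u m :=
      lintegral_ite_one _ (p := fun x => x = m) (by measurability)
    rw [h1] at this
    rw [this, lintegral_countable', tsum_eq_sum (s := Finset.range m)]
    · congr 1
      · simp [eq_comm]
      refine Finset.sum_congr rfl fun x hx => ?_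
      rw [Finset.mem_range] at hx
      rw [lintegral_geoLaw hp hp1, tsum_eq_single (m - 1 - x)]
      · rw [if_pos (by omega), one_mul, mul_comm]
      · intro n hn
        rw [if_neg (by omega), zero_mul]
    · intro x hx
      rw [Finset.mem_range] at hx
      rw [lintegral_geoLaw hp hp1, ENNReal.tsum_eq_zero.2, zero_mul]
      intro n
      rw [if_neg (by omega), zero_mul]
  change u (n + 1) = _
  induction n with
  | zero => rw [hrec, Finset.sum_range_one, hrec 0]; simp
  | succ n ih =>
    rw [hrec, Finset.sum_range_succ, ih]
    have h1 : ∑ x ∈ Finset.range (n + 1), u x * ENNReal.ofReal ((1 - p) ^ (n + 1 + 1 - 1 - x) * p)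
        = ENNReal.ofReal (1 - p) * u (n + 1) := by
      rw [hrec (n + 1), if_neg (by omega), zero_add, Finset.mul_sum]
      refine Finset.sum_congr rfl fun x hx => ?_
      rw [Finset.mem_range] at hx
      rw [mul_left_comm, ← ENNReal.ofReal_mul (by linarith), ← mul_assoc, ← pow_succ']
      congr 5
      omega
    rw [h1, ih, if_neg (by omega), zero_add]
    simp only [Nat.add_sub_cancel, Nat.sub_self, pow_zero, one_mul]
    rw [← ENNReal.ofReal_mul (by linarith), ← ENNReal.ofReal_mul (by linarith),
      ← ENNReal.ofReal_add (by nlinarith) (by nlinarith)]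
    congr 1; ring

/-- A window of positive slots sees the renewal measure as `p` times counting measure. -/
lemma lintegral_renewal_geoLaw_window (hp : 0 < p) (hp1 : p ≤ 1) {t X : ℕ} (hX : X < t)
    (φ : ℕ → ℝ≥0∞) {f : ℕ → ℝ≥0∞}
    (hf : ∀ g, f g = if g < t ∧ t ≤ g + X then φ (t - g) else 0) :
    ∫⁻ g, f g ∂(renewal (geoLaw p)) =
      ENNReal.ofReal p * ∑ m ∈ Finset.range X, φ (m + 1) := by
  simp_rw [hf]
  rw [lintegral_countable', tsum_eq_sum (s := Finset.range t) (fun g hg => by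
    rw [Finset.mem_range] at hg; rw [if_neg (by omega), zero_mul]), ← Finset.sum_range_reflect,
    Finset.mul_sum]
  symm
  rw [← Finset.sum_subset (Finset.range_subset_range.2 hX.le)]
  · refine Finset.sum_congr rfl fun m hm => ?_
    rw [Finset.mem_range] at hm
    rw [if_pos (by omega), show t - (t - 1 - m) = m + 1 by omega,
      show t - 1 - m = (t - 2 - m) + 1 by omega, renewal_geoLaw_singleton hp hp1, mul_comm]
  · intro m hm hm'
    rw [Finset.mem_range] at hm hm'
    rw [if_neg (by omega), zero_mul]

/-- The probability that the sum of two geometric service times is at most `x`. -/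
def geoPairCdf (p : ℝ) (x : ℕ) : ℝ :=
  ∑ m ∈ Finset.range x, m * p ^ 2 * (1 - p) ^ (m - 1)

/-- Averages over a first service time `n + 1` when the second one completes the event with
probability `c * (1 - p) ^ (m - 1 - n)`: all `m` possible values of `n` contribute equally. -/
lemma lintegral_geoLaw_first (hp : 0 < p) (hp1 : p ≤ 1) (m : ℕ) (A : ℕ → ℕ → Prop)
    (c : ℝ) (hA : ∀ n s', A (n + 1) s' → n < m)
    (hc : ∀ n, n < m → geoLaw p {s' | A (n + 1) s'} = ENNReal.ofReal (c * (1 - p) ^ (m - 1 - n))) :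
    ∫⁻ s, geoLaw p {s' | A s s'} ∂(geoLaw p) =
      ENNReal.ofReal (m * p * c * (1 - p) ^ (m - 1)) := by
  have hq : 0 ≤ 1 - p := by linarith
  rw [lintegral_geoLaw hp hp1, tsum_eq_sum (s := Finset.range m)]
  · have : ∀ n ∈ Finset.range m, geoLaw p {s' | A (n + 1) s'} * ENNReal.ofReal ((1 - p) ^ n * p) =
        ENNReal.ofReal (p * c * (1 - p) ^ (m - 1)) := by
      intro n hn
      rw [Finset.mem_range] at hn
      rw [hc n hn, ← ENNReal.ofReal_mul' (mul_nonneg (pow_nonneg hq _) hp.le)]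
      congr 1
      have : (1 - p) ^ (m - 1) = (1 - p) ^ (m - 1 - n) * (1 - p) ^ n := by
        rw [← pow_add]; congr 1; omega
      rw [this]; ring
    rw [Finset.sum_congr rfl this, Finset.sum_const, Finset.card_range, nsmul_eq_mul,
      ← ENNReal.ofReal_natCast, ← ENNReal.ofReal_mul (by positivity)]
    congr 1; ring
  · intro n hn
    rw [Finset.mem_range] at hn
    have : {s' | A (n + 1) s'} = ∅ := by
      ext s'; simp; intro h; exact hn (hA n s' h)
    rw [this]; simp

/-- The probability of a deterministic relation between the generation time and the service times
of two successive updates, summed over all updates. -/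
lemma tsum_measure_relation (ν : Measure ℕ) [IsProbabilityMeasure ν] (R : ℕ → ℕ → ℕ → Prop) :
    ∑' i, (Measure.infinitePi fun _ : ℕ => ν) {ω | R (genTime ω i) (ω i) (ω (i + 1))} =
      ∫⁻ x, ∫⁻ s, ν {s' | R x s s'} ∂ν ∂(renewal ν) := by
  classical
  have := tsum_lintegral_genTime_pair ν (f := fun q => if R q.1 q.2.1 q.2.2 then 1 else 0)
    (Measurable.of_discrete)
  have h1 : ∀ x s, ∫⁻ s', (if R x s s' then 1 else 0) ∂ν = ν {s' | R x s s'} := fun x s =>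
    lintegral_ite_one _ (by measurability)
  simp only [h1] at this
  rw [← this]
  refine tsum_congr fun i => ?_
  have hm : Measurable fun ω : ℕ → ℕ => (genTime ω i, ω i, ω (i + 1)) := by fun_prop
  have hM : MeasurableSet {ω : ℕ → ℕ | R (genTime ω i) (ω i) (ω (i + 1))} :=
    hm (t := {q : ℕ × ℕ × ℕ | R q.1 q.2.1 q.2.2}) (Set.to_countable _).measurableSet
  exact (lintegral_ite_one _ hM).symm

lemma measurableSet_relation (R : ℕ → ℕ → ℕ → Prop) (i : ℕ) :
    MeasurableSet {ω : ℕ → ℕ | R (genTime ω i) (ω i) (ω (i + 1))} := by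
  have hm : Measurable fun ω : ℕ → ℕ => (genTime ω i, ω i, ω (i + 1)) := by fun_prop
  exact hm (t := {q : ℕ × ℕ × ℕ | R q.1 q.2.1 q.2.2}) (Set.to_countable _).measurableSet

lemma ae_geoPathLaw_pos (hp : 0 < p) (hp1 : p ≤ 1) : ∀ᵐ ω ∂(geoPathLaw p), ∀ i, 0 < ω i :=
  ae_forall_infinitePi (geoLaw p) (geoLaw_pos hp hp1)

/-- The probability that sensor A has delivered an update that is at most `x` slots old. -/
lemma measure_not_older (hp : 0 < p) (hp1 : p ≤ 1) {t x : ℕ} (hx : x < t) :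
    geoPathLaw p {ω | ¬ Older ω t x} = ENNReal.ofReal (geoPairCdf p x) := by
  have hq : 0 ≤ 1 - p := by linarith
  have h0 : geoPathLaw p {ω | ¬ Older ω t x} = geoPathLaw p {ω | ∃ i, genTime ω i + ω i < t ∧
      t ≤ genTime ω i + ω i + ω (i + 1) ∧ t ≤ genTime ω i + x} := by
    refine measure_congr ?_
    filter_upwards [ae_geoPathLaw_pos hp hp1] with ω hω
    exact propext (not_older_iff hω t x)
  rw [h0, measure_exists_eq_tsum]
  rotate_left
  · exact fun i => measurableSet_relation (fun g s s' => g + s < t ∧ t ≤ g + s + s' ∧ t ≤ g + x) i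
  · filter_upwards [ae_geoPathLaw_pos hp hp1] with ω hω i j hi hj
    have := eq_of_crossing (strictMono_genTime hω).monotone (t := t) (i := i + 1) (j := j + 1)
      (by rw [genTime_succ]; exact hi.1) (by rw [genTime_succ, genTime_succ]; exact hi.2.1)
      (by rw [genTime_succ]; exact hj.1) (by rw [genTime_succ, genTime_succ]; exact hj.2.1)
    omega
  · rw [geoPathLaw, tsum_measure_relation (geoLaw p)
      (fun g s s' => g + s < t ∧ t ≤ g + s + s' ∧ t ≤ g + x)]
    have h1 : ∀ g, ∫⁻ s, geoLaw p {s' | g + s < t ∧ t ≤ g + s + s' ∧ t ≤ g + x} ∂(geoLaw p) =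
        if g < t ∧ t ≤ g + x then
          ∫⁻ s, geoLaw p {s' | s < t - g ∧ t - g ≤ s + s'} ∂(geoLaw p) else 0 := by
      intro g
      split_ifs with h
      · refine lintegral_congr fun s => ?_
        congr 1; ext s'
        simp only [Set.mem_ofPred_eq]
        omega
      · rw [lintegral_congr (g := fun _ => 0), lintegral_zero]
        intro s
        convert measure_empty (μ := geoLaw p)
        ext s'; simp; omega
    rw [lintegral_renewal_geoLaw_window hp hp1 hx
      (fun v => ∫⁻ s, geoLaw p {s' | s < v ∧ v ≤ s + s'} ∂(geoLaw p)) h1]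
    have h2 : ∀ m : ℕ, ∫⁻ s, geoLaw p {s' | s < m + 1 ∧ m + 1 ≤ s + s'} ∂(geoLaw p) =
        ENNReal.ofReal (m * p * 1 * (1 - p) ^ (m - 1)) := by
      intro m
      refine lintegral_geoLaw_first hp hp1 m (fun s s' => s < m + 1 ∧ m + 1 ≤ s + s') 1
        (fun n s' h => by omega) fun n hn => ?_
      rw [one_mul, ← geoLaw_Ioi hp hp1]
      congr 1; ext s'
      simp only [Set.mem_ofPred_eq]; omega
    simp_rw [h2]
    rw [← ENNReal.ofReal_sum_of_nonneg (fun m _ => by positivity), ← ENNReal.ofReal_mul hp.le,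
      geoPairCdf, Finset.mul_sum]
    congr 1
    exact Finset.sum_congr rfl fun m _ => by ring

/-- The same probability, when moreover sensor A delivers nothing in slot `t`. -/
lemma measure_not_older_and_no_delivery (hp : 0 < p) (hp1 : p ≤ 1) {t x : ℕ} (hx : x < t) :
    geoPathLaw p {ω | ¬ Older ω t x ∧ ∀ i, delTime ω i ≠ t} =
      ENNReal.ofReal ((1 - p) * geoPairCdf p x) := by
  have hq : 0 ≤ 1 - p := by linarith
  have h0 : geoPathLaw p {ω | ¬ Older ω t x ∧ ∀ i, delTime ω i ≠ t} =
      geoPathLaw p {ω | ∃ i, genTime ω i + ω i < t ∧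
      t < genTime ω i + ω i + ω (i + 1) ∧ t ≤ genTime ω i + x} := by
    refine measure_congr ?_
    filter_upwards [ae_geoPathLaw_pos hp hp1] with ω hω
    refine propext ?_
    change (¬ Older ω t x ∧ ∀ i, delTime ω i ≠ t) ↔ ∃ i, genTime ω i + ω i < t ∧
      t < genTime ω i + ω i + ω (i + 1) ∧ t ≤ genTime ω i + x
    rw [not_older_iff hω]
    constructor
    · rintro ⟨⟨i, h1, h2, h3⟩, h4⟩
      refine ⟨i, h1, lt_of_le_of_ne h2 ?_, h3⟩
      have := h4 (i + 1)
      rw [delTime_eq, genTime_succ, genTime_succ] at this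
      omega
    · rintro ⟨i, h1, h2, h3⟩
      refine ⟨⟨i, h1, h2.le, h3⟩, fun j hj => ?_⟩
      rw [delTime_eq] at hj
      rw [← genTime_succ, ← hj, (strictMono_genTime hω).lt_iff_lt] at h1
      rw [← genTime_succ, ← genTime_succ, ← hj, (strictMono_genTime hω).lt_iff_lt] at h2
      omega
  rw [h0, measure_exists_eq_tsum]
  rotate_left
  · exact fun i => measurableSet_relation (fun g s s' => g + s < t ∧ t < g + s + s' ∧ t ≤ g + x) i
  · filter_upwards [ae_geoPathLaw_pos hp hp1] with ω hω i j hi hj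
    have := eq_of_crossing (strictMono_genTime hω).monotone (t := t) (i := i + 1) (j := j + 1)
      (by rw [genTime_succ]; exact hi.1) (by rw [genTime_succ, genTime_succ]; exact hi.2.1.le)
      (by rw [genTime_succ]; exact hj.1) (by rw [genTime_succ, genTime_succ]; exact hj.2.1.le)
    omega
  · rw [geoPathLaw, tsum_measure_relation (geoLaw p)
      (fun g s s' => g + s < t ∧ t < g + s + s' ∧ t ≤ g + x)]
    have h1 : ∀ g, ∫⁻ s, geoLaw p {s' | g + s < t ∧ t < g + s + s' ∧ t ≤ g + x} ∂(geoLaw p) =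
        if g < t ∧ t ≤ g + x then
          ∫⁻ s, geoLaw p {s' | s < t - g ∧ t - g < s + s'} ∂(geoLaw p) else 0 := by
      intro g
      split_ifs with h
      · refine lintegral_congr fun s => ?_
        congr 1; ext s'
        simp only [Set.mem_ofPred_eq]
        omega
      · rw [lintegral_congr (g := fun _ => 0), lintegral_zero]
        intro s
        convert measure_empty (μ := geoLaw p)
        ext s'; simp; omega
    rw [lintegral_renewal_geoLaw_window hp hp1 hx
      (fun v => ∫⁻ s, geoLaw p {s' | s < v ∧ v < s + s'} ∂(geoLaw p)) h1]
    have h2 : ∀ m : ℕ, ∫⁻ s, geoLaw p {s' | s < m + 1 ∧ m + 1 < s + s'} ∂(geoLaw p) =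
        ENNReal.ofReal (m * p * (1 - p) * (1 - p) ^ (m - 1)) := by
      intro m
      refine lintegral_geoLaw_first hp hp1 m (fun s s' => s < m + 1 ∧ m + 1 < s + s') (1 - p)
        (fun n s' h => by omega) fun n hn => ?_
      rw [← pow_succ', ← geoLaw_Ioi hp hp1]
      congr 1; ext s'
      simp only [Set.mem_ofPred_eq]; omega
    simp_rw [h2]
    rw [← ENNReal.ofReal_sum_of_nonneg (fun m _ => by positivity), ← ENNReal.ofReal_mul hp.le,
      geoPairCdf, Finset.mul_sum, Finset.mul_sum]
    congr 1
    exact Finset.sum_congr rfl fun m _ => by ring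

/-- The probability that sensor A delivers in slot `t` after a service shorter than `w`. -/
lemma measure_delivery_lt (hp : 0 < p) (hp1 : p ≤ 1) {t w : ℕ} (hw : 0 < w) (hwt : w ≤ t) :
    geoPathLaw p {ω | ∃ i, delTime ω i = t ∧ ω i < w} =
      ENNReal.ofReal (p * (1 - (1 - p) ^ (w - 1))) := by
  have hq : 0 ≤ 1 - p := by linarith
  rw [measure_exists_eq_tsum]
  rotate_left
  · exact fun i => measurableSet_relation (fun g s _ => g + s = t ∧ s < w) i
  · filter_upwards [ae_geoPathLaw_pos hp hp1] with ω hω i j hi hj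
    have := hi.1.trans hj.1.symm
    rw [delTime_eq, delTime_eq] at this
    have := (strictMono_genTime hω).injective this
    omega
  · refine (tsum_measure_relation (geoLaw p) (fun g s _ => g + s = t ∧ s < w)).trans ?_
    have h1 : ∀ g, ∫⁻ s, geoLaw p {_s' | g + s = t ∧ s < w} ∂(geoLaw p) =
        if g < t ∧ t ≤ g + (w - 1) then geoLaw p {t - g} else 0 := by
      intro g
      have h3 : ∀ s, geoLaw p {_s' : ℕ | g + s = t ∧ s < w} =
          Set.indicator {s | g + s = t ∧ s < w} 1 s := by
        intro s
        by_cases h : g + s = t ∧ s < w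
        · simp [h]
        · simp [h]
      simp_rw [h3]
      rw [lintegral_indicator_one (by measurability)]
      split_ifs with h
      · congr 1; ext s; simp; omega
      · rw [← nonpos_iff_eq_zero, ← geoLaw_singleton_zero hp hp1]
        refine measure_mono ?_
        intro s; simp; omega
    rw [lintegral_renewal_geoLaw_window hp hp1 (by omega) (fun v => geoLaw p {v}) h1]
    simp_rw [geoLaw_singleton_succ hp hp1]
    rw [← ENNReal.ofReal_sum_of_nonneg (fun m _ => by positivity), ← ENNReal.ofReal_mul hp.le,
      ← Finset.sum_mul]
    congr 2
    have := geom_sum_mul (1 - p) (w - 1)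
    linarith

/-- The probability that sensor A delivers in slot `t` and that the last two services took
together at most `x` slots. -/
lemma measure_delivery_pair_le (hp : 0 < p) (hp1 : p ≤ 1) {t x : ℕ} (hx : x < t) :
    geoPathLaw p {ω | ∃ i, delTime ω (i + 1) = t ∧ ω i + ω (i + 1) ≤ x} =
      ENNReal.ofReal (p * geoPairCdf p x) := by
  have hq : 0 ≤ 1 - p := by linarith
  have hmeas : ∀ i, {ω : ℕ → ℕ | delTime ω (i + 1) = t ∧ ω i + ω (i + 1) ≤ x} =
      {ω | genTime ω i + ω i + ω (i + 1) = t ∧ ω i + ω (i + 1) ≤ x} := by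
    intro i; ext ω
    simp only [Set.mem_ofPred_eq, delTime_eq, genTime_succ]
  rw [measure_exists_eq_tsum]
  rotate_left
  · intro i
    rw [hmeas]
    exact measurableSet_relation (fun g s s' => g + s + s' = t ∧ s + s' ≤ x) i
  · filter_upwards [ae_geoPathLaw_pos hp hp1] with ω hω i j hi hj
    have := hi.1.trans hj.1.symm
    rw [delTime_eq, delTime_eq] at this
    have := (strictMono_genTime hω).injective this
    omega
  · simp_rw [hmeas]
    rw [geoPathLaw, tsum_measure_relation (geoLaw p) (fun g s s' => g + s + s' = t ∧ s + s' ≤ x)]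
    have h1 : ∀ g, ∫⁻ s, geoLaw p {s' | g + s + s' = t ∧ s + s' ≤ x} ∂(geoLaw p) =
        if g < t ∧ t ≤ g + x then
          ∫⁻ s, geoLaw p {s' | 0 < s' ∧ s + s' = t - g} ∂(geoLaw p) else 0 := by
      intro g
      have h3 : ∀ s, geoLaw p {s' | g + s + s' = t ∧ s + s' ≤ x} =
          geoLaw p {s' | 0 < s' ∧ g + s + s' = t ∧ s + s' ≤ x} := by
        intro s
        refine measure_congr ?_
        filter_upwards [geoLaw_pos hp hp1] with s' hs'
        refine propext ?_
        change (g + s + s' = t ∧ s + s' ≤ x) ↔ (0 < s' ∧ g + s + s' = t ∧ s + s' ≤ x)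
        tauto
      simp_rw [h3]
      split_ifs with h
      · refine lintegral_congr fun s => ?_
        congr 1; ext s'
        simp only [Set.mem_ofPred_eq]
        omega
      · rw [lintegral_congr (g := fun _ => 0), lintegral_zero]
        intro s
        convert measure_empty (μ := geoLaw p)
        ext s'; simp; omega
    rw [lintegral_renewal_geoLaw_window hp hp1 hx
      (fun v => ∫⁻ s, geoLaw p {s' | 0 < s' ∧ s + s' = v} ∂(geoLaw p)) h1]
    have h2 : ∀ m : ℕ, ∫⁻ s, geoLaw p {s' | 0 < s' ∧ s + s' = m + 1} ∂(geoLaw p) =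
        ENNReal.ofReal (m * p * p * (1 - p) ^ (m - 1)) := by
      intro m
      refine lintegral_geoLaw_first hp hp1 m (fun s s' => 0 < s' ∧ s + s' = m + 1) p
        (fun n s' h => by omega) fun n hn => ?_
      rw [mul_comm, ← geoLaw_singleton_succ hp hp1]
      congr 1; ext s'
      simp only [Set.mem_ofPred_eq, Set.mem_singleton_iff]; omega
    simp_rw [h2]
    rw [← ENNReal.ofReal_sum_of_nonneg (fun m _ => by positivity), ← ENNReal.ofReal_mul hp.le,
      geoPairCdf]
    congr 2
    exact Finset.sum_congr rfl fun m _ => by ring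

end Geometric

/-! ### Long-run averages of quantities with periodic increments -/

/-- A monotone cumulative quantity that grows by `c` in each period of length `T` grows at the
long-run rate `c / T`. -/
lemma tendsto_div_of_periodic_increments {M : ℝ → ℝ≥0∞} (hM : Monotone M) {b T c : ℝ}
    (hT : 0 < T) (hc : 0 ≤ c) (K : ℕ) (hfin : M (b + K * T) ≠ ⊤)
    (hinc : ∀ k : ℕ, K ≤ k → M (b + (k + 1) * T) = M (b + k * T) + ENNReal.ofReal c) :
    Tendsto (fun τ => M τ / ENNReal.ofReal τ) atTop (𝓝 (ENNReal.ofReal (c / T))) := by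
  set m := (M (b + K * T)).toReal with hm
  have hm0 : 0 ≤ m := ENNReal.toReal_nonneg
  have hval : ∀ n : ℕ, M (b + (K + n : ℕ) * T) = ENNReal.ofReal (m + n * c) := by
    intro n
    induction n with
    | zero => simp [hm, ENNReal.ofReal_toReal hfin]
    | succ n ih =>
      have := hinc (K + n) (by omega)
      rw [ih, ← ENNReal.ofReal_add (by positivity) hc] at this
      rw [show ((K + (n + 1) : ℕ) : ℝ) = ((K + n : ℕ) : ℝ) + 1 by push_cast; ring, this]
      congr 1; push_cast; ring
  have hlim : ∀ A : ℝ, Tendsto (fun τ : ℝ => ENNReal.ofReal ((A + c / T * τ) / τ)) atTop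
      (𝓝 (ENNReal.ofReal (c / T))) := by
    intro A
    refine (ENNReal.continuous_ofReal.tendsto _).comp ?_
    have h1 : Tendsto (fun τ : ℝ => A / τ + c / T) atTop (𝓝 (0 + c / T)) :=
      (tendsto_const_nhds.div_atTop tendsto_id).add tendsto_const_nhds
    rw [zero_add] at h1
    refine h1.congr' ?_
    filter_upwards [eventually_gt_atTop 0] with τ hτ
    field_simp
  refine tendsto_of_tendsto_of_tendsto_of_le_of_le'
    (hlim (m - c * (b / T + 1 + K))) (hlim (m + c * (1 - b / T - K))) ?_ ?_
  all_goals
    filter_upwards [eventually_gt_atTop 0, eventually_ge_atTop (b + K * T)] with τ hτ hτ'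
    rw [ENNReal.ofReal_div_of_pos hτ]
    gcongr
    have h0 : (K : ℝ) ≤ (τ - b) / T := by rw [le_div_iff₀ hT]; linarith
    have h0' : (0 : ℝ) ≤ (τ - b) / T := le_trans (Nat.cast_nonneg _) h0
    have h1 : K ≤ ⌊(τ - b) / T⌋₊ := Nat.le_floor h0
    obtain ⟨n, hn⟩ := Nat.exists_eq_add_of_le h1
    have h2 : ((K + n : ℕ) : ℝ) ≤ (τ - b) / T := by rw [← hn]; exact Nat.floor_le h0'
    have h3 : (τ - b) / T < ((K + n : ℕ) : ℝ) + 1 := by rw [← hn]; exact Nat.lt_floor_add_one _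
    have h4 : (τ - b) / T = τ / T - b / T := sub_div _ _ _
  · rw [le_div_iff₀ hT] at h2
    refine le_trans ?_ (hM (show b + (K + n : ℕ) * T ≤ τ by linarith))
    rw [hval]
    apply ENNReal.ofReal_le_ofReal
    have : c * (τ / T - b / T - 1 - K) ≤ c * n := by
      refine mul_le_mul_of_nonneg_left ?_ hc
      push_cast at h3; linarith
    have h5 : c / T * τ = c * (τ / T) := by ring
    linarith
  · rw [div_lt_iff₀ hT] at h3
    refine le_trans (hM (show τ ≤ b + (K + (n + 1) : ℕ) * T by push_cast at h3 ⊢; linarith)) ?_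
    rw [hval]
    apply ENNReal.ofReal_le_ofReal
    have : c * n ≤ c * (τ / T - b / T - K) := by
      refine mul_le_mul_of_nonneg_left ?_ hc
      push_cast at h2; linarith
    have h5 : c / T * τ = c * (τ / T) := by ring
    push_cast
    linarith

lemma tendsto_div_of_periodic_increments_nat {M : ℕ → ℝ≥0∞} (hM : Monotone M) {b T : ℕ} {c : ℝ}
    (hT : 0 < T) (hc : 0 ≤ c) (K : ℕ) (hfin : M (b + K * T) ≠ ⊤)
    (hinc : ∀ k : ℕ, K ≤ k → M (b + (k + 1) * T) = M (b + k * T) + ENNReal.ofReal c) :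
    Tendsto (fun n : ℕ => M n / n) atTop (𝓝 (ENNReal.ofReal (c / T))) := by
  have hfl : ∀ n : ℕ, ⌊(n : ℝ)⌋₊ = n := fun n => Nat.floor_natCast n
  have h := tendsto_div_of_periodic_increments (M := fun τ => M ⌊τ⌋₊) (b := b) (T := T) (c := c)
    (hM.comp Nat.floor_mono) (by exact_mod_cast hT) hc K
    (by rw [show (b : ℝ) + K * T = (b + K * T : ℕ) by push_cast; ring, hfl]; exact hfin)
    (fun k hk => by
      rw [show (b : ℝ) + k * T = (b + k * T : ℕ) by push_cast; ring,
        show (b : ℝ) + (k + 1) * T = (b + (k + 1) * T : ℕ) by push_cast; ring, hfl, hfl]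
      exact hinc k hk)
  refine (h.comp tendsto_natCast_atTop_atTop).congr fun n => ?_
  simp [Function.comp]

lemma longRun_eq {ι : Type} [Preorder ι] [(atTop : Filter ι).NeBot] {m : ι → ℝ≥0∞} {a : ℝ}
    (ha : 0 ≤ a) (h : Tendsto m atTop (𝓝 (ENNReal.ofReal a))) : longRun m = a := by
  rw [longRun, h.limsup_eq, ENNReal.toReal_ofReal ha]

/-- The quotient of two cumulative quantities with linear growth. -/
lemma tendsto_quotient_of_rates {ι : Type*} {l : Filter ι} {S N d : ι → ℝ≥0∞} {s n : ℝ}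
    (hS : Tendsto (fun i => S i / d i) l (𝓝 (ENNReal.ofReal s)))
    (hN : Tendsto (fun i => N i / d i) l (𝓝 (ENNReal.ofReal n))) (hn : 0 < n)
    (hd : ∀ᶠ i in l, d i ≠ 0 ∧ d i ≠ ⊤) :
    Tendsto (fun i => S i / N i) l (𝓝 (ENNReal.ofReal (s / n))) := by
  rw [ENNReal.ofReal_div_of_pos hn]
  have hn' : ENNReal.ofReal n ≠ 0 := by simpa using hn
  refine (ENNReal.Tendsto.div hS (Or.inr hn') hN (Or.inl ENNReal.ofReal_ne_top)).congr' ?_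
  filter_upwards [hd] with i hi
  rw [div_eq_mul_inv (N i), mul_comm (N i), ENNReal.div_eq_inv_mul (a := S i),
    ENNReal.mul_div_mul_left]
  · simpa using hi.2
  · simpa using hi.1

/-! ### Expected ages and peaks of the Geo-D system -/

/-- The expected age of a Geo-D system when sensor B contributes age `w`. -/
def geoMeanAge (p : ℝ) (w : ℕ) : ℝ :=
  ∑ x ∈ Finset.range w, (1 - geoPairCdf p x)

lemma one_sub_geoPairCdf (p : ℝ) (x : ℕ) :
    1 - geoPairCdf p x = (1 - p) ^ x + x * p * (1 - p) ^ (x - 1) := by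
  induction x with
  | zero => simp [geoPairCdf]
  | succ x ih =>
    rw [geoPairCdf, Finset.sum_range_succ, ← sub_sub, ← geoPairCdf, ih]
    rcases x with _ | x
    · simp
    · simp only [Nat.add_sub_cancel]
      push_cast
      ring

section

variable {p : ℝ}

lemma geoPairCdf_le_one (hp : 0 < p) (hp1 : p ≤ 1) (x : ℕ) : geoPairCdf p x ≤ 1 := by
  have h : 0 ≤ 1 - p := by linarith
  have := one_sub_geoPairCdf p x
  have : 0 ≤ (1 - p) ^ x + x * p * (1 - p) ^ (x - 1) := by positivity
  linarith

lemma geoPairCdf_nonneg (hp : 0 < p) (hp1 : p ≤ 1) (x : ℕ) : 0 ≤ geoPairCdf p x := by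
  have h : 0 ≤ 1 - p := by linarith
  unfold geoPairCdf; positivity

lemma geoPairCdf_mono (hp : 0 < p) (hp1 : p ≤ 1) : Monotone (geoPairCdf p) := by
  have h : 0 ≤ 1 - p := by linarith
  refine monotone_nat_of_le_succ fun n => ?_
  rw [geoPairCdf, geoPairCdf, Finset.sum_range_succ]
  have : 0 ≤ n * p ^ 2 * (1 - p) ^ (n - 1) := by positivity
  linarith

lemma geoMeanAge_nonneg (hp : 0 < p) (hp1 : p ≤ 1) (w : ℕ) : 0 ≤ geoMeanAge p w :=
  Finset.sum_nonneg fun x _ => sub_nonneg.2 (geoPairCdf_le_one hp hp1 x)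

lemma measurable_services {α : Type} [MeasurableSpace α] (T : α) (q : Fin 2) :
    Measurable fun ω : ℕ → α => services ω T q := by
  fin_cases q
  · exact measurable_id
  · exact measurable_const

@[fun_prop]
lemma measurable_genTime_services {α : Type} [AddCommMonoid α] [MeasurableSpace α]
    [MeasurableAdd₂ α] (T : α) (q : Fin 2) (i : ℕ) :
    Measurable fun ω : ℕ → α => genTime (services ω T q) i :=
  (measurable_genTime i).comp (measurable_services T q)

@[fun_prop]
lemma measurable_delTime_services {α : Type} [AddCommMonoid α] [MeasurableSpace α]
    [MeasurableAdd₂ α] (T : α) (q : Fin 2) (i : ℕ) :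
    Measurable fun ω : ℕ → α => delTime (services ω T q) i :=
  (measurable_delTime i).comp (measurable_services T q)

@[fun_prop]
lemma measurable_age (T t : ℕ) : Measurable fun ω => age (services ω T) t := by
  refine measurable_of_Ioi fun x => ?_
  have : (fun ω => age (services ω T) t) ⁻¹' Set.Ioi x = {ω | x < t ∧ ∀ q i,
      delTime (services ω T q) i < t → genTime (services ω T q) i + x < t} := by
    ext ω; exact lt_age_iff _ _ _
  rw [this]
  refine measurableSet_setOfPred.2 (measurable_const.and ?_)
  refine Measurable.forall fun q => Measurable.forall fun i => Measurable.imp ?_ ?_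
  · exact measurableSet_setOfPred.1 (measurableSet_lt (by fun_prop) measurable_const)
  · exact measurableSet_setOfPred.1 (measurableSet_lt (by fun_prop) measurable_const)

lemma measurableSet_fresh (T t : ℕ) : MeasurableSet {ω | Fresh (services ω T) t} := by
  simp_rw [fresh_iff]
  refine measurableSet_setOfPred.2
    (Measurable.exists fun q => Measurable.exists fun i => Measurable.and ?_ ?_)
  · exact measurableSet_setOfPred.1 (measurableSet_eq_fun (by fun_prop) measurable_const)
  · exact measurableSet_setOfPred.1 (measurableSet_lt (by fun_prop) (by fun_prop))

lemma measurableSet_older (t x : ℕ) : MeasurableSet {ω | Older ω t x} := by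
  unfold Older
  refine measurableSet_setOfPred.2 (Measurable.forall fun i => Measurable.imp ?_ ?_)
  · exact measurableSet_setOfPred.1 (measurableSet_lt (by fun_prop) measurable_const)
  · exact measurableSet_setOfPred.1 (measurableSet_lt (by fun_prop) measurable_const)

/-- The layer-cake formula for a bounded natural number on an event. -/
lemma lintegral_ite_natCast_eq_sum {Ω : Type*} [MeasurableSpace Ω] (μ : Measure Ω) {f : Ω → ℕ}
    (hf : Measurable f) {A : Ω → Prop} [DecidablePred A] (hA : MeasurableSet {ω | A ω}) {w : ℕ}
    (hw : ∀ ω, f ω ≤ w) :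
    ∫⁻ ω, (if A ω then (f ω : ℝ≥0∞) else 0) ∂μ =
      ∑ x ∈ Finset.range w, μ {ω | x < f ω ∧ A ω} := by
  have h : ∀ ω, (if A ω then (f ω : ℝ≥0∞) else 0) =
      ∑ x ∈ Finset.range w, if x < f ω ∧ A ω then 1 else 0 := by
    intro ω
    split_ifs with h
    · simp only [h, and_true]
      rw [← Finset.sum_filter, Finset.sum_const, nsmul_eq_mul, mul_one]
      congr 1
      have : Finset.filter (fun x => x < f ω) (Finset.range w) = Finset.range (f ω) := by
        ext x; simp only [Finset.mem_filter, Finset.mem_range]; have := hw ω; omega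
      rw [this, Finset.card_range]
    · simp [h]
  have hm : ∀ x, MeasurableSet {ω | x < f ω ∧ A ω} := fun x =>
    (measurableSet_lt measurable_const hf).inter hA
  simp_rw [h]
  rw [lintegral_finsetSum _ fun x _ => Measurable.ite (hm x) measurable_const measurable_const]
  exact Finset.sum_congr rfl fun x _ => lintegral_ite_one μ (hm x)

variable {T k j : ℕ}

lemma age_services_le {ω : ℕ → ℕ} (hj : j < T) (hk : 1 ≤ k) :
    age (services ω T) (k * T + 1 + j) ≤ T + 1 + j := by
  by_contra h
  exact absurd ((lt_age_services_iff hj hk _).1 (not_le.1 h)).1 (lt_irrefl _)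

instance : IsProbabilityMeasure (geoPathLaw p) := by
  have : IsProbabilityMeasure (geoLaw p) := isProbabilityMeasure_geoLaw
  unfold geoPathLaw; infer_instance

lemma measure_lt_age (hp : 0 < p) (hp1 : p ≤ 1) (hj : j < T) (hk : 1 ≤ k) {x : ℕ}
    (hx : x < T + 1 + j) :
    geoPathLaw p {ω | x < age (services ω T) (k * T + 1 + j)} =
      ENNReal.ofReal (1 - geoPairCdf p x) := by
  have hkT : T ≤ k * T := Nat.le_mul_of_pos_left T hk
  have h : {ω | x < age (services ω T) (k * T + 1 + j)} =
      {ω | ¬ Older ω (k * T + 1 + j) x}ᶜ := by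
    ext ω
    simp [lt_age_services_iff hj hk, hx]
  rw [h, prob_compl_eq_one_sub (s := {ω | ¬ Older ω (k * T + 1 + j) x})
    (measurableSet_older _ _).compl, measure_not_older hp hp1 (by omega),
    ENNReal.ofReal_sub _ (geoPairCdf_nonneg hp hp1 x), ENNReal.ofReal_one]

lemma lintegral_age (hp : 0 < p) (hp1 : p ≤ 1) (hj : j < T) (hk : 1 ≤ k) :
    ∫⁻ ω, (age (services ω T) (k * T + 1 + j) : ℝ≥0∞) ∂(geoPathLaw p) =
      ENNReal.ofReal (geoMeanAge p (T + 1 + j)) := by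
  have h := lintegral_ite_natCast_eq_sum (geoPathLaw p) (measurable_age T (k * T + 1 + j))
    (A := fun _ => True) (by simp) (fun ω => age_services_le hj hk)
  simp only [if_true, and_true] at h
  rw [h, geoMeanAge, ENNReal.ofReal_sum_of_nonneg
    fun x _ => sub_nonneg.2 (geoPairCdf_le_one hp hp1 x)]
  exact Finset.sum_congr rfl fun x hx => measure_lt_age hp hp1 hj hk (Finset.mem_range.1 hx)

/-- The probability of a fresh reception, between two deliveries of sensor B. -/
lemma measure_fresh_off_delivery (hp : 0 < p) (hp1 : p ≤ 1) (hj : j + 1 < T) (hk : 1 ≤ k) :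
    geoPathLaw p {ω | Fresh (services ω T) (k * T + 1 + j)} =
      ENNReal.ofReal (p * (1 - (1 - p) ^ (T + j))) := by
  have hkT : T ≤ k * T := Nat.le_mul_of_pos_left T hk
  rw [show T + j = T + 1 + j - 1 by omega,
    ← measure_delivery_lt hp hp1 (t := k * T + 1 + j) (by omega) (by omega)]
  refine measure_congr ?_
  filter_upwards [ae_geoPathLaw_pos hp hp1] with ω hω
  exact propext (fresh_off_delivery_iff hω hj hk)

lemma measure_lt_age_and_fresh_off_delivery (hp : 0 < p) (hp1 : p ≤ 1) (hj : j + 1 < T)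
    (hk : 1 ≤ k) {x : ℕ} (hx : x < T + 1 + j) :
    geoPathLaw p {ω | x < age (services ω T) (k * T + 1 + j) ∧
        Fresh (services ω T) (k * T + 1 + j)} =
      ENNReal.ofReal (p * (1 - (1 - p) ^ (T + j)) - p * geoPairCdf p x) := by
  have hkT : T ≤ k * T := Nat.le_mul_of_pos_left T hk
  have h := measure_delivery_lt hp hp1 (t := k * T + 1 + j) (w := T + 1 + j) (by omega) (by omega)
  have h' := measure_delivery_pair_le hp hp1 (t := k * T + 1 + j) (x := x) (by omega)
  rw [ENNReal.ofReal_sub _ (mul_nonneg hp.le (geoPairCdf_nonneg hp hp1 x)), ← h',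
    show T + j = T + 1 + j - 1 by omega, ← h, ← measure_sdiff]
  · refine measure_congr ?_
    filter_upwards [ae_geoPathLaw_pos hp hp1] with ω hω
    exact propext (lt_age_and_fresh_off_delivery_iff hω hj hk hx)
  · rintro ω ⟨i, hi, hi'⟩
    exact ⟨i + 1, hi, by omega⟩
  · refine MeasurableSet.nullMeasurableSet ?_
    refine measurableSet_setOfPred.2 (Measurable.exists fun i => Measurable.and ?_ ?_)
    · exact measurableSet_setOfPred.1 (measurableSet_eq_fun (by fun_prop) measurable_const)
    · refine measurableSet_setOfPred.1 (measurableSet_le ?_ measurable_const)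
      exact (measurable_pi_apply i).add (measurable_pi_apply (i + 1))
  · exact measure_ne_top _ _

lemma add_one_add_pred (hT : 0 < T) : k * T + 1 + (T - 1) = k * T + T := by omega

/-- The probability of a fresh reception in a slot in which sensor B delivers. -/
lemma measure_fresh_on_delivery (hp : 0 < p) (hp1 : p ≤ 1) (hT : 0 < T) (hk : 1 ≤ k) :
    geoPathLaw p {ω | Fresh (services ω T) (k * T + T)} =
      ENNReal.ofReal (1 - (1 - p) * geoPairCdf p T) := by
  have hkT : T ≤ k * T := Nat.le_mul_of_pos_left T hk
  have h : geoPathLaw p {ω | Fresh (services ω T) (k * T + T)}ᶜ =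
      geoPathLaw p {ω | ¬ Older ω (k * T + T) T ∧ ∀ i, delTime ω i ≠ k * T + T} := by
    refine measure_congr ?_
    filter_upwards [ae_geoPathLaw_pos hp hp1] with ω hω
    exact propext (not_fresh_on_delivery_iff hω hT hk)
  rw [measure_not_older_and_no_delivery hp hp1 (by omega)] at h
  rw [ENNReal.ofReal_sub _ (mul_nonneg (by linarith) (geoPairCdf_nonneg hp hp1 T)), ← h,
    ENNReal.ofReal_one, ← prob_compl_eq_one_sub (measurableSet_fresh _ _).compl, compl_compl]

lemma measurableSet_no_delivery (t : ℕ) :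
    MeasurableSet {ω : ℕ → ℕ | ∀ i, delTime ω i ≠ t} :=
  measurableSet_setOfPred.2 (Measurable.forall fun i => measurableSet_setOfPred.1
    (measurableSet_eq_fun (by fun_prop) measurable_const).compl)

lemma measure_lt_age_and_fresh_on_delivery (hp : 0 < p) (hp1 : p ≤ 1) (hT : 0 < T)
    (hk : 1 ≤ k) {x : ℕ} (hx : x < 2 * T) :
    geoPathLaw p {ω | x < age (services ω T) (k * T + T) ∧ Fresh (services ω T) (k * T + T)} =
      ENNReal.ofReal (1 - geoPairCdf p x -
        (1 - p) * (geoPairCdf p T - geoPairCdf p (min x T))) := by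
  have hkT : T ≤ k * T := Nat.le_mul_of_pos_left T hk
  have hmono : geoPairCdf p (min x T) ≤ geoPairCdf p T := geoPairCdf_mono hp hp1 (min_le_right _ _)
  have hiff : ∀ ω, x < age (services ω T) (k * T + T) ↔ Older ω (k * T + T) x := by
    intro ω
    rw [← add_one_add_pred hT, lt_age_services_iff (by omega) hk]
    have : x < T + 1 + (T - 1) := by omega
    simp [this]
  have hage : geoPathLaw p {ω | x < age (services ω T) (k * T + T)} =
      ENNReal.ofReal (1 - geoPairCdf p x) := by
    rw [← add_one_add_pred hT]
    exact measure_lt_age hp hp1 (by omega) hk (by omega)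
  -- the event that the age exceeds `x` although nothing fresh arrives
  have hbad : geoPathLaw p {ω | x < age (services ω T) (k * T + T) ∧
      ¬ Fresh (services ω T) (k * T + T)} =
      ENNReal.ofReal ((1 - p) * (geoPairCdf p T - geoPairCdf p (min x T))) := by
    rw [mul_sub, ENNReal.ofReal_sub _ (mul_nonneg (by linarith) (geoPairCdf_nonneg hp hp1 _)),
      ← measure_not_older_and_no_delivery hp hp1 (t := k * T + T) (by omega),
      ← measure_not_older_and_no_delivery hp hp1 (t := k * T + T) (by omega), ← measure_sdiff]
    · refine measure_congr ?_
      filter_upwards [ae_geoPathLaw_pos hp hp1] with ω hω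
      refine propext ?_
      change (x < age (services ω T) (k * T + T) ∧ ¬ Fresh (services ω T) (k * T + T)) ↔
        ((¬ Older ω (k * T + T) T ∧ ∀ i, delTime ω i ≠ k * T + T) ∧
        ¬ (¬ Older ω (k * T + T) (min x T) ∧ ∀ i, delTime ω i ≠ k * T + T))
      rw [hiff, not_fresh_on_delivery_iff hω hT hk]
      have h1 : Older ω (k * T + T) x → Older ω (k * T + T) (min x T) :=
        fun h i hi => by have := h i hi; have := min_le_left x T; omega
      have h2 : T ≤ x → Older ω (k * T + T) x → Older ω (k * T + T) T :=
        fun h' h i hi => by have := h i hi; omega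
      rcases le_total T x with h | h
      · rw [min_eq_right h] at h1 ⊢
        have := h2 h
        tauto
      · rw [min_eq_left h] at h1 ⊢
        tauto
    · rintro ω ⟨h1, h2⟩
      refine ⟨fun h => h1 fun i hi => ?_, h2⟩
      have := h i hi; have := min_le_right x T; omega
    · exact ((measurableSet_older _ _).compl.inter
        (measurableSet_no_delivery _)).nullMeasurableSet
    · exact measure_ne_top _ _
  rw [ENNReal.ofReal_sub _ (mul_nonneg (by linarith) (by linarith)), ← hbad, ← hage,
    ← measure_sdiff]
  · congr 1; ext ω
    simp only [Set.mem_ofPred_eq, Set.mem_sdiff]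
    tauto
  · exact fun ω h => h.1
  · exact ((measurableSet_lt measurable_const (measurable_age T _)).inter
      (measurableSet_fresh _ _).compl).nullMeasurableSet
  · exact measure_ne_top _ _

end

/-! ### Averages of the Geo-D system -/

/-- The expected sum of the ages over one period of sensor B. -/
def geoAgePerPeriod (p : ℝ) (T : ℕ) : ℝ :=
  ∑ j ∈ Finset.range T, geoMeanAge p (T + 1 + j)

/-- The expected number of valid updates in one period of sensor B.  The last summand belongs to
the slot in which sensor B delivers. -/
def geoPeaksPerPeriod (p : ℝ) (T : ℕ) : ℝ :=
  ∑ j ∈ Finset.range (T - 1), p * (1 - (1 - p) ^ (T + j)) + (1 - (1 - p) * geoPairCdf p T)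

/-- The expected sum of the age peaks in one period of sensor B.  The last summand belongs to
the slot in which sensor B delivers. -/
def geoPeakSumPerPeriod (p : ℝ) (T : ℕ) : ℝ :=
  ∑ j ∈ Finset.range (T - 1), ∑ x ∈ Finset.range (T + 1 + j),
      (p * (1 - (1 - p) ^ (T + j)) - p * geoPairCdf p x) +
    ∑ x ∈ Finset.range (2 * T),
      (1 - geoPairCdf p x - (1 - p) * (geoPairCdf p T - geoPairCdf p (min x T)))

section

variable {p : ℝ}

lemma geoPeak_term_nonneg (hp : 0 < p) (hp1 : p ≤ 1) {x n : ℕ} (hx : x ≤ n) :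
    0 ≤ p * (1 - (1 - p) ^ n) - p * geoPairCdf p x := by
  have hq : 0 ≤ 1 - p := by linarith
  rw [← mul_sub]
  refine mul_nonneg hp.le ?_
  have h := one_sub_geoPairCdf p x
  have h1 : (1 - p) ^ n ≤ (1 - p) ^ x := pow_le_pow_of_le_one hq (by linarith) hx
  have : 0 ≤ x * p * (1 - p) ^ (x - 1) := by positivity
  linarith

lemma geoPeak_delivery_term_nonneg (hp : 0 < p) (hp1 : p ≤ 1) (x T : ℕ) :
    0 ≤ 1 - geoPairCdf p x - (1 - p) * (geoPairCdf p T - geoPairCdf p (min x T)) := by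
  have h1 := geoPairCdf_le_one hp hp1 x
  have h2 := geoPairCdf_le_one hp hp1 T
  rcases le_total x T with h | h
  · rw [min_eq_left h]
    have := geoPairCdf_mono hp hp1 h
    nlinarith
  · rw [min_eq_right h]; linarith

lemma one_sub_pow_nonneg (hp : 0 < p) (hp1 : p ≤ 1) (n : ℕ) : 0 ≤ 1 - (1 - p) ^ n :=
  sub_nonneg.2 (pow_le_one₀ (by linarith) (by linarith))

lemma geoAgePerPeriod_nonneg (hp : 0 < p) (hp1 : p ≤ 1) (T : ℕ) : 0 ≤ geoAgePerPeriod p T :=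
  Finset.sum_nonneg fun _ _ => geoMeanAge_nonneg hp hp1 _

lemma geoPeaksPerPeriod_pos (hp : 0 < p) (hp1 : p ≤ 1) (T : ℕ) : 0 < geoPeaksPerPeriod p T := by
  have h1 : 0 ≤ ∑ j ∈ Finset.range (T - 1), p * (1 - (1 - p) ^ (T + j)) :=
    Finset.sum_nonneg fun j _ => mul_nonneg hp.le (one_sub_pow_nonneg hp hp1 _)
  have h2 : (1 - p) * geoPairCdf p T ≤ (1 - p) * 1 :=
    mul_le_mul_of_nonneg_left (geoPairCdf_le_one hp hp1 T) (by linarith)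
  unfold geoPeaksPerPeriod
  linarith

lemma geoPeakSumPerPeriod_nonneg (hp : 0 < p) (hp1 : p ≤ 1) (T : ℕ) :
    0 ≤ geoPeakSumPerPeriod p T := by
  refine add_nonneg (Finset.sum_nonneg fun j _ => Finset.sum_nonneg fun x hx => ?_)
    (Finset.sum_nonneg fun x _ => geoPeak_delivery_term_nonneg hp hp1 x T)
  rw [Finset.mem_range] at hx
  exact geoPeak_term_nonneg hp hp1 (by omega)

/-- A cumulative quantity whose slots have finite expectations, and whose periods all contribute
`c`, grows at the rate `c / T`. -/
lemma tendsto_sum_range_div {f : ℕ → ℝ≥0∞} {T : ℕ} {c : ℝ} (hT : 0 < T) (hc : 0 ≤ c)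
    (hf : ∀ t, f t ≠ ⊤)
    (h : ∀ k, 1 ≤ k → ∑ j ∈ Finset.range T, f (k * T + 1 + j) = ENNReal.ofReal c) :
    Tendsto (fun n : ℕ => (∑ t ∈ Finset.range n, f t) / n) atTop
      (𝓝 (ENNReal.ofReal (c / T))) := by
  refine tendsto_div_of_periodic_increments_nat (M := fun n => ∑ t ∈ Finset.range n, f t) (b := 1)
    ?_ hT hc 1 ?_ fun k hk => ?_
  · intro a b hab
    exact Finset.sum_le_sum_of_subset (Finset.range_subset_range.2 hab)
  · exact ENNReal.sum_ne_top.2 fun t _ => hf t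
  · rw [← h k hk, show 1 + (k + 1) * T = (k * T + 1) + T by ring, Finset.sum_range_add,
      add_comm 1]

lemma sum_range_pred_add {M : Type*} [AddCommMonoid M] (g : ℕ → M) {T : ℕ} (hT : 0 < T) :
    ∑ j ∈ Finset.range T, g j = ∑ j ∈ Finset.range (T - 1), g j + g (T - 1) := by
  obtain ⟨S, rfl⟩ : ∃ S, T = S + 1 := ⟨T - 1, by omega⟩
  rw [Finset.sum_range_succ, Nat.add_sub_cancel]

lemma age_le (s : Fin 2 → ℕ → ℕ) (t : ℕ) : age s t ≤ t := by
  by_contra h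
  exact absurd ((lt_age_iff s t t).1 (not_le.1 h)).1 (lt_irrefl _)

lemma lintegral_natCast_ne_top {Ω : Type*} [MeasurableSpace Ω] (μ : Measure Ω)
    [IsProbabilityMeasure μ] {f : Ω → ℝ≥0∞} {t : ℕ} (h : ∀ ω, f ω ≤ t) :
    ∫⁻ ω, f ω ∂μ ≠ ⊤ := by
  refine ne_top_of_le_ne_top (ENNReal.natCast_ne_top t) ((lintegral_mono h).trans ?_)
  simp

variable {μB : ℝ} {T : ℕ}

lemma tendsto_geoDMeanAoI (hp : 0 < p) (hp1 : p ≤ 1) (hT : 0 < T) (hμ : ⌈1 / μB⌉₊ = T) :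
    Tendsto (geoDMeanAoI p μB) atTop (𝓝 (ENNReal.ofReal (geoAgePerPeriod p T / T))) := by
  have h := tendsto_sum_range_div (T := T)
    (f := fun t => ∫⁻ ω, (age (services ω T) t : ℝ≥0∞) ∂(geoPathLaw p))
    hT (geoAgePerPeriod_nonneg hp hp1 T)
    (fun t => lintegral_natCast_ne_top _ (t := t) fun ω => by exact_mod_cast age_le _ t)
    (fun k hk => by
      rw [geoAgePerPeriod, ENNReal.ofReal_sum_of_nonneg fun _ _ => geoMeanAge_nonneg hp hp1 _]
      exact Finset.sum_congr rfl fun j hj => lintegral_age hp hp1 (Finset.mem_range.1 hj) hk)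
  refine h.congr fun n => ?_
  simp only [geoDMeanAoI, geoDServices, hμ]
  simp only [div_eq_mul_inv]
  have hm : ∀ t, Measurable fun ω => (age (services ω T) t : ℝ≥0∞) := fun t =>
    (Measurable.of_discrete (f := fun n : ℕ => (n : ℝ≥0∞))).comp (measurable_age T t)
  rw [lintegral_mul_const _ (Finset.measurable_sum _ fun t _ => hm t),
    lintegral_finsetSum _ fun t _ => hm t]

lemma tendsto_geoDNumPeaks (hp : 0 < p) (hp1 : p ≤ 1) (hT : 0 < T) (hμ : ⌈1 / μB⌉₊ = T) :
    Tendsto (fun n : ℕ => geoDNumPeaks p μB n / n) atTop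
      (𝓝 (ENNReal.ofReal (geoPeaksPerPeriod p T / T))) := by
  classical
  have h := tendsto_sum_range_div (T := T)
    (f := fun t => geoPathLaw p {ω | Fresh (services ω T) t})
    hT (geoPeaksPerPeriod_pos hp hp1 T).le (fun t => measure_ne_top _ _)
    (fun k hk => by
      have hnn : ∀ j, 0 ≤ p * (1 - (1 - p) ^ (T + j)) := fun j =>
        mul_nonneg hp.le (one_sub_pow_nonneg hp hp1 _)
      have h1 : 0 ≤ 1 - (1 - p) * geoPairCdf p T := by
        have := geoPairCdf_le_one hp hp1 T
        have := geoPairCdf_nonneg hp hp1 T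
        nlinarith
      rw [sum_range_pred_add _ hT, add_one_add_pred hT, measure_fresh_on_delivery hp hp1 hT hk,
        geoPeaksPerPeriod, ENNReal.ofReal_add (Finset.sum_nonneg fun j _ => hnn j) h1,
        ENNReal.ofReal_sum_of_nonneg fun j _ => hnn j]
      congr 1
      refine Finset.sum_congr rfl fun j hj => measure_fresh_off_delivery hp hp1 ?_ hk
      rw [Finset.mem_range] at hj; omega)
  refine h.congr fun n => ?_
  subst hμ
  have hm : ∀ t, MeasurableSet {ω | Fresh (geoDServices μB ω) t} := measurableSet_fresh _
  rw [geoDNumPeaks, lintegral_finsetSum _ fun t _ =>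
    Measurable.ite (hm t) measurable_const measurable_const]
  congr 1
  exact Finset.sum_congr rfl fun t _ => (lintegral_ite_one _ (hm t)).symm

lemma tendsto_geoDSumPeaks (hp : 0 < p) (hp1 : p ≤ 1) (hT : 0 < T) (hμ : ⌈1 / μB⌉₊ = T) :
    Tendsto (fun n : ℕ => geoDSumPeaks p μB n / n) atTop
      (𝓝 (ENNReal.ofReal (geoPeakSumPerPeriod p T / T))) := by
  classical
  have h := tendsto_sum_range_div (T := T)
    (f := fun t => ∫⁻ ω, (if Fresh (services ω T) t then (age (services ω T) t : ℝ≥0∞) else 0)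
      ∂(geoPathLaw p))
    hT (geoPeakSumPerPeriod_nonneg hp hp1 T)
    (fun t => lintegral_natCast_ne_top _ (t := t) fun ω => by
      split_ifs
      · exact_mod_cast age_le _ t
      · simp)
    (fun k hk => by
      have hnn : ∀ j, ∀ x ∈ Finset.range (T + 1 + j),
          0 ≤ p * (1 - (1 - p) ^ (T + j)) - p * geoPairCdf p x := fun j x hx => by
        rw [Finset.mem_range] at hx
        exact geoPeak_term_nonneg hp hp1 (by omega)
      have hnn' := fun x (_ : x ∈ Finset.range (2 * T)) =>
        geoPeak_delivery_term_nonneg hp hp1 x T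
      have hlast : ∫⁻ ω, (if Fresh (services ω T) (k * T + T)
          then (age (services ω T) (k * T + T) : ℝ≥0∞) else 0) ∂(geoPathLaw p) =
          ∑ x ∈ Finset.range (2 * T), ENNReal.ofReal (1 - geoPairCdf p x -
            (1 - p) * (geoPairCdf p T - geoPairCdf p (min x T))) := by
        rw [lintegral_ite_natCast_eq_sum _ (measurable_age T _) (measurableSet_fresh T _)
          (w := 2 * T)]
        · exact Finset.sum_congr rfl fun x hx =>
            measure_lt_age_and_fresh_on_delivery hp hp1 hT hk (Finset.mem_range.1 hx)
        · intro ω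
          rw [← add_one_add_pred hT, show 2 * T = T + 1 + (T - 1) by omega]
          exact age_services_le (by omega) hk
      rw [sum_range_pred_add _ hT, add_one_add_pred hT, hlast, geoPeakSumPerPeriod,
        ENNReal.ofReal_add (Finset.sum_nonneg fun j _ => Finset.sum_nonneg (hnn j))
          (Finset.sum_nonneg hnn'), ENNReal.ofReal_sum_of_nonneg hnn',
        ENNReal.ofReal_sum_of_nonneg fun j _ => Finset.sum_nonneg (hnn j)]
      congr 1
      refine Finset.sum_congr rfl fun j hj => ?_
      rw [Finset.mem_range] at hj
      rw [ENNReal.ofReal_sum_of_nonneg (hnn j), lintegral_ite_natCast_eq_sum _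
        (measurable_age T _) (measurableSet_fresh T _) fun ω => age_services_le (by omega) hk]
      exact Finset.sum_congr rfl fun x hx =>
        measure_lt_age_and_fresh_off_delivery hp hp1 (by omega) hk (Finset.mem_range.1 hx))
  refine h.congr fun n => ?_
  simp only [geoDSumPeaks, geoDServices, hμ]
  have hm : ∀ t, Measurable fun ω => (age (services ω T) t : ℝ≥0∞) := fun t =>
    (Measurable.of_discrete (f := fun n : ℕ => (n : ℝ≥0∞))).comp (measurable_age T t)
  rw [lintegral_finsetSum _ fun t _ =>
    Measurable.ite (measurableSet_fresh T t) (hm t) measurable_const]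

lemma tendsto_geoDMeanPAoI (hp : 0 < p) (hp1 : p ≤ 1) (hT : 0 < T) (hμ : ⌈1 / μB⌉₊ = T) :
    Tendsto (geoDMeanPAoI p μB) atTop
      (𝓝 (ENNReal.ofReal (geoPeakSumPerPeriod p T / geoPeaksPerPeriod p T))) := by
  have hT' : (0 : ℝ) < T := by exact_mod_cast hT
  have h := tendsto_quotient_of_rates (tendsto_geoDSumPeaks hp hp1 hT hμ)
    (tendsto_geoDNumPeaks hp hp1 hT hμ) (div_pos (geoPeaksPerPeriod_pos hp hp1 T) hT') (by
      filter_upwards [eventually_gt_atTop 0] with n hn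
      exact ⟨by exact_mod_cast hn.ne', ENNReal.natCast_ne_top n⟩)
  rw [div_div_div_cancel_right₀ hT'.ne'] at h
  exact h

lemma geoDAvgAoI_eq (hp : 0 < p) (hp1 : p ≤ 1) (hT : 0 < T) (hμ : ⌈1 / μB⌉₊ = T) :
    geoDAvgAoI p μB = geoAgePerPeriod p T / T :=
  longRun_eq (div_nonneg (geoAgePerPeriod_nonneg hp hp1 T) (Nat.cast_nonneg T))
    (tendsto_geoDMeanAoI hp hp1 hT hμ)

lemma geoDAvgPAoI_eq (hp : 0 < p) (hp1 : p ≤ 1) (hT : 0 < T) (hμ : ⌈1 / μB⌉₊ = T) :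
    geoDAvgPAoI p μB = geoPeakSumPerPeriod p T / geoPeaksPerPeriod p T :=
  longRun_eq (div_nonneg (geoPeakSumPerPeriod_nonneg hp hp1 T) (geoPeaksPerPeriod_pos hp hp1 T).le)
    (tendsto_geoDMeanPAoI hp hp1 hT hμ)

end

/-! ### The limit of short slots -/

/-- Riemann sums with a varying summand. -/
lemma tendsto_sum_range_div_integral {ι : Type*} {l : Filter ι} [l.IsCountablyGenerated]
    {g : ι → ℕ → ℝ} {N : ι → ℕ} {φ : ℝ → ℝ} {C : ℝ}
    (hN : ∀ᶠ i in l, 0 < N i) (hC : ∀ᶠ i in l, ∀ j, |g i j| ≤ C)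
    (hφ : ∀ u : ℝ, 0 < u → u ≤ 1 → Tendsto (fun i => g i ⌊u * N i⌋₊) l (𝓝 (φ u))) :
    Tendsto (fun i => (∑ j ∈ Finset.range (N i), g i j) / N i) l (𝓝 (∫ u in (0 : ℝ)..1, φ u)) := by
  have hmeas : ∀ i, Measurable fun v : ℝ => g i ⌊v⌋₊ := fun i =>
    (Measurable.of_discrete (f := g i)).comp Nat.measurable_floor
  have hstep : ∀ i (j : ℕ), Set.EqOn (fun _ : ℝ => g i j) (fun v : ℝ => g i ⌊v⌋₊)
      (Set.Ioo (j : ℝ) (j + 1 : ℕ)) := by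
    intro i j v hv
    have : ⌊v⌋₊ = j := by
      rw [Nat.floor_eq_iff (le_trans (Nat.cast_nonneg _) hv.1.le)]
      exact ⟨hv.1.le, by have := hv.2; push_cast at this; exact this⟩
    simp [this]
  have hsum : ∀ i, 0 < N i → (∑ j ∈ Finset.range (N i), g i j) / N i =
      ∫ u in (0 : ℝ)..1, g i ⌊u * N i⌋₊ := by
    intro i hi
    have hi' : (N i : ℝ) ≠ 0 := by exact_mod_cast hi.ne'
    rw [intervalIntegral.integral_comp_mul_right (fun v : ℝ => g i ⌊v⌋₊) hi', zero_mul, one_mul]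
    have h := intervalIntegral.sum_integral_adjacent_intervals (μ := volume)
      (f := fun v : ℝ => g i ⌊v⌋₊) (a := fun j : ℕ => (j : ℝ)) (n := N i) (fun j _ => by
        refine IntervalIntegrable.congr_uIoo (f := fun _ => g i j) intervalIntegrable_const ?_
        rw [Set.uIoo_of_le (by push_cast; linarith)]
        exact hstep i j)
    rw [Nat.cast_zero] at h
    rw [← h, smul_eq_mul, div_eq_inv_mul]
    congr 1
    refine Finset.sum_congr rfl fun j _ => ?_
    have : ∫ v in (j : ℝ)..(j + 1 : ℕ), g i ⌊v⌋₊ = ∫ v in (j : ℝ)..(j + 1 : ℕ), g i j := by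
      refine (intervalIntegral.integral_congr_uIoo ?_).symm
      rw [Set.uIoo_of_le (by push_cast; linarith)]
      exact hstep i j
    rw [this]; simp
  refine Tendsto.congr' (f₁ := fun i => ∫ u in (0 : ℝ)..1, g i ⌊u * N i⌋₊) ?_ ?_
  · filter_upwards [hN] with i hi using (hsum i hi).symm
  · refine intervalIntegral.tendsto_integral_filter_of_dominated_convergence (fun _ => C) ?_ ?_ ?_ ?_
    · exact Eventually.of_forall fun i =>
        ((hmeas i).comp (measurable_id.mul_const _)).aestronglyMeasurable
    · filter_upwards [hC] with i hi
      exact Eventually.of_forall fun u _ => hi _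
    · exact intervalIntegrable_const
    · refine Eventually.of_forall fun u hu => ?_
      rw [Set.uIoc_of_le zero_le_one] at hu
      exact hφ u hu.1 hu.2

/-- The probability that at most one event of a Poisson process of rate `r` occurs in time `x`. -/
def erlangTail (r x : ℝ) : ℝ := Real.exp (-(r * x)) * (1 + r * x)

/-- The expected age of an M-D system when sensor B contributes age `w`: the integral of
`erlangTail r` over `[0, w]`. -/
def mdMeanAge (r w : ℝ) : ℝ :=
  2 * (1 - Real.exp (-(r * w))) / r - w * Real.exp (-(r * w))

/-- The mean peak `min (S + S') w` on the event `S' < w` that an update of sensor A is fresh, where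
`S'` is its service time, `S` the one before it, and `w` the age that sensor B alone would give. -/
def mdMeanPeak (r w : ℝ) : ℝ := mdMeanAge r w - w * Real.exp (-(r * w))

/-- The expected sum of the age peaks of the M-D system in one period of sensor B.  The last summand
belongs to the delivery of sensor B. -/
def mdPeakSumPerPeriod (r T : ℝ) : ℝ :=
  r * T * (∫ u in (0 : ℝ)..1, mdMeanPeak r (T * (1 + u))) +
    (mdMeanAge r (2 * T) - (mdMeanAge r T - T * erlangTail r T))

/-- The expected number of age peaks of the M-D system in one period of sensor B.  The last summand
belongs to the delivery of sensor B. -/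
def mdPeaksPerPeriod (r T : ℝ) : ℝ :=
  r * T * (∫ u in (0 : ℝ)..1, (1 - Real.exp (-(r * (T * (1 + u)))))) + erlangTail r T

lemma geoMeanAge_eq {p : ℝ} (hp : p ≠ 0) (n : ℕ) :
    geoMeanAge p n = (2 * (1 - (1 - p) ^ n) - n * p * (1 - p) ^ (n - 1)) / p := by
  rw [eq_div_iff hp]
  induction n with
  | zero => simp [geoMeanAge]
  | succ n ih =>
    rw [geoMeanAge, Finset.sum_range_succ, add_mul, ← geoMeanAge, ih, one_sub_geoPairCdf]
    rcases n with _ | n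
    · simp; ring
    · simp only [Nat.add_sub_cancel]
      push_cast
      ring

section

variable {r T : ℝ}

lemma tendsto_one_sub_pow {n : ℝ → ℕ} {y : ℝ}
    (hn : Tendsto (fun δ : ℝ => (n δ : ℝ) / δ) atTop (𝓝 y)) :
    Tendsto (fun δ : ℝ => (1 - r / δ) ^ n δ) atTop (𝓝 (Real.exp (-(r * y)))) := by
  have h1 := Real.tendsto_mul_log_one_add_div_atTop (-r)
  have h2 := (Real.continuous_exp.tendsto _).comp (hn.mul h1)
  rw [show y * -r = -(r * y) by ring] at h2
  refine h2.congr' ?_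
  filter_upwards [eventually_gt_atTop 0, eventually_gt_atTop r] with δ hδ hδr
  have : 0 < 1 - r / δ := by rw [sub_pos, div_lt_one hδ]; exact hδr
  have h3 : (n δ : ℝ) / δ * (δ * Real.log (1 + -r / δ)) = n δ * Real.log (1 - r / δ) := by
    rw [neg_div, ← sub_eq_add_neg]; field_simp
  simp only [Function.comp, h3]
  rw [mul_comm, ← Real.rpow_def_of_pos this, Real.rpow_natCast]

lemma tendsto_pred_div {n : ℝ → ℕ} {y : ℝ}
    (hn : Tendsto (fun δ : ℝ => (n δ : ℝ) / δ) atTop (𝓝 y)) :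
    Tendsto (fun δ : ℝ => ((n δ - 1 : ℕ) : ℝ) / δ) atTop (𝓝 y) := by
  have h : Tendsto (fun δ : ℝ => (n δ : ℝ) / δ - 1 / δ) atTop (𝓝 (y - 0)) :=
    hn.sub (tendsto_const_nhds.div_atTop tendsto_id)
  rw [sub_zero] at h
  refine tendsto_of_tendsto_of_tendsto_of_le_of_le' h hn ?_ ?_
  all_goals
    filter_upwards [eventually_gt_atTop 0] with δ hδ
  · rw [← sub_div]
    gcongr
    rw [sub_le_iff_le_add]
    exact_mod_cast (show n δ ≤ n δ - 1 + 1 by omega)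
  · gcongr
    omega

lemma tendsto_mul_rate {n : ℝ → ℕ} {y : ℝ}
    (hn : Tendsto (fun δ : ℝ => (n δ : ℝ) / δ) atTop (𝓝 y)) :
    Tendsto (fun δ : ℝ => (n δ : ℝ) * (r / δ)) atTop (𝓝 (r * y)) := by
  refine (hn.const_mul r).congr fun δ => ?_
  ring

lemma tendsto_one_sub_geoPairCdf {n : ℝ → ℕ} {y : ℝ}
    (hn : Tendsto (fun δ : ℝ => (n δ : ℝ) / δ) atTop (𝓝 y)) :
    Tendsto (fun δ : ℝ => 1 - geoPairCdf (r / δ) (n δ)) atTop (𝓝 (erlangTail r y)) := by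
  have h := (tendsto_one_sub_pow (r := r) hn).add
    ((tendsto_mul_rate (r := r) hn).mul (tendsto_one_sub_pow (r := r) (tendsto_pred_div hn)))
  rw [show Real.exp (-(r * y)) + r * y * Real.exp (-(r * y)) = erlangTail r y by
    rw [erlangTail]; ring] at h
  exact h.congr fun δ => (one_sub_geoPairCdf _ _).symm

lemma tendsto_geoMeanAge (hr : 0 < r) {n : ℝ → ℕ} {y : ℝ}
    (hn : Tendsto (fun δ : ℝ => (n δ : ℝ) / δ) atTop (𝓝 y)) :
    Tendsto (fun δ : ℝ => geoMeanAge (r / δ) (n δ) / δ) atTop (𝓝 (mdMeanAge r y)) := by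
  have h := ((((tendsto_one_sub_pow (r := r) hn).const_sub 1).const_mul 2).sub
    ((tendsto_mul_rate (r := r) hn).mul
      (tendsto_one_sub_pow (r := r) (tendsto_pred_div hn)))).div_const r
  rw [show (2 * (1 - Real.exp (-(r * y))) - r * y * Real.exp (-(r * y))) / r = mdMeanAge r y by
    rw [mdMeanAge]; field_simp] at h
  refine h.congr' ?_
  filter_upwards [eventually_gt_atTop 0] with δ hδ
  rw [geoMeanAge_eq (by positivity)]
  field_simp

lemma tendsto_ceil_div (hT : 0 < T) :
    Tendsto (fun δ : ℝ => (⌈δ * T⌉₊ : ℝ) / δ) atTop (𝓝 T) :=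
  (tendsto_nat_ceil_mul_div_atTop hT.le).congr fun δ => by rw [mul_comm]

lemma tendsto_ceil_atTop (hT : 0 < T) : Tendsto (fun δ : ℝ => ⌈δ * T⌉₊) atTop atTop :=
  tendsto_nat_ceil_atTop.comp (tendsto_id.atTop_mul_const hT)

lemma tendsto_ceil_add_floor_div (hT : 0 < T) {u : ℝ} (hu : 0 ≤ u) (c : ℕ) :
    Tendsto (fun δ : ℝ => ((⌈δ * T⌉₊ + c + ⌊u * ⌈δ * T⌉₊⌋₊ : ℕ) : ℝ) / δ) atTop
      (𝓝 (T * (1 + u))) := by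
  have h1 : Tendsto (fun δ : ℝ => (⌊u * (⌈δ * T⌉₊ : ℝ)⌋₊ : ℝ) / (⌈δ * T⌉₊ : ℝ)) atTop (𝓝 u) :=
    (tendsto_nat_floor_mul_div_atTop hu).comp
      (tendsto_natCast_atTop_atTop.comp (tendsto_ceil_atTop hT))
  have h2 : Tendsto (fun δ : ℝ => (c : ℝ) / δ) atTop (𝓝 0) :=
    tendsto_const_nhds.div_atTop tendsto_id
  have h := ((tendsto_ceil_div hT).add h2).add (h1.mul (tendsto_ceil_div hT))
  rw [show T + 0 + u * T = T * (1 + u) by ring] at h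
  refine h.congr' ?_
  filter_upwards [(tendsto_ceil_atTop hT).eventually_gt_atTop 0] with δ hδ
  have : (⌈δ * T⌉₊ : ℝ) ≠ 0 := by exact_mod_cast hδ.ne'
  push_cast
  rw [div_mul_div_cancel₀ this, add_div, add_div]

lemma eventually_rate (hr : 0 < r) : ∀ᶠ δ : ℝ in atTop, 0 < r / δ ∧ r / δ ≤ 1 ∧ 0 < δ := by
  filter_upwards [eventually_gt_atTop 0, eventually_ge_atTop r] with δ hδ hδ'
  exact ⟨by positivity, (div_le_one hδ).2 hδ', hδ⟩

lemma geoMeanAge_div_le (hr : 0 < r) {δ : ℝ} (hδ : 0 < δ) (hp1 : r / δ ≤ 1) (n : ℕ) :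
    geoMeanAge (r / δ) n / δ ≤ 2 / r := by
  have hp : 0 < r / δ := by positivity
  have hq : 0 ≤ 1 - r / δ := by linarith
  rw [geoMeanAge_eq hp.ne', div_div, div_mul_cancel₀ _ hδ.ne']
  gcongr
  have h1 : 0 ≤ (1 - r / δ) ^ n := by positivity
  have h2 : 0 ≤ n * (r / δ) * (1 - r / δ) ^ (n - 1) := by positivity
  linarith

lemma mul_pow_div_le (hr : 0 < r) {δ : ℝ} (hδ : 0 < δ) (hp1 : r / δ ≤ 1) (n : ℕ) :
    n * (1 - r / δ) ^ (n - 1) / δ ≤ 1 / r := by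
  have hp : 0 < r / δ := by positivity
  have hq : 0 ≤ 1 - r / δ := by linarith
  have h1 := one_sub_geoPairCdf (r / δ) n
  have h2 := geoPairCdf_nonneg hp hp1 n
  have h3 : 0 ≤ (1 - r / δ) ^ n := by positivity
  rw [div_le_div_iff₀ hδ hr]
  have h4 : n * (r / δ) * (1 - r / δ) ^ (n - 1) ≤ 1 := by linarith
  have h5 : n * (r / δ) * (1 - r / δ) ^ (n - 1) * δ = n * (1 - r / δ) ^ (n - 1) * r := by
    field_simp
  nlinarith

/-- The scaled average age of the Geo-D system converges. -/
lemma tendsto_geoAgePerPeriod (hr : 0 < r) (hT : 0 < T) :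
    Tendsto (fun δ : ℝ => 1 / δ * (geoAgePerPeriod (r / δ) ⌈δ * T⌉₊ / ⌈δ * T⌉₊)) atTop
      (𝓝 (∫ u in (0 : ℝ)..1, mdMeanAge r (T * (1 + u)))) := by
  have h := tendsto_sum_range_div_integral (l := (atTop : Filter ℝ))
    (g := fun δ j => geoMeanAge (r / δ) (⌈δ * T⌉₊ + 1 + j) / δ) (N := fun δ => ⌈δ * T⌉₊)
    (φ := fun u => mdMeanAge r (T * (1 + u))) (C := 2 / r)
    ((tendsto_ceil_atTop hT).eventually_gt_atTop 0) (by
      filter_upwards [eventually_rate hr] with δ ⟨hp, hp1, hδ⟩ j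
      rw [abs_of_nonneg (div_nonneg (geoMeanAge_nonneg hp hp1 _) hδ.le)]
      exact geoMeanAge_div_le hr hδ hp1 _)
    (fun u hu _ => tendsto_geoMeanAge hr (tendsto_ceil_add_floor_div hT hu.le 1))
  refine h.congr fun δ => ?_
  rw [geoAgePerPeriod, ← Finset.sum_div]
  ring

lemma tendsto_ceil_mul_rate (hT : 0 < T) :
    Tendsto (fun δ : ℝ => (⌈δ * T⌉₊ : ℝ) * (r / δ)) atTop (𝓝 (r * T)) :=
  tendsto_mul_rate (tendsto_ceil_div hT)

lemma tendsto_rate : Tendsto (fun δ : ℝ => r / δ) atTop (𝓝 0) :=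
  tendsto_const_nhds.div_atTop tendsto_id

/-- Sums over the slots between two deliveries of sensor B, weighted with the vanishing delivery
probability of sensor A. -/
lemma tendsto_rate_mul_sum (hT : 0 < T) {g : ℝ → ℕ → ℝ} {φ : ℝ → ℝ} {C : ℝ}
    (hC : ∀ᶠ δ in atTop, ∀ j, |g δ j| ≤ C)
    (hφ : ∀ u : ℝ, 0 < u → u ≤ 1 →
      Tendsto (fun δ : ℝ => g δ ⌊u * ⌈δ * T⌉₊⌋₊) atTop (𝓝 (φ u))) :
    Tendsto (fun δ : ℝ => r / δ * ∑ j ∈ Finset.range (⌈δ * T⌉₊ - 1), g δ j) atTop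
      (𝓝 (r * T * ∫ u in (0 : ℝ)..1, φ u)) := by
  have h := tendsto_sum_range_div_integral (l := (atTop : Filter ℝ)) (g := g)
    (N := fun δ => ⌈δ * T⌉₊) ((tendsto_ceil_atTop hT).eventually_gt_atTop 0) hC hφ
  have h0 : Tendsto (fun δ : ℝ => r / δ * g δ (⌈δ * T⌉₊ - 1)) atTop (𝓝 0) := by
    refine Tendsto.zero_mul_isBoundedUnder_le tendsto_rate ?_
    refine ⟨C, ?_⟩
    rw [eventually_map]
    filter_upwards [hC] with δ hδ
    exact hδ _
  have h1 := ((tendsto_ceil_mul_rate (r := r) hT).mul h).sub h0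
  rw [sub_zero] at h1
  refine h1.congr' ?_
  filter_upwards [(tendsto_ceil_atTop hT).eventually_gt_atTop 0] with δ hδ
  have : (⌈δ * T⌉₊ : ℝ) ≠ 0 := by exact_mod_cast hδ.ne'
  rw [sum_range_pred_add _ hδ]
  field_simp
  ring

/-- The expected number of peaks in one period converges. -/
lemma tendsto_geoPeaksPerPeriod (hr : 0 < r) (hT : 0 < T) :
    Tendsto (fun δ : ℝ => geoPeaksPerPeriod (r / δ) ⌈δ * T⌉₊) atTop
      (𝓝 (mdPeaksPerPeriod r T)) := by
  have h1 := tendsto_rate_mul_sum (r := r) hT (C := 1)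
    (g := fun δ j => 1 - (1 - r / δ) ^ (⌈δ * T⌉₊ + j))
    (φ := fun u => 1 - Real.exp (-(r * (T * (1 + u))))) (by
      filter_upwards [eventually_rate hr] with δ ⟨hp, hp1, hδ⟩ j
      rw [abs_of_nonneg (one_sub_pow_nonneg hp hp1 _)]
      have : 0 ≤ (1 - r / δ) ^ (⌈δ * T⌉₊ + j) := pow_nonneg (by linarith) _
      linarith)
    (fun u hu _ => (tendsto_one_sub_pow (tendsto_ceil_add_floor_div hT hu.le 0)).const_sub 1)
  have h2 : Tendsto (fun δ : ℝ => 1 - (1 - r / δ) * geoPairCdf (r / δ) ⌈δ * T⌉₊) atTop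
      (𝓝 (erlangTail r T)) := by
    have h3 := tendsto_one_sub_geoPairCdf (r := r) (tendsto_ceil_div hT)
    have h4 := (((tendsto_rate (r := r)).const_sub 1).mul (h3.const_sub 1)).const_sub 1
    rw [show 1 - (1 - 0) * (1 - erlangTail r T) = erlangTail r T by ring] at h4
    refine h4.congr fun δ => ?_
    ring
  refine (h1.add h2).congr fun δ => ?_
  rw [geoPeaksPerPeriod, Finset.mul_sum]

lemma sum_peak_off_delivery (p : ℝ) (w n : ℕ) :
    ∑ x ∈ Finset.range w, (p * (1 - (1 - p) ^ n) - p * geoPairCdf p x) =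
      p * (geoMeanAge p w - w * (1 - p) ^ n) := by
  have : ∀ x, p * (1 - (1 - p) ^ n) - p * geoPairCdf p x =
      p * (1 - geoPairCdf p x) - p * (1 - p) ^ n := fun x => by ring
  simp_rw [this]
  rw [Finset.sum_sub_distrib, ← Finset.mul_sum, ← geoMeanAge, Finset.sum_const, Finset.card_range,
    nsmul_eq_mul]
  ring

lemma sum_peak_on_delivery (p : ℝ) (N : ℕ) :
    ∑ x ∈ Finset.range (2 * N),
        (1 - geoPairCdf p x - (1 - p) * (geoPairCdf p N - geoPairCdf p (min x N))) =
      geoMeanAge p (2 * N) - (1 - p) * (geoMeanAge p N - N * (1 - geoPairCdf p N)) := by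
  rw [Finset.sum_sub_distrib, ← geoMeanAge, ← Finset.mul_sum]
  congr 2
  rw [two_mul, Finset.sum_range_add]
  have h2 : ∑ x ∈ Finset.range N, (geoPairCdf p N - geoPairCdf p (min (N + x) N)) = 0 :=
    Finset.sum_eq_zero fun x _ => by rw [min_eq_right (by omega), sub_self]
  have h1 : ∑ x ∈ Finset.range N, (geoPairCdf p N - geoPairCdf p (min x N)) =
      ∑ x ∈ Finset.range N, ((1 - geoPairCdf p x) - (1 - geoPairCdf p N)) := by
    refine Finset.sum_congr rfl fun x hx => ?_
    rw [Finset.mem_range] at hx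
    rw [min_eq_left hx.le]; ring
  rw [h1, h2, add_zero, Finset.sum_sub_distrib, Finset.sum_const, Finset.card_range, nsmul_eq_mul,
    geoMeanAge]

/-- The scaled expected sum of the peaks in one period converges. -/
lemma tendsto_geoPeakSumPerPeriod (hr : 0 < r) (hT : 0 < T) :
    Tendsto (fun δ : ℝ => 1 / δ * geoPeakSumPerPeriod (r / δ) ⌈δ * T⌉₊) atTop
      (𝓝 (mdPeakSumPerPeriod r T)) := by
  have h1 := tendsto_rate_mul_sum (r := r) hT (C := 2 / r + 1 / r)
    (g := fun δ j => geoMeanAge (r / δ) (⌈δ * T⌉₊ + 1 + j) / δ -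
      ((⌈δ * T⌉₊ + 1 + j : ℕ) : ℝ) * (1 - r / δ) ^ (⌈δ * T⌉₊ + 1 + j - 1) / δ)
    (φ := fun u => mdMeanPeak r (T * (1 + u))) (by
      filter_upwards [eventually_rate hr] with δ ⟨hp, hp1, hδ⟩ j
      refine (abs_sub _ _).trans (add_le_add ?_ ?_)
      · rw [abs_of_nonneg (div_nonneg (geoMeanAge_nonneg hp hp1 _) hδ.le)]
        exact geoMeanAge_div_le hr hδ hp1 _
      · have hq : 0 ≤ 1 - r / δ := by linarith
        rw [abs_of_nonneg (by positivity)]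
        exact mul_pow_div_le hr hδ hp1 _)
    (fun u hu _ => by
      have h := tendsto_ceil_add_floor_div hT hu.le 1
      refine (tendsto_geoMeanAge hr h).sub ?_
      refine (h.mul (tendsto_one_sub_pow (r := r) (tendsto_pred_div h))).congr fun δ => ?_
      ring)
  have hN := tendsto_ceil_div hT
  have h2N : Tendsto (fun δ : ℝ => ((2 * ⌈δ * T⌉₊ : ℕ) : ℝ) / δ) atTop (𝓝 (2 * T)) :=
    (hN.const_mul 2).congr fun δ => by push_cast; ring
  have h2 := (tendsto_geoMeanAge hr h2N).sub (((tendsto_rate (r := r)).const_sub 1).mul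
    ((tendsto_geoMeanAge hr hN).sub (hN.mul (tendsto_one_sub_geoPairCdf (r := r) hN))))
  rw [sub_zero, one_mul] at h2
  refine (h1.add h2).congr fun δ => ?_
  rw [geoPeakSumPerPeriod, sum_peak_on_delivery]
  have : ∀ j, ∑ x ∈ Finset.range (⌈δ * T⌉₊ + 1 + j), (r / δ * (1 - (1 - r / δ) ^ (⌈δ * T⌉₊ + j)) -
      r / δ * geoPairCdf (r / δ) x) = r / δ * (geoMeanAge (r / δ) (⌈δ * T⌉₊ + 1 + j) -
      ((⌈δ * T⌉₊ + 1 + j : ℕ) : ℝ) * (1 - r / δ) ^ (⌈δ * T⌉₊ + 1 + j - 1)) := by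
    intro j
    rw [sum_peak_off_delivery, show ⌈δ * T⌉₊ + 1 + j - 1 = ⌈δ * T⌉₊ + j by omega]
  simp_rw [this, ← Finset.mul_sum, ← sub_div, ← Finset.sum_div]
  ring

end

/-! ### The renewal measure of exponential service times -/

/-- Lower integrals of nonnegative functions with an explicit primitive. -/
lemma lintegral_Ioc_eq_sub {F f : ℝ → ℝ} {a b : ℝ} (hab : a ≤ b)
    (hF : ∀ x, HasDerivAt F (f x) x) (hf : Continuous f) (h0 : ∀ x, a < x → x ≤ b → 0 ≤ f x) :
    ∫⁻ x in Set.Ioc a b, ENNReal.ofReal (f x) = ENNReal.ofReal (F b - F a) := by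
  rw [← intervalIntegral.integral_eq_sub_of_hasDerivAt (fun x _ => hF x)
    (hf.intervalIntegrable a b), intervalIntegral.integral_of_le hab,
    ofReal_integral_eq_lintegral_ofReal]
  · exact (hf.intervalIntegrable a b).1
  · filter_upwards [ae_restrict_mem measurableSet_Ioc] with x hx using h0 x hx.1 hx.2

/-- The convolution of two densities on the positive half-line. -/
lemma lintegral_Ioi_convolution {a b f : ℝ → ℝ≥0∞} (ha : Measurable a) (hb : Measurable b)
    (hf : Measurable f) :
    ∫⁻ x in Set.Ioi 0, a x * ∫⁻ s in Set.Ioi 0, b s * f (x + s) =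
      ∫⁻ z in Set.Ioi 0, (∫⁻ x in Set.Ioc 0 z, a x * b (z - x)) * f z := by
  set K : ℝ → ℝ → ℝ≥0∞ := fun x z =>
    {q : ℝ × ℝ | 0 < q.1 ∧ q.1 < q.2}.indicator (fun q => a q.1 * b (q.2 - q.1) * f q.2) (x, z)
    with hK
  have hS : MeasurableSet {q : ℝ × ℝ | 0 < q.1 ∧ q.1 < q.2} :=
    (measurableSet_lt measurable_const measurable_fst).inter
      (measurableSet_lt measurable_fst measurable_snd)
  have hKm : Measurable (Function.uncurry K) := by
    refine Measurable.indicator ?_ hS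
    exact (((ha.comp measurable_fst).mul (hb.comp (measurable_snd.sub measurable_fst))).mul
      (hf.comp measurable_snd))
  have h1 : ∫⁻ x in Set.Ioi 0, a x * ∫⁻ s in Set.Ioi 0, b s * f (x + s) =
      ∫⁻ x, ∫⁻ z, K x z := by
    rw [← lintegral_indicator measurableSet_Ioi]
    refine lintegral_congr fun x => ?_
    by_cases hx : 0 < x
    · rw [Set.indicator_of_mem (Set.mem_Ioi.2 hx), ← lintegral_indicator measurableSet_Ioi,
        ← lintegral_sub_right_eq_self _ x, ← lintegral_const_mul]
      · refine lintegral_congr fun z => ?_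
        by_cases hz : x < z
        · rw [hK, Set.indicator_of_mem (by simpa using hz)]
          simp only
          rw [Set.indicator_of_mem (show (x, z) ∈ {q : ℝ × ℝ | 0 < q.1 ∧ q.1 < q.2} from ⟨hx, hz⟩)]
          simp [mul_assoc]
        · rw [hK, Set.indicator_of_notMem (by simpa using hz)]
          simp only
          rw [Set.indicator_of_notMem (fun h => hz h.2), mul_zero]
      · refine Measurable.comp (g := (Set.Ioi (0 : ℝ)).indicator fun s => b s * f (x + s)) ?_
          (measurable_id.sub_const x)
        exact Measurable.indicator (hb.mul (hf.comp (measurable_const_add x))) measurableSet_Ioi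
    · rw [Set.indicator_of_notMem (by simpa using hx)]
      simp only [hK]
      rw [lintegral_congr (g := fun _ => 0) fun z => Set.indicator_of_notMem (fun h => hx h.1) _,
        lintegral_zero]
  rw [h1, lintegral_lintegral_swap hKm.aemeasurable, ← lintegral_indicator measurableSet_Ioi]
  refine lintegral_congr fun z => ?_
  by_cases hz : 0 < z
  · rw [Set.indicator_of_mem (Set.mem_Ioi.2 hz),
      setLIntegral_congr (Ioo_ae_eq_Ioc (a := (0 : ℝ)) (b := z)).symm,
      ← lintegral_mul_const _ (show Measurable fun x => a x * b (z - x) from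
        ha.mul (hb.comp (measurable_const.sub measurable_id))),
      ← lintegral_indicator measurableSet_Ioo]
    refine lintegral_congr fun x => ?_
    simp only [hK, Set.indicator_apply, Set.mem_Ioo, Set.mem_ofPred_eq]
  · rw [Set.indicator_of_notMem (by simpa using hz)]
    simp only [hK]
    rw [lintegral_congr (g := fun _ => 0) fun x =>
      Set.indicator_of_notMem (fun h => hz (h.1.trans h.2)) _, lintegral_zero]

section

variable {r : ℝ}

lemma lintegral_expMeasure (r : ℝ) {f : ℝ → ℝ≥0∞} (hf : Measurable f) :
    ∫⁻ x, f x ∂(expMeasure r) =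
      ∫⁻ x in Set.Ioi 0, ENNReal.ofReal (r * Real.exp (-(r * x))) * f x := by
  have h : expMeasure r = volume.withDensity (exponentialPDF r) := rfl
  have hm : Measurable (exponentialPDF r) := (measurable_exponentialPDFReal r).ennreal_ofReal
  rw [h, lintegral_withDensity_eq_lintegral_mul _ hm hf,
    setLIntegral_congr Ioi_ae_eq_Ici, ← lintegral_indicator measurableSet_Ici]
  refine lintegral_congr fun x => ?_
  by_cases hx : 0 ≤ x
  · simp [Set.indicator_of_mem (Set.mem_Ici.2 hx), exponentialPDF_of_nonneg hx]
  · rw [Set.indicator_of_notMem (by simpa using hx), Pi.mul_apply,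
      exponentialPDF_of_neg (not_le.1 hx), zero_mul]

lemma ae_expMeasure_pos (r : ℝ) : ∀ᵐ x ∂(expMeasure r), 0 < x := by
  rw [ae_iff, ← lintegral_indicator_one (by measurability),
    lintegral_expMeasure r (measurable_one.indicator (by measurability))]
  refine (setLIntegral_congr_fun measurableSet_Ioi (g := fun _ => 0) fun x hx => ?_).trans
    lintegral_zero
  rw [Set.indicator_of_notMem (s := {a : ℝ | ¬ 0 < a}) (fun h : ¬ 0 < x => h hx), mul_zero]

/-- The cumulative distribution function of the exponential law. -/
lemma expMeasure_Iio (hr : 0 < r) {y : ℝ} (hy : 0 ≤ y) :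
    expMeasure r (Set.Iio y) = ENNReal.ofReal (1 - Real.exp (-(r * y))) := by
  rw [← lintegral_indicator_one measurableSet_Iio,
    lintegral_expMeasure r (measurable_one.indicator measurableSet_Iio),
    ← lintegral_indicator measurableSet_Ioi]
  have h := lintegral_Ioc_eq_sub (F := fun x => -Real.exp (-(r * x)))
    (f := fun x => r * Real.exp (-(r * x))) hy (fun x => hasDerivAt_neg_exp_mul_exp)
    (by fun_prop) (fun x _ _ => by positivity)
  rw [show 1 - Real.exp (-(r * y)) = -Real.exp (-(r * y)) - -Real.exp (-(r * 0)) by simp; ring,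
    ← h, setLIntegral_congr Ioo_ae_eq_Ioc.symm, ← lintegral_indicator measurableSet_Ioo]
  refine lintegral_congr fun x => ?_
  by_cases h1 : 0 < x <;> by_cases h2 : x < y <;> simp [Set.indicator_apply, h1, h2]

lemma measurable_expDensity (r : ℝ) :
    Measurable fun x : ℝ => ENNReal.ofReal (r * Real.exp (-(r * x))) := by fun_prop

/-- The sum of `n + 1` exponential service times has an Erlang law. -/
lemma lintegral_map_genTime_exp (hr : 0 < r) (n : ℕ) {f : ℝ → ℝ≥0∞} (hf : Measurable f) :
    ∫⁻ x, f x ∂((expPathLaw r).map fun ω => genTime ω (n + 1)) =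
      ∫⁻ x in Set.Ioi 0, ENNReal.ofReal (r ^ (n + 1) * x ^ n / n.factorial *
        Real.exp (-(r * x))) * f x := by
  have := isProbabilityMeasure_expMeasure hr
  have hfs : ∀ f : ℝ → ℝ≥0∞, Measurable f → ∀ x, ∫⁻ s, f (x + s) ∂(expMeasure r) =
      ∫⁻ s in Set.Ioi 0, ENNReal.ofReal (r * Real.exp (-(r * s))) * f (x + s) := fun f hf x =>
    lintegral_expMeasure r (hf.comp (measurable_const_add x))
  have hfm : ∀ f : ℝ → ℝ≥0∞, Measurable f →
      Measurable fun x => ∫⁻ s, f (x + s) ∂(expMeasure r) := fun f hf =>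
    Measurable.lintegral_prod_right' (f := fun q : ℝ × ℝ => f (q.1 + q.2)) (by fun_prop)
  induction n generalizing f with
  | zero =>
    rw [expPathLaw, lintegral_map_genTime_succ _ _ hf, lintegral_map_genTime_zero _ (hfm f hf)]
    simp [lintegral_expMeasure r hf]
  | succ n ih =>
    rw [expPathLaw, lintegral_map_genTime_succ _ _ hf, ← expPathLaw, ih (hfm f hf)]
    simp_rw [hfs f hf]
    rw [lintegral_Ioi_convolution (by fun_prop) (measurable_expDensity r) hf]
    refine setLIntegral_congr_fun measurableSet_Ioi fun z hz => ?_
    have hz' : 0 ≤ z := le_of_lt hz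
    congr 1
    have h := lintegral_Ioc_eq_sub
      (F := fun x => r ^ (n + 2) * Real.exp (-(r * z)) / n.factorial * (x ^ (n + 1) / (n + 1 : ℕ)))
      (f := fun x => r ^ (n + 2) * Real.exp (-(r * z)) / n.factorial * x ^ n) hz'
      (fun x => by
        have := ((hasDerivAt_pow (n + 1) x).div_const ((n + 1 : ℕ) : ℝ)).const_mul
          (r ^ (n + 2) * Real.exp (-(r * z)) / n.factorial)
        refine this.congr_deriv ?_
        rw [Nat.add_sub_cancel]
        field_simp)
      (by fun_prop) (fun x hx _ => by positivity)
    rw [show r ^ (n + 1 + 1) * z ^ (n + 1) / (n + 1).factorial * Real.exp (-(r * z)) =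
      r ^ (n + 2) * Real.exp (-(r * z)) / n.factorial * (z ^ (n + 1) / (n + 1 : ℕ)) -
      r ^ (n + 2) * Real.exp (-(r * z)) / n.factorial * (0 ^ (n + 1) / (n + 1 : ℕ)) by
        rw [Nat.factorial_succ]; push_cast; field_simp; simp, ← h]
    refine setLIntegral_congr_fun measurableSet_Ioc fun x hx => ?_
    have hx0 : 0 < x := hx.1
    rw [← ENNReal.ofReal_mul (by positivity)]
    congr 1
    rw [show Real.exp (-(r * z)) = Real.exp (-(r * x)) * Real.exp (-(r * (z - x))) by
      rw [← Real.exp_add]; congr 1; ring]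
    ring

/-- The renewal measure of a Poisson process is `r` times Lebesgue measure on the positive
half-line, together with the atom at the origin of the first generation time. -/
lemma lintegral_renewal_exp (hr : 0 < r) {f : ℝ → ℝ≥0∞} (hf : Measurable f) :
    ∫⁻ x, f x ∂(renewal (expMeasure r)) = f 0 + ∫⁻ x in Set.Ioi 0, ENNReal.ofReal r * f x := by
  have := isProbabilityMeasure_expMeasure hr
  rw [renewal, lintegral_sum_measure, tsum_eq_zero_add' ENNReal.summable,
    lintegral_map_genTime_zero _ hf]
  congr 1
  have h := fun n => lintegral_map_genTime_exp hr n hf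
  simp only [expPathLaw] at h
  simp_rw [h]
  rw [← lintegral_tsum fun n => by fun_prop]
  refine setLIntegral_congr_fun measurableSet_Ioi fun x hx => ?_
  rw [ENNReal.tsum_mul_right]
  congr 1
  have hx0 : 0 < x := hx
  have hs : HasSum (fun n : ℕ => r ^ (n + 1) * x ^ n / n.factorial * Real.exp (-(r * x))) r := by
    have := (NormedSpace.expSeries_div_hasSum_exp (r * x)).mul_left (r * Real.exp (-(r * x)))
    rw [← Real.exp_eq_exp_ℝ, mul_assoc, ← Real.exp_add, neg_add_cancel, Real.exp_zero,
      mul_one] at this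
    refine this.congr_fun fun n => ?_
    rw [mul_pow]; ring
  rw [← ENNReal.ofReal_tsum_of_nonneg (fun n => by positivity) hs.summable, hs.tsum_eq]

/-- When the first generation time does not contribute, sums over updates become integrals over
the whole line, which can be shifted to the delivery time `t = x + c`. -/
lemma lintegral_renewal_exp_shift (hr : 0 < r) {f : ℝ → ℝ≥0∞} (hf : Measurable f)
    (h0 : ∀ x ≤ 0, f x = 0) (c : ℝ) :
    ∫⁻ x, f x ∂(renewal (expMeasure r)) = ENNReal.ofReal r * ∫⁻ t, f (t - c) := by
  rw [lintegral_renewal_exp hr hf, h0 0 le_rfl, zero_add, lintegral_const_mul _ hf,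
    lintegral_sub_right_eq_self f c, ← lintegral_indicator measurableSet_Ioi]
  congr 1
  refine lintegral_congr fun x => ?_
  by_cases hx : 0 < x
  · rw [Set.indicator_of_mem (Set.mem_Ioi.2 hx)]
  · rw [Set.indicator_of_notMem (by simpa using hx), h0 x (not_lt.1 hx)]

/-- The event that a service interval straddles the time `v` while the preceding service started
at time `0`. -/
lemma lintegral_exp_straddle (hr : 0 < r) {v : ℝ} (hv : 0 < v) :
    ∫⁻ s, expMeasure r {s' | s < v ∧ v ≤ s + s'} ∂(expMeasure r) =
      ENNReal.ofReal (r * v * Real.exp (-(r * v))) := by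
  have := isProbabilityMeasure_expMeasure hr
  have h1 : ∀ s, expMeasure r {s' | s < v ∧ v ≤ s + s'} =
      (Set.Iio v).indicator (fun s => ENNReal.ofReal (Real.exp (-(r * (v - s))))) s := by
    intro s
    by_cases hs : s < v
    · have h2 : {s' | s < v ∧ v ≤ s + s'} = (Set.Iio (v - s))ᶜ := by
        ext s'; simp [hs]; constructor <;> intro h <;> linarith
      rw [Set.indicator_of_mem (Set.mem_Iio.2 hs), h2, prob_compl_eq_one_sub measurableSet_Iio,
        expMeasure_Iio hr (by linarith), ← ENNReal.ofReal_one, ← ENNReal.ofReal_sub]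
      · congr 1; ring
      · rw [sub_nonneg, Real.exp_le_one_iff]
        have : 0 ≤ r * (v - s) := mul_nonneg hr.le (by linarith)
        linarith
    · rw [Set.indicator_of_notMem (by simpa using hs)]
      simp [hs]
  simp_rw [h1]
  have hm : Measurable fun s : ℝ => ENNReal.ofReal (Real.exp (-(r * (v - s)))) := by fun_prop
  rw [lintegral_expMeasure r (hm.indicator measurableSet_Iio),
    ← lintegral_indicator measurableSet_Ioi]
  have h := lintegral_Ioc_eq_sub (F := fun x => r * Real.exp (-(r * v)) * x)
    (f := fun _ => r * Real.exp (-(r * v))) hv.le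
    (fun x => by simpa using (hasDerivAt_id x).const_mul (r * Real.exp (-(r * v))))
    (by fun_prop) (fun x _ _ => by positivity)
  rw [show r * v * Real.exp (-(r * v)) = r * Real.exp (-(r * v)) * v -
    r * Real.exp (-(r * v)) * 0 by ring, ← h, setLIntegral_congr Ioo_ae_eq_Ioc.symm,
    ← lintegral_indicator measurableSet_Ioo]
  refine lintegral_congr fun s => ?_
  by_cases h1 : 0 < s <;> by_cases h2 : s < v <;> simp [Set.indicator_apply, h1, h2]
  rw [← ENNReal.ofReal_mul (by positivity), mul_assoc, ← Real.exp_add]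
  congr 3; ring

lemma hasDerivAt_erlangTail (r x : ℝ) :
    HasDerivAt (fun x => -erlangTail r x) (r ^ 2 * x * Real.exp (-(r * x))) x := by
  have h1 : HasDerivAt (fun x : ℝ => Real.exp (-(r * x))) (Real.exp (-(r * x)) * (-r)) x := by
    have := ((hasDerivAt_id x).const_mul r).neg.exp
    simpa using this
  have h2 : HasDerivAt (fun x : ℝ => 1 + r * x) r x := by
    simpa using ((hasDerivAt_id x).const_mul r).const_add 1
  refine ((h1.mul h2).neg).congr_deriv ?_
  ring

lemma hasDerivAt_mdMeanAge (hr : r ≠ 0) (x : ℝ) :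
    HasDerivAt (mdMeanAge r) (erlangTail r x) x := by
  have h1 : HasDerivAt (fun x : ℝ => Real.exp (-(r * x))) (Real.exp (-(r * x)) * (-r)) x := by
    have := ((hasDerivAt_id x).const_mul r).neg.exp
    simpa using this
  have h := (((h1.const_sub 1).const_mul 2).div_const r).sub ((hasDerivAt_id x).mul h1)
  refine h.congr_deriv ?_
  simp only [erlangTail, id]
  field_simp
  ring

lemma erlangTail_le_one (r x : ℝ) : erlangTail r x ≤ 1 := by
  have h := Real.add_one_le_exp (r * x)
  rw [erlangTail, Real.exp_neg, inv_mul_le_iff₀ (Real.exp_pos _)]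
  linarith

lemma erlangTail_nonneg (hr : 0 < r) {x : ℝ} (hx : 0 ≤ x) : 0 ≤ erlangTail r x := by
  unfold erlangTail; positivity

lemma continuous_erlangTail : Continuous (erlangTail r) := by unfold erlangTail; fun_prop

lemma continuous_mdMeanAge : Continuous (mdMeanAge r) := by
  unfold mdMeanAge; fun_prop

/-- The expected positive part of `y` minus two service times. -/
lemma lintegral_exp_pair_deficit (hr : 0 < r) {y : ℝ} (hy : 0 ≤ y) :
    ∫⁻ s, ∫⁻ s', ENNReal.ofReal (y - s - s') ∂(expMeasure r) ∂(expMeasure r) =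
      ENNReal.ofReal (y - mdMeanAge r y) := by
  have := isProbabilityMeasure_expMeasure hr
  have h1 := lintegral_genTime_pair (expMeasure r) 0
    (f := fun q => ENNReal.ofReal (y - q.2.1 - q.2.2)) (by fun_prop)
  have h2 := lintegral_map_genTime_zero (expMeasure r) (f := fun _ => ∫⁻ s, ∫⁻ s',
    ENNReal.ofReal (y - s - s') ∂(expMeasure r) ∂(expMeasure r)) measurable_const
  rw [h2] at h1
  have h3 := lintegral_map_genTime_exp hr 1 (f := fun x => ENNReal.ofReal (y - x)) (by fun_prop)
  rw [expPathLaw, lintegral_map (by fun_prop) (by fun_prop)] at h3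
  rw [← h1]
  have h4 : ∀ ω : ℕ → ℝ, y - ω 0 - ω (0 + 1) = y - genTime ω (1 + 1) := by
    intro ω; simp [genTime, Finset.sum_range_succ]; ring
  simp_rw [h4]
  rw [h3]
  have h := lintegral_Ioc_eq_sub
    (F := fun v => (y - v) * (-erlangTail r v) + Real.exp (-(r * v)) * (2 + r * v) / r)
    (f := fun v => (y - v) * (r ^ 2 * v * Real.exp (-(r * v)))) hy (fun v => by
      have a1 : HasDerivAt (fun x : ℝ => Real.exp (-(r * x))) (Real.exp (-(r * v)) * (-r)) v := by
        have := ((hasDerivAt_id v).const_mul r).neg.exp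
        simpa using this
      have a2 : HasDerivAt (fun x : ℝ => 2 + r * x) r v := by
        simpa using ((hasDerivAt_id v).const_mul r).const_add 2
      have a3 : HasDerivAt (fun x : ℝ => y - x) (-1) v := by
        simpa using (hasDerivAt_id v).const_sub y
      refine ((a3.mul (hasDerivAt_erlangTail r v)).add ((a1.mul a2).div_const r)).congr_deriv ?_
      simp only [erlangTail]
      field_simp
      ring)
    (by fun_prop) (fun v hv hvy => by
      have : 0 ≤ y - v := by linarith
      positivity)
  have h5 : y - mdMeanAge r y =
      ((y - y) * (-erlangTail r y) + Real.exp (-(r * y)) * (2 + r * y) / r) -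
      ((y - 0) * (-erlangTail r 0) + Real.exp (-(r * 0)) * (2 + r * 0) / r) := by
    simp only [mdMeanAge, erlangTail, mul_zero, neg_zero, Real.exp_zero]
    field_simp
    ring
  rw [h5, ← h, ← lintegral_indicator measurableSet_Ioi, ← lintegral_indicator measurableSet_Ioc]
  refine lintegral_congr fun v => ?_
  by_cases hv : 0 < v
  · by_cases hvy : v ≤ y
    · rw [Set.indicator_of_mem (Set.mem_Ioi.2 hv), Set.indicator_of_mem (Set.mem_Ioc.2 ⟨hv, hvy⟩),
        ← ENNReal.ofReal_mul (by positivity)]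
      congr 1
      simp; ring
    · rw [Set.indicator_of_mem (Set.mem_Ioi.2 hv), Set.indicator_of_notMem (fun h => hvy h.2),
        ENNReal.ofReal_of_nonpos (by linarith : y - v ≤ 0), mul_zero]
  · rw [Set.indicator_of_notMem (by simpa using hv), Set.indicator_of_notMem (fun h => hv h.1)]

end

/-! ### The continuous age of information -/

section Stamp

variable {s : Fin 2 → ℕ → ℝ}

lemma genTime_nonneg {ω : ℕ → ℝ} (hω : ∀ i, 0 ≤ ω i) (i : ℕ) : 0 ≤ genTime ω i :=
  Finset.sum_nonneg fun j _ => hω j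

lemma genTime_le_delTime {ω : ℕ → ℝ} (hω : ∀ i, 0 ≤ ω i) (i : ℕ) : genTime ω i ≤ delTime ω i :=
  le_add_of_nonneg_right (hω i)

lemma bddAbove_stampBefore (hs : ∀ q i, 0 ≤ s q i) (t : ℝ) :
    BddAbove (Set.range fun x : Fin 2 × ℕ =>
      if delTime (s x.1) x.2 < t then genTime (s x.1) x.2 else 0) := by
  refine ⟨max t 0, ?_⟩
  rintro _ ⟨x, rfl⟩
  simp only
  split_ifs with h
  · exact ((genTime_le_delTime (hs x.1) x.2).trans h.le).trans (le_max_left _ _)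
  · exact le_max_right _ _

lemma stampBefore_nonneg (hs : ∀ q i, 0 ≤ s q i) (t : ℝ) : 0 ≤ stampBefore s t := by
  refine le_trans ?_ (le_ciSup (bddAbove_stampBefore hs t) ((0 : Fin 2), 0))
  simp only
  split_ifs
  · exact genTime_nonneg (hs 0) 0
  · exact le_rfl

lemma stampBefore_le_iff (hs : ∀ q i, 0 ≤ s q i) {t y : ℝ} (hy : 0 ≤ y) :
    stampBefore s t ≤ y ↔ ∀ q i, delTime (s q) i < t → genTime (s q) i ≤ y := by
  constructor
  · intro h q i hd
    refine le_trans ?_ h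
    have := le_ciSup (bddAbove_stampBefore hs t) (q, i)
    simp only [hd, if_true] at this
    exact this
  · intro h
    refine ciSup_le fun x => ?_
    split_ifs with hd
    · exact h _ _ hd
    · exact hy

/-- The age just before `t` is at least `x` if and only if every update delivered before `t` was
generated at least `x` time units ago. -/
lemma le_ctsAgeBefore_iff (hs : ∀ q i, 0 ≤ s q i) (t x : ℝ) :
    x ≤ ctsAgeBefore s t ↔
      x ≤ t ∧ ∀ q i, delTime (s q) i < t → genTime (s q) i + x ≤ t := by
  rw [ctsAgeBefore]
  by_cases hx : x ≤ t
  · rw [le_sub_comm, stampBefore_le_iff hs (by linarith)]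
    simp only [hx, true_and, le_sub_iff_add_le]
  · have := stampBefore_nonneg hs t
    constructor
    · intro h; exact absurd (by linarith) hx
    · intro h; exact absurd h.1 hx

lemma ctsAge_eq_ctsAgeBefore {t : ℝ} (h : ∀ q i, delTime (s q) i ≠ t) :
    ctsAge s t = ctsAgeBefore s t := by
  simp only [ctsAge, ctsAgeBefore, stamp, stampBefore]
  congr 2
  ext x
  simp only [(h x.1 x.2).le_iff_lt]

lemma ctsAge_le (hs : ∀ q i, 0 ≤ s q i) (t : ℝ) : ctsAge s t ≤ t := by
  have h : 0 ≤ stamp s t := Real.iSup_nonneg fun x => by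
    split_ifs
    · exact genTime_nonneg (hs x.1) x.2
    · exact le_rfl
  rw [ctsAge]; linarith

end Stamp

lemma genTime_const_real (T : ℝ) (i : ℕ) : genTime (fun _ => T) i = i * T := by
  simp [genTime]

lemma delTime_const_real (T : ℝ) (i : ℕ) : delTime (fun _ => T) i = (i + 1) * T := by
  rw [delTime_eq, genTime_const_real]; push_cast; ring

section Services

variable {ω : ℕ → ℝ} {T : ℝ} {k : ℕ}

lemma services_nonneg (hω : ∀ i, 0 < ω i) (hT : 0 < T) (q : Fin 2) (i : ℕ) :
    0 ≤ services ω T q i := by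
  fin_cases q
  · exact (hω i).le
  · exact hT.le

/-- When `(k + 1) * T < t ≤ (k + 2) * T`, the freshest update of sensor B delivered before `t` was
generated at time `k * T`, so that sensor B alone keeps the age just before `t` at most
`t - k * T`. -/
lemma le_ctsAgeBefore_services_iff (hω : ∀ i, 0 < ω i) (hT : 0 < T) {t : ℝ}
    (ht : (k + 1) * T < t) (ht' : t ≤ (k + 2) * T) (x : ℝ) :
    x ≤ ctsAgeBefore (services ω T) t ↔
      x ≤ t - k * T ∧ ∀ i, delTime ω i < t → genTime ω i + x ≤ t := by
  rw [le_ctsAgeBefore_iff (services_nonneg hω hT), Fin.forall_fin_two]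
  simp only [services_zero, services_one, genTime_const_real, delTime_const_real]
  constructor
  · rintro ⟨-, h, hB⟩
    have := hB k ht
    exact ⟨by linarith, h⟩
  · rintro ⟨hx, h⟩
    have hk : 0 ≤ (k : ℝ) * T := by positivity
    refine ⟨by linarith, h, fun i hi => ?_⟩
    have h1 : ((i : ℝ) + 1) < k + 2 := lt_of_mul_lt_mul_right (hi.trans_le ht') hT.le
    have h2 : i < k + 1 := by exact_mod_cast (by linarith : (i : ℝ) < k + 1)
    have h3 : (i : ℝ) ≤ k := by exact_mod_cast Nat.lt_succ_iff.1 h2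
    have := mul_le_mul_of_nonneg_right h3 hT.le
    linarith

/-- The age just before the delivery of update `i + 1` of sensor A. -/
lemma ctsAgeBefore_delTime_succ (hω : ∀ i, 0 < ω i) (hT : 0 < T) {i : ℕ}
    (ht : (k + 1) * T < delTime ω (i + 1)) (ht' : delTime ω (i + 1) ≤ (k + 2) * T) :
    ctsAgeBefore (services ω T) (delTime ω (i + 1)) =
      min (ω i + ω (i + 1)) (delTime ω (i + 1) - k * T) := by
  refine eq_of_forall_le_iff fun x => ?_
  rw [le_ctsAgeBefore_services_iff hω hT ht ht', le_min_iff, and_comm]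
  refine and_congr_left fun _ => ?_
  have hmono := strictMono_genTime hω
  have hD : delTime ω (i + 1) = genTime ω i + ω i + ω (i + 1) := by
    rw [delTime_eq, genTime_succ, genTime_succ]
  constructor
  · intro h
    have := h i (by rw [delTime_eq, delTime_eq]; exact hmono (Nat.lt_succ_self _))
    linarith
  · intro h j hj
    rw [delTime_eq, delTime_eq, hmono.lt_iff_lt] at hj
    have := hmono.monotone (show j ≤ i by omega)
    linarith

lemma ctsFresh_iff (s : Fin 2 → ℕ → ℝ) (q : Fin 2) (i : ℕ) :
    CtsFresh s q i ↔ s q i < ctsAgeBefore s (delTime (s q) i) := by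
  rw [CtsFresh, delTime, add_sub_cancel_left]

lemma not_ctsFresh_zero (hω : ∀ i, 0 < ω i) (hT : 0 < T) : ¬ CtsFresh (services ω T) 0 0 := by
  rw [ctsFresh_iff, ctsAgeBefore, not_lt]
  have := stampBefore_nonneg (services_nonneg hω hT) (delTime (services ω T 0) 0)
  have h2 : delTime (services ω T 0) 0 = services ω T 0 0 := by simp [delTime, genTime]
  rw [h2] at this ⊢
  linarith

/-- An update of sensor A delivered in the window `((k + 1) * T, (k + 2) * T]` is fresh if and only
if it was generated later than the freshest delivered update of sensor B. -/
lemma ctsFresh_zero_succ_iff (hω : ∀ i, 0 < ω i) (hT : 0 < T) {i : ℕ}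
    (ht : (k + 1) * T < delTime ω (i + 1)) (ht' : delTime ω (i + 1) ≤ (k + 2) * T) :
    CtsFresh (services ω T) 0 (i + 1) ↔ k * T < genTime ω (i + 1) := by
  rw [ctsFresh_iff]
  simp only [services_zero]
  rw [ctsAgeBefore_delTime_succ hω hT ht ht', lt_min_iff, delTime]
  constructor
  · rintro ⟨-, h⟩; linarith
  · intro h; exact ⟨by have := hω i; linarith, by linarith⟩

lemma ctsFresh_one_iff (ω : ℕ → ℝ) (T : ℝ) (i : ℕ) :
    CtsFresh (services ω T) 1 i ↔ T < ctsAgeBefore (services ω T) ((i + 1) * T) := by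
  rw [ctsFresh_iff]
  simp only [services_one, delTime_const_real]

/-- Some update delivered before `t` is younger than `x` if and only if the last delivered one
is; this makes the union of events over `i` disjoint. -/
lemma exists_younger_iff (hω : ∀ i, 0 < ω i) {t : ℝ} (hex : ∃ n, t ≤ genTime ω n) (x : ℝ) :
    (¬ ∀ i, delTime ω i < t → genTime ω i + x ≤ t) ↔
      ∃ i, genTime ω i + ω i < t ∧ t ≤ genTime ω i + ω i + ω (i + 1) ∧ t < genTime ω i + x := by
  push Not
  have hmono := (strictMono_genTime hω).monotone
  constructor
  · rintro ⟨i, hi, hx⟩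
    rw [delTime_eq] at hi
    obtain ⟨j, hij, hj, hj'⟩ := exists_last_lt hi hex hmono
    obtain ⟨j, rfl⟩ : ∃ l, j = l + 1 := ⟨j - 1, by omega⟩
    have := hmono (show i ≤ j by omega)
    rw [genTime_succ (i := j + 1)] at hj'
    rw [genTime_succ] at hj hj'
    exact ⟨j, hj, hj', by linarith⟩
  · rintro ⟨i, h1, -, h3⟩
    exact ⟨i, h1, h3⟩

end Services

/-! ### Measurability of the continuous age -/

lemma measurable_stampBefore (T : ℝ) :
    Measurable fun q : (ℕ → ℝ) × ℝ => stampBefore (services q.1 T) q.2 := by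
  refine Measurable.iSup fun x => Measurable.ite ?_ ?_ measurable_const
  · exact measurableSet_lt ((measurable_delTime_services T x.1 x.2).comp measurable_fst)
      measurable_snd
  · exact (measurable_genTime_services T x.1 x.2).comp measurable_fst

lemma measurable_stamp (T : ℝ) :
    Measurable fun q : (ℕ → ℝ) × ℝ => stamp (services q.1 T) q.2 := by
  refine Measurable.iSup fun x => Measurable.ite ?_ ?_ measurable_const
  · exact measurableSet_le ((measurable_delTime_services T x.1 x.2).comp measurable_fst)
      measurable_snd
  · exact (measurable_genTime_services T x.1 x.2).comp measurable_fst

lemma measurable_ctsAge (T : ℝ) :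
    Measurable fun q : (ℕ → ℝ) × ℝ => ctsAge (services q.1 T) q.2 :=
  measurable_snd.sub (measurable_stamp T)

lemma measurable_ctsAgeBefore (T : ℝ) :
    Measurable fun q : (ℕ → ℝ) × ℝ => ctsAgeBefore (services q.1 T) q.2 :=
  measurable_snd.sub (measurable_stampBefore T)

lemma measurable_ctsAgeBefore_at (T t : ℝ) :
    Measurable fun ω : ℕ → ℝ => ctsAgeBefore (services ω T) t :=
  (measurable_ctsAgeBefore T).comp (measurable_id.prodMk measurable_const)

lemma measurable_ctsAgeBefore_delTime (T : ℝ) (q : Fin 2) (i : ℕ) :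
    Measurable fun ω : ℕ → ℝ => ctsAgeBefore (services ω T) (delTime (services ω T q) i) :=
  (measurable_ctsAgeBefore T).comp (measurable_id.prodMk (measurable_delTime_services T q i))

lemma measurableSet_ctsFresh (T : ℝ) (q : Fin 2) (i : ℕ) :
    MeasurableSet {ω : ℕ → ℝ | CtsFresh (services ω T) q i} := by
  unfold CtsFresh
  exact measurableSet_lt (by fun_prop) (measurable_ctsAgeBefore_delTime T q i)

/-! ### The expected age of the M-D system -/

section Expectation

variable {r : ℝ}

lemma isProbabilityMeasure_expPathLaw (hr : 0 < r) : IsProbabilityMeasure (expPathLaw r) := by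
  have := isProbabilityMeasure_expMeasure hr
  unfold expPathLaw; infer_instance

lemma ae_expPathLaw_pos (hr : 0 < r) : ∀ᵐ ω ∂(expPathLaw r), ∀ i, 0 < ω i := by
  have := isProbabilityMeasure_expMeasure hr
  exact ae_forall_infinitePi (expMeasure r) (ae_expMeasure_pos r)

lemma tsum_measure_genTime (ν : Measure ℝ) {S : Set ℝ} (hS : MeasurableSet S) :
    ∑' i, (Measure.infinitePi fun _ : ℕ => ν) {ω | genTime ω i ∈ S} = renewal ν S := by
  rw [renewal, Measure.sum_apply _ hS]
  refine tsum_congr fun i => ?_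
  rw [Measure.map_apply (measurable_genTime i) hS]
  rfl

/-- The Poisson process has infinitely many events. -/
lemma ae_exists_le_genTime (hr : 0 < r) (t : ℝ) :
    ∀ᵐ ω ∂(expPathLaw r), ∃ n, t ≤ genTime ω n := by
  have := isProbabilityMeasure_expMeasure hr
  rw [ae_iff]
  by_contra hne
  have h1 := tsum_measure_genTime (expMeasure r) (measurableSet_Iio (a := t))
  have h2 : renewal (expMeasure r) (Set.Iio t) ≠ ⊤ := by
    rw [← lintegral_indicator_one measurableSet_Iio,
      lintegral_renewal_exp hr (measurable_one.indicator measurableSet_Iio),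
      lintegral_const_mul _ (measurable_one.indicator measurableSet_Iio),
      lintegral_indicator_one measurableSet_Iio, Measure.restrict_apply measurableSet_Iio]
    refine ENNReal.add_ne_top.2 ⟨?_, ENNReal.mul_ne_top ENNReal.ofReal_ne_top ?_⟩
    · by_cases h : (0 : ℝ) < t <;> simp [h]
    · rw [Set.Iio_inter_Ioi, Real.volume_Ioo]; exact ENNReal.ofReal_ne_top
  rw [← h1] at h2
  refine h2 (top_le_iff.1 ?_)
  rw [← ENNReal.tsum_const_eq_top_of_ne_zero (α := ℕ) hne]
  refine ENNReal.tsum_le_tsum fun i => measure_mono fun ω hω => ?_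
  exact not_le.1 fun h => hω ⟨i, h⟩

/-- At a fixed positive time, almost surely nothing is generated by sensor A. -/
lemma ae_genTime_ne (hr : 0 < r) {t : ℝ} (ht : 0 < t) :
    ∀ᵐ ω ∂(expPathLaw r), ∀ i, genTime ω i ≠ t := by
  have := isProbabilityMeasure_expMeasure hr
  have h1 := tsum_measure_genTime (expMeasure r) (measurableSet_singleton t)
  have h2 : renewal (expMeasure r) {t} = 0 := by
    rw [← lintegral_indicator_one (measurableSet_singleton t),
      lintegral_renewal_exp hr (measurable_one.indicator (measurableSet_singleton t)),
      lintegral_const_mul _ (measurable_one.indicator (measurableSet_singleton t)),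
      lintegral_indicator_one (measurableSet_singleton t),
      Set.indicator_of_notMem (by simpa using ht.ne)]
    simp
  rw [h2, ENNReal.tsum_eq_zero] at h1
  rw [ae_all_iff]
  intro i
  rw [ae_iff]
  simpa [expPathLaw] using h1 i

/-- The probability that sensor A has delivered before `t` an update younger than `x`. -/
lemma measure_exists_younger (hr : 0 < r) {t x : ℝ} (hx : 0 ≤ x) (hxt : x ≤ t) :
    expPathLaw r {ω | ¬ ∀ i, delTime ω i < t → genTime ω i + x ≤ t} =
      ENNReal.ofReal (1 - erlangTail r x) := by
  classical
  have := isProbabilityMeasure_expMeasure hr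
  have h0 : expPathLaw r {ω | ¬ ∀ i, delTime ω i < t → genTime ω i + x ≤ t} =
      expPathLaw r {ω | ∃ i, genTime ω i + ω i < t ∧ t ≤ genTime ω i + ω i + ω (i + 1) ∧
        t < genTime ω i + x} := by
    refine measure_congr ?_
    filter_upwards [ae_expPathLaw_pos hr, ae_exists_le_genTime hr t] with ω hω hex
    exact propext (exists_younger_iff hω hex x)
  have hS : MeasurableSet {q : ℝ × ℝ × ℝ | q.1 + q.2.1 < t ∧ t ≤ q.1 + q.2.1 + q.2.2 ∧
      t < q.1 + x} := by
    refine measurableSet_setOfPred.2 (Measurable.and ?_ (Measurable.and ?_ ?_))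
    · exact measurableSet_setOfPred.1 (measurableSet_lt (by fun_prop) (by fun_prop))
    · exact measurableSet_setOfPred.1 (measurableSet_le (by fun_prop) (by fun_prop))
    · exact measurableSet_setOfPred.1 (measurableSet_lt (by fun_prop) (by fun_prop))
  have hm : ∀ i : ℕ, Measurable fun ω : ℕ → ℝ => (genTime ω i, ω i, ω (i + 1)) := fun i => by
    fun_prop
  rw [h0, measure_exists_eq_tsum]
  rotate_left
  · exact fun i => (hm i) hS
  · filter_upwards [ae_expPathLaw_pos hr] with ω hω i j hi hj
    have := eq_of_crossing (strictMono_genTime hω).monotone (t := t) (i := i + 1) (j := j + 1)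
      (by rw [genTime_succ]; exact hi.1) (by rw [genTime_succ, genTime_succ]; exact hi.2.1)
      (by rw [genTime_succ]; exact hj.1) (by rw [genTime_succ, genTime_succ]; exact hj.2.1)
    omega
  · have h1 := tsum_lintegral_genTime_pair (expMeasure r)
      (f := fun q => if q.1 + q.2.1 < t ∧ t ≤ q.1 + q.2.1 + q.2.2 ∧ t < q.1 + x then 1 else 0)
      (Measurable.ite hS measurable_const measurable_const)
    have h2 : ∀ i, ∫⁻ ω, (if genTime ω i + ω i < t ∧ t ≤ genTime ω i + ω i + ω (i + 1) ∧
        t < genTime ω i + x then 1 else 0) ∂(expPathLaw r) = expPathLaw r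
        {ω | genTime ω i + ω i < t ∧ t ≤ genTime ω i + ω i + ω (i + 1) ∧ t < genTime ω i + x} :=
      fun i => lintegral_ite_one _ ((hm i) hS)
    simp only [expPathLaw] at h2 ⊢
    simp_rw [← h2]
    rw [h1]
    -- only updates generated in `(t - x, t)` contribute
    have h3 : ∀ᵐ g ∂(renewal (expMeasure r)), ∫⁻ s, ∫⁻ s', (if g + s < t ∧ t ≤ g + s + s' ∧
        t < g + x then 1 else 0) ∂(expMeasure r) ∂(expMeasure r) =
        (Set.Ioo (t - x) t).indicator (fun g => ENNReal.ofReal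
          (r * (t - g) * Real.exp (-(r * (t - g))))) g := by
      refine Eventually.of_forall fun g => ?_
      by_cases hg : t - x < g ∧ g < t
      · rw [Set.indicator_of_mem (by exact hg), ← lintegral_exp_straddle hr (by linarith [hg.2])]
        refine lintegral_congr fun s => ?_
        rw [lintegral_ite_one]
        · congr 1; ext s'
          simp only [Set.mem_ofPred_eq]
          constructor
          · rintro ⟨h1, h2, -⟩; exact ⟨by linarith, by linarith⟩
          · rintro ⟨h1, h2⟩; exact ⟨by linarith, by linarith, by linarith [hg.1]⟩
        · refine measurableSet_setOfPred.2
            (measurable_const.and (Measurable.and ?_ measurable_const))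
          exact measurableSet_setOfPred.1 (measurableSet_le (by fun_prop) (by fun_prop))
      · rw [Set.indicator_of_notMem (by exact hg)]
        have : ∀ᵐ s ∂(expMeasure r), ∫⁻ s', (if g + s < t ∧ t ≤ g + s + s' ∧
            t < g + x then (1 : ℝ≥0∞) else 0) ∂(expMeasure r) = 0 := by
          filter_upwards [ae_expMeasure_pos r] with s hs
          rw [lintegral_congr (g := fun _ => 0), lintegral_zero]
          intro s'
          rw [if_neg]
          rintro ⟨h1, -, h3⟩
          exact hg ⟨by linarith, by linarith⟩
        rw [lintegral_congr_ae this, lintegral_zero]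
    rw [lintegral_congr_ae h3, lintegral_renewal_exp_shift hr (Measurable.indicator (by fun_prop)
      measurableSet_Ioo) (fun g hg => Set.indicator_of_notMem (fun h => by
        have := h.1; linarith) _) 0]
    have h4 := lintegral_Ioc_eq_sub (F := fun g => erlangTail r (t - g))
      (f := fun g => r * (r * (t - g) * Real.exp (-(r * (t - g))))) (a := t - x) (b := t)
      (by linarith) (fun g => by
        have := (hasDerivAt_erlangTail r (t - g)).scomp g ((hasDerivAt_id g).const_sub t)
        refine (this.neg.congr_of_eventuallyEq ?_).congr_deriv ?_
        · exact Eventually.of_forall fun g => by simp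
        · simp; ring)
      (by fun_prop) (fun g hg hg' => by
        have : 0 ≤ t - g := by linarith
        positivity)
    rw [sub_self, sub_sub_cancel, show erlangTail r 0 = 1 by simp [erlangTail]] at h4
    simp only [sub_zero]
    rw [← h4, lintegral_indicator measurableSet_Ioo, setLIntegral_congr Ioo_ae_eq_Ioc,
      ← lintegral_const_mul _ (by fun_prop)]
    exact lintegral_congr fun g => (ENNReal.ofReal_mul hr.le).symm

variable {T : ℝ} {k : ℕ}

lemma measurableSet_all_older (t x : ℝ) :
    MeasurableSet {ω : ℕ → ℝ | ∀ i, delTime ω i < t → genTime ω i + x ≤ t} :=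
  measurableSet_setOfPred.2 (Measurable.forall fun i => Measurable.imp
    (measurableSet_setOfPred.1 (measurableSet_lt (by fun_prop) measurable_const))
    (measurableSet_setOfPred.1 (measurableSet_le (by fun_prop) measurable_const)))

/-- The law of the age just before `t`. -/
lemma measure_le_ctsAgeBefore (hr : 0 < r) (hT : 0 < T) {t x : ℝ} (ht : (k + 1) * T < t)
    (ht' : t ≤ (k + 2) * T) (hx : 0 ≤ x) :
    expPathLaw r {ω | x ≤ ctsAgeBefore (services ω T) t} =
      if x ≤ t - k * T then ENNReal.ofReal (erlangTail r x) else 0 := by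
  have := isProbabilityMeasure_expPathLaw hr
  have h0 : expPathLaw r {ω | x ≤ ctsAgeBefore (services ω T) t} = expPathLaw r
      {ω | x ≤ t - k * T ∧ ∀ i, delTime ω i < t → genTime ω i + x ≤ t} := by
    refine measure_congr ?_
    filter_upwards [ae_expPathLaw_pos hr] with ω hω
    exact propext (le_ctsAgeBefore_services_iff hω hT ht ht' x)
  rw [h0]
  split_ifs with h
  · have hk : 0 ≤ (k : ℝ) * T := by positivity
    have h1 : {ω : ℕ → ℝ | x ≤ t - k * T ∧ ∀ i, delTime ω i < t → genTime ω i + x ≤ t} =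
        {ω | ¬ ∀ i, delTime ω i < t → genTime ω i + x ≤ t}ᶜ := by
      ext ω
      simp only [Set.mem_compl_iff, Set.mem_ofPred_eq, not_not, h, true_and]
    rw [h1, prob_compl_eq_one_sub
      (s := {ω : ℕ → ℝ | ¬ ∀ i, delTime ω i < t → genTime ω i + x ≤ t})
      (measurableSet_all_older t x).compl,
      measure_exists_younger hr hx (by linarith), ← ENNReal.ofReal_one,
      ← ENNReal.ofReal_sub _ (by linarith [erlangTail_le_one r x])]
    congr 1; ring
  · simp [h]

/-- The mean of the age just before `t`. -/
lemma lintegral_ctsAgeBefore (hr : 0 < r) (hT : 0 < T) {t : ℝ} (ht : (k + 1) * T < t)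
    (ht' : t ≤ (k + 2) * T) :
    ∫⁻ ω, ENNReal.ofReal (ctsAgeBefore (services ω T) t) ∂(expPathLaw r) =
      ENNReal.ofReal (mdMeanAge r (t - k * T)) := by
  have hw : 0 ≤ t - k * T := by nlinarith
  rw [lintegral_eq_lintegral_meas_le]
  · have h := lintegral_Ioc_eq_sub hw (hasDerivAt_mdMeanAge hr.ne') continuous_erlangTail
      (fun x hx _ => erlangTail_nonneg hr hx.le)
    rw [show mdMeanAge r (t - k * T) = mdMeanAge r (t - k * T) - mdMeanAge r 0 by
      simp [mdMeanAge], ← h, ← lintegral_indicator measurableSet_Ioi,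
      ← lintegral_indicator measurableSet_Ioc]
    refine lintegral_congr fun x => ?_
    by_cases hx : 0 < x
    · rw [Set.indicator_of_mem (Set.mem_Ioi.2 hx), measure_le_ctsAgeBefore hr hT ht ht' hx.le]
      simp [Set.indicator_apply, hx]
    · rw [Set.indicator_of_notMem (by simpa using hx), Set.indicator_of_notMem (fun h => hx h.1)]
  · filter_upwards [ae_expPathLaw_pos hr] with ω hω
    have hk : 0 ≤ (k : ℝ) * T := by positivity
    exact (le_ctsAgeBefore_services_iff hω hT ht ht' 0).2 ⟨hw, fun i hi => by
      rw [add_zero]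
      exact (genTime_le_delTime (fun j => (hω j).le) i).trans hi.le⟩
  · exact (measurable_ctsAgeBefore_at T t).aemeasurable

/-- The age at a time that is no multiple of the period of sensor B. -/
lemma lintegral_ctsAge (hr : 0 < r) (hT : 0 < T) {t : ℝ} (ht : (k + 1) * T < t)
    (ht' : t < (k + 2) * T) :
    ∫⁻ ω, ENNReal.ofReal (ctsAge (services ω T) t) ∂(expPathLaw r) =
      ENNReal.ofReal (mdMeanAge r (t - k * T)) := by
  rw [← lintegral_ctsAgeBefore hr hT ht ht'.le]
  have hk : 0 ≤ (k : ℝ) * T := by positivity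
  refine lintegral_congr_ae ?_
  filter_upwards [ae_genTime_ne hr (show 0 < t by nlinarith)] with ω hω
  rw [ctsAge_eq_ctsAgeBefore]
  rw [Fin.forall_fin_two]
  refine ⟨fun i => by rw [services_zero, delTime_eq]; exact hω _, fun i => ?_⟩
  rw [services_one, delTime_const_real]
  intro h
  rw [← h] at ht ht'
  have h1 := lt_of_mul_lt_mul_right ht hT.le
  have h2 := lt_of_mul_lt_mul_right ht' hT.le
  have h3 : k < i := by exact_mod_cast (by linarith : (k : ℝ) < i)
  have h4 : i < k + 1 := by exact_mod_cast (by linarith : (i : ℝ) < k + 1)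
  omega

end Expectation

/-! ### The average age of the M-D system -/

section MD

variable {r T : ℝ}

/-- Integrals over one period of sensor B. -/
lemma lintegral_period {f : ℝ → ℝ} (hT : 0 < T) (hf : Continuous f)
    (h0 : ∀ y, T < y → y ≤ 2 * T → 0 ≤ f y) (k : ℕ) :
    ∫⁻ t in Set.Ioc ((k + 1) * T) ((k + 2) * T), ENNReal.ofReal (f (t - k * T)) =
      ENNReal.ofReal (T * ∫ u in (0 : ℝ)..1, f (T * (1 + u))) := by
  have hc : Continuous fun t => f (t - k * T) := by fun_prop
  rw [← ofReal_integral_eq_lintegral_ofReal (hc.intervalIntegrable _ _).1,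
    ← intervalIntegral.integral_of_le (by nlinarith)]
  · congr 1
    rw [intervalIntegral.integral_comp_sub_right f]
    have h : ∀ u, f (T * (1 + u)) = f (T * u + T) := fun u => by congr 1; ring
    simp_rw [h]
    have h1 := intervalIntegral.smul_integral_comp_mul_add f T T (a := 0) (b := 1)
    rw [smul_eq_mul] at h1
    rw [h1]
    congr 1 <;> ring
  · filter_upwards [ae_restrict_mem measurableSet_Ioc] with t ht
    exact h0 _ (by linarith [ht.1]) (by linarith [ht.2])

lemma monotoneOn_mdMeanAge (hr : 0 < r) : MonotoneOn (mdMeanAge r) (Set.Ici 0) :=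
  monotoneOn_of_deriv_nonneg (convex_Ici 0) continuous_mdMeanAge.continuousOn
    (fun x _ => (hasDerivAt_mdMeanAge hr.ne' x).differentiableAt.differentiableWithinAt)
    (fun x hx => by
      rw [interior_Ici] at hx
      rw [(hasDerivAt_mdMeanAge hr.ne' x).deriv]
      exact erlangTail_nonneg hr (le_of_lt hx))

lemma mdMeanAge_nonneg (hr : 0 < r) {w : ℝ} (hw : 0 ≤ w) : 0 ≤ mdMeanAge r w := by
  have := monotoneOn_mdMeanAge hr (Set.mem_Ici.2 le_rfl) (Set.mem_Ici.2 hw) hw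
  simpa [mdMeanAge] using this

/-- The average age of the M-D system. -/
lemma tendsto_mdMeanAoI (hr : 0 < r) (hT : 0 < T) :
    Tendsto (mdMeanAoI r (1 / T)) atTop
      (𝓝 (ENNReal.ofReal (∫ u in (0 : ℝ)..1, mdMeanAge r (T * (1 + u))))) := by
  have := isProbabilityMeasure_expPathLaw hr
  set c := T * ∫ u in (0 : ℝ)..1, mdMeanAge r (T * (1 + u)) with hc
  have hm : Measurable fun q : (ℕ → ℝ) × ℝ => ENNReal.ofReal (ctsAge (services q.1 T) q.2) :=
    (measurable_ctsAge T).ennreal_ofReal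
  have hc0 : 0 ≤ c := mul_nonneg hT.le (intervalIntegral.integral_nonneg zero_le_one fun u hu =>
    mdMeanAge_nonneg hr (mul_nonneg hT.le (by linarith [hu.1])))
  have h := tendsto_div_of_periodic_increments (b := 0) (T := T) (c := c)
    (M := fun τ => ∫⁻ t in Set.Ioc 0 τ, ∫⁻ ω, ENNReal.ofReal (ctsAge (services ω T) t)
      ∂(expPathLaw r)) (fun a b hab => lintegral_mono_set (Set.Ioc_subset_Ioc_right hab))
    hT hc0 1 (by
      refine ne_top_of_le_ne_top (b := ∫⁻ t in Set.Ioc 0 T, ENNReal.ofReal T)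
        (by simp [ENNReal.mul_eq_top]) ?_
      rw [Nat.cast_one, one_mul, zero_add]
      refine setLIntegral_mono measurable_const fun t ht => ?_
      calc _ ≤ ∫⁻ _ω, ENNReal.ofReal T ∂(expPathLaw r) := by
            refine lintegral_mono_ae ?_
            filter_upwards [ae_expPathLaw_pos hr] with ω hω
            exact ENNReal.ofReal_le_ofReal ((ctsAge_le (services_nonneg hω hT) t).trans ht.2)
        _ = ENNReal.ofReal T := by simp)
    (fun k hk => by
      obtain ⟨j, rfl⟩ : ∃ j, k = j + 1 := ⟨k - 1, by omega⟩
      have hj : 0 ≤ (j : ℝ) * T := by positivity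
      push_cast
      rw [zero_add, zero_add, show ((j : ℝ) + 1 + 1) * T = (j + 2) * T by ring,
        ← Set.Ioc_union_Ioc_eq_Ioc (show 0 ≤ ((j : ℝ) + 1) * T by positivity)
          (show ((j : ℝ) + 1) * T ≤ (j + 2) * T by nlinarith),
        lintegral_union measurableSet_Ioc (by
          rw [Set.disjoint_left]; intro t h1 h2; exact absurd h1.2 (not_le.2 h2.1)),
        hc, ← lintegral_period hT continuous_mdMeanAge
          (fun y hy _ => mdMeanAge_nonneg hr (by linarith)) j]
      congr 1
      rw [setLIntegral_congr Ioo_ae_eq_Ioc.symm, setLIntegral_congr Ioo_ae_eq_Ioc.symm]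
      exact setLIntegral_congr_fun measurableSet_Ioo fun t ht => lintegral_ctsAge hr hT ht.1 ht.2)
  rw [hc, mul_div_cancel_left₀ _ hT.ne'] at h
  refine h.congr fun τ => ?_
  simp only [mdMeanAoI, mdServices, one_div_one_div]
  simp only [div_eq_mul_inv]
  rw [lintegral_mul_const _ (Measurable.lintegral_prod_right' hm),
    lintegral_lintegral_swap (f := fun (ω : ℕ → ℝ) (t : ℝ) =>
      ENNReal.ofReal (ctsAge (services ω T) t)) hm.aemeasurable]

/-! ### Peaks of the M-D system -/

open Classical in
/-- The expected sum over the valid updates delivered up to time `τ` of a function `φ` of the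
peak.  The constant `1` counts the peaks. -/
def mdPeaks (r T : ℝ) (φ : ℝ → ℝ≥0∞) (τ : ℝ) : ℝ≥0∞ :=
  ∫⁻ ω, ∑' x : Fin 2 × ℕ,
    (if delTime (services ω T x.1) x.2 ≤ τ ∧ CtsFresh (services ω T) x.1 x.2
      then φ (ctsAgeBefore (services ω T) (delTime (services ω T x.1) x.2))
      else 0) ∂(expPathLaw r)

open Classical in
/-- The contribution of update `i` of queue `q` to the peaks in the time window `(a, b]`. -/
def peakTerm (T : ℝ) (φ : ℝ → ℝ≥0∞) (a b : ℝ) (q : Fin 2) (i : ℕ) (ω : ℕ → ℝ) : ℝ≥0∞ :=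
  if (a < delTime (services ω T q) i ∧ delTime (services ω T q) i ≤ b) ∧
      CtsFresh (services ω T) q i
    then φ (ctsAgeBefore (services ω T) (delTime (services ω T q) i)) else 0

lemma peakTerm_of_fresh {φ : ℝ → ℝ≥0∞} {a b : ℝ} {q : Fin 2} {i : ℕ} {ω : ℕ → ℝ}
    (hw : a < delTime (services ω T q) i ∧ delTime (services ω T q) i ≤ b)
    (hf : CtsFresh (services ω T) q i) :
    peakTerm T φ a b q i ω = φ (ctsAgeBefore (services ω T) (delTime (services ω T q) i)) :=
  if_pos ⟨hw, hf⟩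

lemma peakTerm_eq_zero {φ : ℝ → ℝ≥0∞} {a b : ℝ} {q : Fin 2} {i : ℕ} {ω : ℕ → ℝ}
    (h : ¬((a < delTime (services ω T q) i ∧ delTime (services ω T q) i ≤ b) ∧
      CtsFresh (services ω T) q i)) : peakTerm T φ a b q i ω = 0 :=
  if_neg h

lemma measurableSet_window (T a b : ℝ) (q : Fin 2) (i : ℕ) :
    MeasurableSet {ω : ℕ → ℝ | a < delTime (services ω T q) i ∧
      delTime (services ω T q) i ≤ b} :=
  measurableSet_setOfPred.2 (Measurable.and
    (measurableSet_setOfPred.1 (measurableSet_lt measurable_const (by fun_prop)))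
    (measurableSet_setOfPred.1 (measurableSet_le (by fun_prop) measurable_const)))

lemma measurable_peakTerm (T : ℝ) {φ : ℝ → ℝ≥0∞} (hφ : Measurable φ) (a b : ℝ) (q : Fin 2)
    (i : ℕ) : Measurable (peakTerm T φ a b q i) := by
  unfold peakTerm
  refine Measurable.ite (measurableSet_setOfPred.2 (Measurable.and
    (measurableSet_setOfPred.1 (measurableSet_window T a b q i))
    (measurableSet_setOfPred.1 (measurableSet_ctsFresh T q i))))
    (hφ.comp (measurable_ctsAgeBefore_delTime T q i)) measurable_const

lemma mdPeaks_mono (r T : ℝ) (φ : ℝ → ℝ≥0∞) : Monotone (mdPeaks r T φ) := by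
  intro a b hab
  refine lintegral_mono fun ω => ENNReal.tsum_le_tsum fun x => ?_
  split_ifs with h1 h2
  · exact le_rfl
  · exact absurd ⟨h1.1.trans hab, h1.2⟩ h2
  · exact zero_le
  · exact le_rfl

lemma mdPeaks_add {φ : ℝ → ℝ≥0∞} (hφ : Measurable φ) {a b : ℝ} (hab : a ≤ b) :
    mdPeaks r T φ b = mdPeaks r T φ a +
      (∑' i, ∫⁻ ω, peakTerm T φ a b 0 i ω ∂(expPathLaw r) +
        ∑' i, ∫⁻ ω, peakTerm T φ a b 1 i ω ∂(expPathLaw r)) := by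
  have h1 : ∑' i, ∫⁻ ω, peakTerm T φ a b 0 i ω ∂(expPathLaw r) +
      ∑' i, ∫⁻ ω, peakTerm T φ a b 1 i ω ∂(expPathLaw r) =
      ∫⁻ ω, ∑' x : Fin 2 × ℕ, peakTerm T φ a b x.1 x.2 ω ∂(expPathLaw r) := by
    have h := lintegral_tsum (μ := expPathLaw r)
      (f := fun (x : Fin 2 × ℕ) ω => peakTerm T φ a b x.1 x.2 ω)
      fun x => (measurable_peakTerm T hφ a b x.1 x.2).aemeasurable
    rw [h, ENNReal.tsum_prod' (f := fun x : Fin 2 × ℕ =>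
      ∫⁻ ω, peakTerm T φ a b x.1 x.2 ω ∂(expPathLaw r)), tsum_fintype (L := .unconditional (Fin 2)),
      Fin.sum_univ_two]
  have hm : Measurable fun ω => ∑' x : Fin 2 × ℕ, peakTerm T φ a b x.1 x.2 ω :=
    Measurable.tsum fun x => measurable_peakTerm T hφ a b x.1 x.2
  rw [h1]
  refine Eq.trans (lintegral_congr fun ω => ?_) (lintegral_add_right _ hm)
  rw [← ENNReal.tsum_add]
  refine tsum_congr fun x => ?_
  unfold peakTerm
  by_cases hf : CtsFresh (services ω T) x.1 x.2
  · by_cases h1 : delTime (services ω T x.1) x.2 ≤ a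
    · simp [hf, h1, h1.trans hab, not_lt.2 h1]
    · simp [hf, h1, not_le.1 h1]
  · simp [hf]

/-- The first period contributes finitely many peaks in expectation, each of them at most `T`. -/
lemma mdPeaks_first_ne_top (hr : 0 < r) (hT : 0 < T) {φ : ℝ → ℝ≥0∞} {C : ℝ≥0∞} (hC : C ≠ ⊤)
    (hφC : ∀ y ≤ T, φ y ≤ C) : mdPeaks r T φ T ≠ ⊤ := by
  classical
  have := isProbabilityMeasure_expPathLaw hr
  have := isProbabilityMeasure_expMeasure hr
  have hle : mdPeaks r T φ T ≤ ∫⁻ ω, ∑' x : Fin 2 × ℕ,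
      C * (if delTime (services ω T x.1) x.2 ≤ T then 1 else 0) ∂(expPathLaw r) := by
    refine lintegral_mono_ae ?_
    filter_upwards [ae_expPathLaw_pos hr] with ω hω
    refine ENNReal.tsum_le_tsum fun x => ?_
    split_ifs with h1 h2 h2
    · rw [mul_one]
      refine hφC _ (le_trans ?_ h1.1)
      have := stampBefore_nonneg (services_nonneg hω hT) (delTime (services ω T x.1) x.2)
      rw [ctsAgeBefore]; linarith
    · exact absurd h1.1 h2
    · exact zero_le
    · exact zero_le
  refine ne_top_of_le_ne_top ?_ hle
  have hm : ∀ x : Fin 2 × ℕ, MeasurableSet {ω : ℕ → ℝ | delTime (services ω T x.1) x.2 ≤ T} :=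
    fun x => measurableSet_le (by fun_prop) measurable_const
  have hterm : ∀ x : Fin 2 × ℕ,
      ∫⁻ ω, C * (if delTime (services ω T x.1) x.2 ≤ T then 1 else 0) ∂(expPathLaw r) =
        C * expPathLaw r {ω | delTime (services ω T x.1) x.2 ≤ T} := fun x => by
    rw [lintegral_const_mul C (Measurable.ite (hm x) measurable_const measurable_const),
      ← lintegral_indicator_one (hm x)]
    rfl
  rw [lintegral_tsum fun x =>
    ((Measurable.ite (hm x) measurable_const measurable_const).const_mul C).aemeasurable,
    tsum_congr hterm, ENNReal.tsum_mul_left, ENNReal.tsum_prod', tsum_fintype, Fin.sum_univ_two]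
  refine ENNReal.mul_ne_top hC (ENNReal.add_ne_top.2 ⟨?_, ?_⟩)
  · have h1 := tsum_measure_genTime (expMeasure r) (measurableSet_Iic (a := T))
    have h2 : renewal (expMeasure r) (Set.Iic T) ≠ ⊤ := by
      rw [← lintegral_indicator_one measurableSet_Iic,
        lintegral_renewal_exp hr (measurable_one.indicator measurableSet_Iic),
        lintegral_const_mul _ (measurable_one.indicator measurableSet_Iic),
        lintegral_indicator_one measurableSet_Iic, Measure.restrict_apply measurableSet_Iic]
      refine ENNReal.add_ne_top.2 ⟨?_, ENNReal.mul_ne_top ENNReal.ofReal_ne_top ?_⟩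
      · simp [hT.le]
      · rw [Set.Iic_inter_Ioi, Real.volume_Ioc]; exact ENNReal.ofReal_ne_top
    rw [← h1] at h2
    refine ne_top_of_le_ne_top h2 ?_
    rw [tsum_eq_zero_add' (f := fun i => (Measure.infinitePi fun _ : ℕ => expMeasure r)
      {ω | genTime ω i ∈ Set.Iic T}) ENNReal.summable]
    refine le_trans (le_of_eq (tsum_congr fun i => ?_)) le_add_self
    simp_rw [← delTime_eq]
    rfl
  · rw [tsum_eq_single 0]
    · exact measure_ne_top _ _
    · intro i hi
      convert measure_empty (μ := expPathLaw r)
      ext ω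
      simp only [services_one, delTime_const_real, Set.mem_ofPred_eq, Set.mem_empty_iff_false,
        iff_false, not_le]
      have : (0 : ℝ) < i := by exact_mod_cast Nat.pos_of_ne_zero hi
      nlinarith

/-- Expected sums over the updates of sensor A are integrals over the time `t` at which they are
delivered (`c (s, s') = s`) or at which the next one is (`c (s, s') = s + s'`). -/
lemma tsum_lintegral_poisson (hr : 0 < r) {f : ℝ × ℝ × ℝ → ℝ≥0∞} (hf : Measurable f)
    {c : ℝ × ℝ → ℝ} (hc : Measurable c) (h0 : ∀ x ≤ 0, ∀ s s', f (x + c (s, s'), s, s') = 0) :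
    ∑' i, ∫⁻ ω, f (genTime ω i + c (ω i, ω (i + 1)), ω i, ω (i + 1)) ∂(expPathLaw r) =
      ENNReal.ofReal r * ∫⁻ t, ∫⁻ s, ∫⁻ s', f (t, s, s') ∂(expMeasure r) ∂(expMeasure r) := by
  have := isProbabilityMeasure_expMeasure hr
  set ν := expMeasure r
  have hg : Measurable fun q : ℝ × ℝ × ℝ => f (q.1 + c q.2, q.2.1, q.2.2) := by fun_prop
  have h1 := tsum_lintegral_genTime_pair ν hg
  rw [expPathLaw, h1]
  have h2 : ∀ x, ∫⁻ s, ∫⁻ s', f (x + c (s, s'), s, s') ∂ν ∂ν =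
      ∫⁻ y, f (x + c y, y.1, y.2) ∂(ν.prod ν) := fun x => by
    rw [lintegral_prod _ (by fun_prop)]
  have h3 : ∀ t, ∫⁻ s, ∫⁻ s', f (t, s, s') ∂ν ∂ν = ∫⁻ y, f (t, y.1, y.2) ∂(ν.prod ν) := fun t => by
    rw [lintegral_prod _ (by fun_prop)]
  simp_rw [h2, h3]
  rw [lintegral_renewal_exp_shift hr (Measurable.lintegral_prod_right' hg)
    (fun x hx => by rw [← h2]; simp [h0 x hx]) 0]
  simp only [sub_zero]
  congr 1
  rw [lintegral_lintegral_swap (f := fun x y => f (x + c y, y.1, y.2)) hg.aemeasurable,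
    lintegral_lintegral_swap (f := fun x (y : ℝ × ℝ) => f (x, y.1, y.2)) (by
      exact hf.aemeasurable)]
  exact lintegral_congr fun y => lintegral_add_right_eq_self (fun t => f (t, y.1, y.2)) (c y)

/-- Deliveries of sensor A in the window `(a, b]` of updates that were generated after `u`. -/
lemma tsum_lintegral_generated_after (hr : 0 < r) {u a b : ℝ} (hu : 0 ≤ u) (hua : u ≤ a)
    {ψ : ℝ → ℝ} (hψ : Continuous ψ) :
    ∑' i, ∫⁻ ω, {q : ℝ × ℝ | (a < q.1 ∧ q.1 ≤ b) ∧ u < q.1 - q.2}.indicator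
        (fun q => ENNReal.ofReal (ψ q.1)) (genTime ω i + ω i, ω i) ∂(expPathLaw r) =
      ∫⁻ t in Set.Ioc a b, ENNReal.ofReal (ψ t * (r * (1 - Real.exp (-(r * (t - u)))))) := by
  have := isProbabilityMeasure_expMeasure hr
  set S := {q : ℝ × ℝ | (a < q.1 ∧ q.1 ≤ b) ∧ u < q.1 - q.2} with hS
  have hSm : MeasurableSet S := by
    refine measurableSet_setOfPred.2 (Measurable.and (Measurable.and ?_ ?_) ?_)
    · exact measurableSet_setOfPred.1 (measurableSet_lt (by fun_prop) (by fun_prop))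
    · exact measurableSet_setOfPred.1 (measurableSet_le (by fun_prop) (by fun_prop))
    · exact measurableSet_setOfPred.1 (measurableSet_lt (by fun_prop) (by fun_prop))
  have hm : Measurable (S.indicator fun q : ℝ × ℝ => ENNReal.ofReal (ψ q.1)) :=
    Measurable.indicator (by fun_prop) hSm
  have h := tsum_lintegral_poisson hr
    (f := fun q => S.indicator (fun q : ℝ × ℝ => ENNReal.ofReal (ψ q.1)) (q.1, q.2.1))
    (hm.comp (by fun_prop)) (c := fun y => y.1) (by fun_prop) (fun x hx s s' =>
      Set.indicator_of_notMem (fun hmem => by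
        have : u < x + s - s := hmem.2
        linarith) _)
  simp only at h
  rw [h, ← lintegral_indicator measurableSet_Ioc, ← lintegral_const_mul _ (by
    refine Measurable.lintegral_prod_right' (f := fun q : ℝ × ℝ => ∫⁻ _s' : ℝ,
      S.indicator (fun q : ℝ × ℝ => ENNReal.ofReal (ψ q.1)) (q.1, q.2) ∂(expMeasure r)) ?_
    simpa using hm)]
  refine lintegral_congr fun t => ?_
  simp only [lintegral_const, measure_univ, mul_one]
  by_cases ht : t ∈ Set.Ioc a b
  · rw [Set.indicator_of_mem ht]
    have h1 : ∀ s, S.indicator (fun q : ℝ × ℝ => ENNReal.ofReal (ψ q.1)) (t, s) =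
        ENNReal.ofReal (ψ t) * (Set.Iio (t - u)).indicator 1 s := by
      intro s
      by_cases hs : s < t - u
      · rw [Set.indicator_of_mem (show (t, s) ∈ S from ⟨ht, by simp only; linarith⟩),
          Set.indicator_of_mem (by exact hs)]; simp
      · rw [Set.indicator_of_notMem (fun hmem => hs (by
          have : u < t - s := hmem.2
          linarith)), Set.indicator_of_notMem (by exact hs), mul_zero]
    have h2 : 0 ≤ 1 - Real.exp (-(r * (t - u))) := by
      rw [sub_nonneg, Real.exp_le_one_iff]
      have : 0 ≤ r * (t - u) := mul_nonneg hr.le (by linarith [ht.1])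
      linarith
    simp_rw [h1]
    rw [lintegral_const_mul _ (measurable_one.indicator measurableSet_Iio),
      lintegral_indicator_one measurableSet_Iio, expMeasure_Iio hr (by linarith [ht.1]),
      mul_left_comm, ← ENNReal.ofReal_mul hr.le, ← ENNReal.ofReal_mul' (mul_nonneg hr.le h2)]
  · rw [Set.indicator_of_notMem ht, lintegral_congr (g := fun _ => 0), lintegral_zero, mul_zero]
    exact fun s => Set.indicator_of_notMem (fun hmem => ht hmem.1) _

/-- The amount by which `D - u` exceeds the age just before the delivery time `D`, summed over
the deliveries of sensor A in the window `(a, b]`. -/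
lemma tsum_lintegral_deficit (hr : 0 < r) {u a b : ℝ} (hu : 0 ≤ u) (hua : u ≤ a) :
    ∑' i, ∫⁻ ω, (Set.Ioc a b).indicator (fun _ => ENNReal.ofReal (genTime ω i - u))
        (genTime ω i + (ω i + ω (i + 1))) ∂(expPathLaw r) =
      ∫⁻ t in Set.Ioc a b, ENNReal.ofReal (r * ((t - u) - mdMeanAge r (t - u))) := by
  have := isProbabilityMeasure_expMeasure hr
  have hm : Measurable fun q : ℝ × ℝ × ℝ => (Set.Ioc a b).indicator
      (fun t => ENNReal.ofReal (t - u - q.2.1 - q.2.2)) q.1 := by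
    have : (fun q : ℝ × ℝ × ℝ => (Set.Ioc a b).indicator
        (fun t => ENNReal.ofReal (t - u - q.2.1 - q.2.2)) q.1) =
        (Prod.fst ⁻¹' Set.Ioc a b).indicator
          fun q : ℝ × ℝ × ℝ => ENNReal.ofReal (q.1 - u - q.2.1 - q.2.2) := by
      ext q
      by_cases hq : q.1 ∈ Set.Ioc a b
      · rw [Set.indicator_of_mem hq, Set.indicator_of_mem (by exact hq)]
      · rw [Set.indicator_of_notMem hq, Set.indicator_of_notMem (by exact hq)]
    rw [this]
    exact Measurable.indicator (by fun_prop) (measurable_fst measurableSet_Ioc)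
  have h := tsum_lintegral_poisson hr hm (c := fun y => y.1 + y.2) (by fun_prop)
    (fun x hx s s' => by
      simp only
      rw [Set.indicator_apply]
      split_ifs
      · exact ENNReal.ofReal_of_nonpos (by linarith)
      · rfl)
  simp only at h
  have h1 : ∀ (ω : ℕ → ℝ) i, (Set.Ioc a b).indicator
      (fun _ => ENNReal.ofReal (genTime ω i - u)) (genTime ω i + (ω i + ω (i + 1))) =
      (Set.Ioc a b).indicator (fun t => ENNReal.ofReal (t - u - ω i - ω (i + 1)))
        (genTime ω i + (ω i + ω (i + 1))) := by
    intro ω i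
    simp only [Set.indicator_apply]
    split_ifs
    · congr 1; ring
    · rfl
  simp_rw [h1]
  rw [h, ← lintegral_indicator measurableSet_Ioc, ← lintegral_const_mul _ (by
    refine Measurable.lintegral_prod_right' (f := fun q : ℝ × ℝ => ∫⁻ s',
      (Set.Ioc a b).indicator (fun t => ENNReal.ofReal (t - u - q.2 - s')) q.1
      ∂(expMeasure r)) ?_
    refine Measurable.lintegral_prod_right' (f := fun q : (ℝ × ℝ) × ℝ =>
      (Set.Ioc a b).indicator (fun t => ENNReal.ofReal (t - u - q.1.2 - q.2)) q.1.1) ?_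
    exact hm.comp (g := fun q : ℝ × ℝ × ℝ => (Set.Ioc a b).indicator
      (fun t => ENNReal.ofReal (t - u - q.2.1 - q.2.2)) q.1)
      (f := fun q : (ℝ × ℝ) × ℝ => (q.1.1, q.1.2, q.2)) (by fun_prop))]
  refine lintegral_congr fun t => ?_
  by_cases ht : t ∈ Set.Ioc a b
  · simp only [Set.indicator_of_mem ht]
    rw [lintegral_exp_pair_deficit hr (by linarith [ht.1]), ENNReal.ofReal_mul hr.le]
  · simp [Set.indicator_of_notMem ht]

variable {k : ℕ}

/-- The expected number of valid updates of sensor A in one period. -/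
lemma tsum_peakTerm_zero_one (hr : 0 < r) (hT : 0 < T) :
    ∑' i, ∫⁻ ω, peakTerm T (fun _ => 1) ((k + 1) * T) ((k + 2) * T) 0 i ω ∂(expPathLaw r) =
      ENNReal.ofReal (r * T * ∫ u in (0 : ℝ)..1, (1 - Real.exp (-(r * (T * (1 + u)))))) := by
  have hk : 0 ≤ (k : ℝ) * T := by positivity
  have h1 := tsum_lintegral_generated_after hr (u := k * T) (a := (k + 1) * T)
    (b := (k + 2) * T) hk (by nlinarith) (ψ := fun _ => 1) continuous_const
  have h2 := lintegral_period (T := T) (f := fun y => 1 * (r * (1 - Real.exp (-(r * y))))) hT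
    (by fun_prop) (fun y hy _ => by
      have : 0 ≤ r * y := mul_nonneg hr.le (by linarith)
      have : Real.exp (-(r * y)) ≤ 1 := Real.exp_le_one_iff.2 (by linarith)
      rw [one_mul]
      exact mul_nonneg hr.le (by linarith)) k
  rw [h2] at h1
  rw [show r * T * ∫ u in (0 : ℝ)..1, (1 - Real.exp (-(r * (T * (1 + u))))) =
    T * ∫ u in (0 : ℝ)..1, 1 * (r * (1 - Real.exp (-(r * (T * (1 + u)))))) by
      simp only [one_mul, intervalIntegral.integral_const_mul]; ring, ← h1]
  refine tsum_congr fun i => lintegral_congr_ae ?_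
  filter_upwards [ae_expPathLaw_pos hr] with ω hω
  have hD : genTime ω i + ω i = delTime ω i := rfl
  rw [peakTerm, hD]
  simp only [services_zero]
  by_cases hw : (k + 1) * T < delTime ω i ∧ delTime ω i ≤ (k + 2) * T
  · have hf : CtsFresh (services ω T) 0 i ↔ k * T < delTime ω i - ω i := by
      rcases i with _ | i
      · refine iff_of_false (not_ctsFresh_zero hω hT) ?_
        simpa [delTime, genTime] using hk
      · rw [ctsFresh_zero_succ_iff hω hT hw.1 hw.2, delTime, add_sub_cancel_right]
    simp [Set.indicator_apply, hw, hf]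
  · simp [hw]

/-- The expected sum of the age peaks at deliveries of sensor A in one period. -/
lemma tsum_peakTerm_zero_ofReal (hr : 0 < r) (hT : 0 < T) :
    ∑' i, ∫⁻ ω, peakTerm T ENNReal.ofReal ((k + 1) * T) ((k + 2) * T) 0 i ω ∂(expPathLaw r) =
      ENNReal.ofReal (r * T * ∫ u in (0 : ℝ)..1, mdMeanPeak r (T * (1 + u))) := by
  have hk : 0 ≤ (k : ℝ) * T := by positivity
  have hexp : ∀ y, 0 ≤ y → 0 ≤ 1 - Real.exp (-(r * y)) := fun y hy =>
    sub_nonneg.2 (Real.exp_le_one_iff.2 (by have := mul_nonneg hr.le hy; linarith))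
  have hdef : ∀ y, 0 ≤ y → 0 ≤ y - mdMeanAge r y := fun y hy => by
    have h : MonotoneOn (fun y => y - mdMeanAge r y) (Set.Ici 0) :=
      monotoneOn_of_deriv_nonneg (convex_Ici 0)
        (continuous_id.sub continuous_mdMeanAge).continuousOn
        (fun x _ => ((hasDerivAt_id x).sub
          (hasDerivAt_mdMeanAge hr.ne' x)).differentiableAt.differentiableWithinAt)
        (fun x _ => by
          have := ((hasDerivAt_id x).sub (hasDerivAt_mdMeanAge hr.ne' x)).deriv
          rw [show deriv (fun y => y - mdMeanAge r y) x = 1 - erlangTail r x from this]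
          linarith [erlangTail_le_one r x])
    have := h (Set.mem_Ici.2 le_rfl) (Set.mem_Ici.2 hy) hy
    simpa [mdMeanAge] using this
  have h1 := tsum_lintegral_generated_after hr (u := k * T) (a := (k + 1) * T)
    (b := (k + 2) * T) hk (by nlinarith) (ψ := fun t => t - k * T) (by fun_prop)
  have h2 := tsum_lintegral_deficit hr (u := k * T) (a := (k + 1) * T)
    (b := (k + 2) * T) hk (by nlinarith)
  have hcont := continuous_mdMeanAge (r := r)
  rw [lintegral_period (T := T) (f := fun y => y * (r * (1 - Real.exp (-(r * y))))) hT
    (by fun_prop) (fun y hy _ => mul_nonneg (by linarith)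
      (mul_nonneg hr.le (hexp y (by linarith)))) k] at h1
  rw [lintegral_period (T := T) (f := fun y => r * (y - mdMeanAge r y)) hT
    (by fun_prop) (fun y hy _ => mul_nonneg hr.le (hdef y (by linarith))) k] at h2
  -- at a fresh delivery at time `D` the peak `min (S + S') (D - k * T)` and the positive part of
  -- `D - k * T - (S + S')` add up to `D - k * T`; the positive part vanishes at stale deliveries
  have hsum : ∑' i, ∫⁻ ω, peakTerm T ENNReal.ofReal ((k + 1) * T) ((k + 2) * T) 0 (i + 1) ω
      ∂(expPathLaw r) + ∑' i, ∫⁻ ω, (Set.Ioc ((k + 1) * T) ((k + 2) * T)).indicator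
        (fun _ => ENNReal.ofReal (genTime ω i - k * T)) (genTime ω i + (ω i + ω (i + 1)))
        ∂(expPathLaw r) =
      ∑' i, ∫⁻ ω, {q : ℝ × ℝ | ((k + 1) * T < q.1 ∧ q.1 ≤ (k + 2) * T) ∧
        k * T < q.1 - q.2}.indicator (fun q => ENNReal.ofReal (q.1 - k * T))
        (genTime ω (i + 1) + ω (i + 1), ω (i + 1)) ∂(expPathLaw r) := by
    rw [← ENNReal.tsum_add]
    refine tsum_congr fun i => ?_
    rw [← lintegral_add_left (measurable_peakTerm T ENNReal.measurable_ofReal _ _ _ _)]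
    refine lintegral_congr_ae ?_
    filter_upwards [ae_expPathLaw_pos hr] with ω hω
    have hD : genTime ω (i + 1) + ω (i + 1) = delTime ω (i + 1) := rfl
    have hD' : genTime ω i + (ω i + ω (i + 1)) = delTime ω (i + 1) := by
      rw [delTime_eq, genTime_succ, genTime_succ]; ring
    rw [hD, hD']
    by_cases hw : (k + 1) * T < delTime ω (i + 1) ∧ delTime ω (i + 1) ≤ (k + 2) * T
    · have hf : CtsFresh (services ω T) 0 (i + 1) ↔ k * T < delTime ω (i + 1) - ω (i + 1) := by
        rw [ctsFresh_zero_succ_iff hω hT hw.1 hw.2, ← hD, add_sub_cancel_right]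
      rw [Set.indicator_of_mem (by exact hw)]
      by_cases hu : k * T < delTime ω (i + 1) - ω (i + 1)
      · rw [peakTerm_of_fresh (by exact hw) (hf.2 hu), services_zero,
          ctsAgeBefore_delTime_succ hω hT hw.1 hw.2,
          Set.indicator_of_mem (by exact ⟨hw, hu⟩)]
        have ha := hω i
        have hb := hω (i + 1)
        rcases le_total (ω i + ω (i + 1)) (delTime ω (i + 1) - k * T) with h | h
        · rw [min_eq_left h, ← ENNReal.ofReal_add (by linarith) (by linarith)]
          congr 1; linarith
        · rw [min_eq_right h, ENNReal.ofReal_of_nonpos (p := genTime ω i - k * T) (by linarith),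
            add_zero]
      · rw [peakTerm_eq_zero (fun h => hu (hf.1 h.2)), Set.indicator_of_notMem (fun h => hu h.2),
          zero_add]
        refine ENNReal.ofReal_of_nonpos ?_
        have := hω i
        linarith
    · rw [peakTerm_eq_zero (fun h => hw h.1), Set.indicator_of_notMem (by exact hw),
        Set.indicator_of_notMem (fun h => hw h.1), add_zero]
  -- the first update of sensor A is never fresh
  have hz1 : ∑' i, ∫⁻ ω, peakTerm T ENNReal.ofReal ((k + 1) * T) ((k + 2) * T) 0 i ω
      ∂(expPathLaw r) = ∑' i, ∫⁻ ω, peakTerm T ENNReal.ofReal ((k + 1) * T) ((k + 2) * T) 0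
        (i + 1) ω ∂(expPathLaw r) := by
    rw [tsum_eq_zero_add' ENNReal.summable]
    rw [show ∫⁻ ω, peakTerm T ENNReal.ofReal ((k + 1) * T) ((k + 2) * T) 0 0 ω ∂(expPathLaw r) = 0
      from ?_, zero_add]
    rw [lintegral_congr_ae (g := fun _ => 0), lintegral_zero]
    filter_upwards [ae_expPathLaw_pos hr] with ω hω
    exact peakTerm_eq_zero fun h => not_ctsFresh_zero hω hT h.2
  rw [tsum_eq_zero_add' ENNReal.summable] at h1
  have hz2 : ∫⁻ ω, {q : ℝ × ℝ | ((k + 1) * T < q.1 ∧ q.1 ≤ (k + 2) * T) ∧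
        k * T < q.1 - q.2}.indicator (fun q => ENNReal.ofReal (q.1 - k * T))
        (genTime ω 0 + ω 0, ω 0) ∂(expPathLaw r) = 0 := by
    rw [lintegral_congr (g := fun _ => 0), lintegral_zero]
    intro ω
    refine Set.indicator_of_notMem (fun h => ?_) _
    have := h.2
    simp only [genTime, Finset.range_zero, Finset.sum_empty, zero_add, sub_self] at this
    linarith
  rw [hz2, zero_add, ← hsum, ← hz1, h2] at h1
  have hint : ∀ f : ℝ → ℝ, Continuous f →
      IntervalIntegrable (fun u => f (T * (1 + u))) volume 0 1 := fun f hf =>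
    (hf.comp (by fun_prop : Continuous fun u : ℝ => T * (1 + u))).intervalIntegrable _ _
  rw [ENNReal.eq_sub_of_add_eq ENNReal.ofReal_ne_top h1, ← ENNReal.ofReal_sub]
  · congr 1
    rw [← mul_sub, ← intervalIntegral.integral_sub
      (hint (fun y => y * (r * (1 - Real.exp (-(r * y))))) (by fun_prop))
      (hint (fun y => r * (y - mdMeanAge r y)) (by fun_prop)),
      mul_comm r T, mul_assoc, ← intervalIntegral.integral_const_mul r]
    congr 1
    refine intervalIntegral.integral_congr fun u _ => ?_
    simp only [mdMeanPeak]; ring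
  · refine mul_nonneg hT.le (intervalIntegral.integral_nonneg zero_le_one fun u hu => ?_)
    exact mul_nonneg hr.le (hdef _ (mul_nonneg hT.le (by linarith [hu.1])))

/-- Sensor B contributes to the peaks of a period only with its delivery at the end of the
period. -/
lemma tsum_peakTerm_one (hT : 0 < T) (φ : ℝ → ℝ≥0∞) :
    ∑' i, ∫⁻ ω, peakTerm T φ ((k + 1) * T) ((k + 2) * T) 1 i ω ∂(expPathLaw r) =
      ∫⁻ ω, {ω | T < ctsAgeBefore (services ω T) ((k + 2) * T)}.indicator
        (fun ω => φ (ctsAgeBefore (services ω T) ((k + 2) * T))) ω ∂(expPathLaw r) := by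
  rw [tsum_eq_single (k + 1)]
  · refine lintegral_congr fun ω => ?_
    have h : (((k + 1 : ℕ) : ℝ) + 1) * T = (k + 2) * T := by push_cast; ring
    rw [peakTerm, ctsFresh_one_iff]
    simp only [services_one, delTime_const_real, h, Set.indicator_apply, Set.mem_ofPred_eq]
    have : (k + 1) * T < ((k : ℝ) + 2) * T := by nlinarith
    simp [this]
  · intro i hi
    rw [lintegral_congr (g := fun _ => 0), lintegral_zero]
    intro ω
    rw [peakTerm, if_neg]
    simp only [services_one, delTime_const_real]
    rintro ⟨⟨h1, h2⟩, -⟩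
    have h3 := lt_of_mul_lt_mul_right h1 hT.le
    have h4 := le_of_mul_le_mul_right h2 hT
    have h5 : k < i := by exact_mod_cast (by linarith : (k : ℝ) < i)
    have h6 : i ≤ k + 1 := by exact_mod_cast (by linarith : (i : ℝ) ≤ k + 1)
    omega

/-- The probability that a delivery of sensor B is fresh. -/
lemma measure_lt_ctsAgeBefore (hr : 0 < r) (hT : 0 < T) :
    expPathLaw r {ω | T < ctsAgeBefore (services ω T) ((k + 2) * T)} =
      ENNReal.ofReal (erlangTail r T) := by
  have hun : {ω : ℕ → ℝ | T < ctsAgeBefore (services ω T) ((k + 2) * T)} =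
      ⋃ n : ℕ, {ω | T + 1 / ((n : ℝ) + 1) ≤ ctsAgeBefore (services ω T) ((k + 2) * T)} := by
    ext ω
    simp only [Set.mem_ofPred_eq, Set.mem_iUnion]
    constructor
    · intro h
      obtain ⟨n, hn⟩ := exists_nat_one_div_lt (sub_pos.2 h)
      exact ⟨n, by linarith⟩
    · rintro ⟨n, hn⟩
      have : 0 < 1 / ((n : ℝ) + 1) := Nat.one_div_pos_of_nat
      linarith
  have hlim := tendsto_one_div_add_atTop_nhds_zero_nat (𝕜 := ℝ)
  have h1 : Tendsto (fun n : ℕ => expPathLaw r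
      {ω | T + 1 / ((n : ℝ) + 1) ≤ ctsAgeBefore (services ω T) ((k + 2) * T)}) atTop
      (𝓝 (ENNReal.ofReal (erlangTail r T))) := by
    have h2 : Tendsto (fun n : ℕ => ENNReal.ofReal (erlangTail r (T + 1 / ((n : ℝ) + 1)))) atTop
        (𝓝 (ENNReal.ofReal (erlangTail r (T + 0)))) :=
      (ENNReal.continuous_ofReal.tendsto _).comp
        ((continuous_erlangTail.tendsto _).comp (hlim.const_add T))
    rw [add_zero] at h2
    refine h2.congr' ?_
    filter_upwards [hlim.eventually_le_const hT] with n hn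
    have : 0 < 1 / ((n : ℝ) + 1) := Nat.one_div_pos_of_nat
    rw [measure_le_ctsAgeBefore hr hT (by nlinarith) le_rfl (by linarith), if_pos (by linarith)]
  rw [hun]
  refine tendsto_nhds_unique (tendsto_measure_iUnion_atTop ?_) h1
  intro m n hmn ω hω
  refine le_trans ?_ (show T + 1 / ((m : ℝ) + 1) ≤ _ from hω)
  have := Nat.one_div_le_one_div (α := ℝ) hmn
  linarith

/-- The mean of a peak at a delivery of sensor B, on the event that it is fresh. -/
lemma lintegral_peak_one (hr : 0 < r) (hT : 0 < T) :
    ∫⁻ ω, {ω | T < ctsAgeBefore (services ω T) ((k + 2) * T)}.indicator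
        (fun ω => ENNReal.ofReal (ctsAgeBefore (services ω T) ((k + 2) * T))) ω ∂(expPathLaw r) =
      ENNReal.ofReal (mdMeanAge r (2 * T) - (mdMeanAge r T - T * erlangTail r T)) := by
  set X : (ℕ → ℝ) → ℝ := fun ω => ctsAgeBefore (services ω T) ((k + 2) * T) with hX
  have hXm : Measurable X := measurable_ctsAgeBefore_at T _
  have hA : MeasurableSet {ω | T < X ω} := measurableSet_lt measurable_const hXm
  have hsplit : ∀ ω, {ω | T < X ω}.indicator (fun ω => ENNReal.ofReal (X ω)) ω =
      ENNReal.ofReal T * {ω | T < X ω}.indicator 1 ω + ENNReal.ofReal (max (X ω - T) 0) := by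
    intro ω
    by_cases h : T < X ω
    · rw [Set.indicator_of_mem (by exact h), Set.indicator_of_mem (by exact h),
        max_eq_left (by linarith), Pi.one_apply, mul_one, ← ENNReal.ofReal_add hT.le (by linarith)]
      congr 1; ring
    · rw [Set.indicator_of_notMem (by exact h), Set.indicator_of_notMem (by exact h),
        max_eq_right (by linarith [not_lt.1 h])]
      simp
  have hmax : ∫⁻ ω, ENNReal.ofReal (max (X ω - T) 0) ∂(expPathLaw r) =
      ENNReal.ofReal (mdMeanAge r (2 * T) - mdMeanAge r T) := by
    rw [lintegral_eq_lintegral_meas_le (f := fun ω => max (X ω - T) 0) _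
      (Eventually.of_forall fun ω => le_max_right _ _)
      ((hXm.sub_const T).max measurable_const).aemeasurable]
    have h := lintegral_Ioc_eq_sub (F := fun x => mdMeanAge r (x + T))
      (f := fun x => erlangTail r (x + T)) hT.le
      (fun x => (hasDerivAt_mdMeanAge hr.ne' (x + T)).comp_add_const x T)
      (continuous_erlangTail.comp (continuous_add_const T))
      (fun x hx _ => erlangTail_nonneg hr (by linarith))
    rw [two_mul, show mdMeanAge r T = mdMeanAge r (0 + T) by rw [zero_add], ← h,
      ← lintegral_indicator measurableSet_Ioi, ← lintegral_indicator measurableSet_Ioc]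
    refine lintegral_congr fun x => ?_
    by_cases hx : 0 < x
    · have h1 : {ω | x ≤ max (X ω - T) 0} = {ω | x + T ≤ X ω} := by
        ext ω
        simp only [Set.mem_ofPred_eq, le_max_iff, not_le.2 hx, or_false, le_sub_iff_add_le]
      rw [Set.indicator_of_mem (Set.mem_Ioi.2 hx), h1, hX,
        measure_le_ctsAgeBefore hr hT (by nlinarith) le_rfl (by linarith)]
      by_cases hxT : x ≤ T
      · rw [if_pos (by linarith), Set.indicator_of_mem (Set.mem_Ioc.2 ⟨hx, hxT⟩)]
      · rw [if_neg (by linarith), Set.indicator_of_notMem (fun h => hxT h.2)]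
    · rw [Set.indicator_of_notMem (by simpa using hx), Set.indicator_of_notMem (fun h => hx h.1)]
  have hmono : mdMeanAge r T ≤ mdMeanAge r (2 * T) :=
    monotoneOn_mdMeanAge hr (Set.mem_Ici.2 hT.le) (Set.mem_Ici.2 (by linarith)) (by linarith)
  rw [lintegral_congr hsplit, lintegral_add_left ((measurable_one.indicator hA).const_mul _),
    lintegral_const_mul _ (measurable_one.indicator hA), lintegral_indicator_one hA,
    measure_lt_ctsAgeBefore hr hT, hmax, ← ENNReal.ofReal_mul hT.le,
    ← ENNReal.ofReal_add (mul_nonneg hT.le (erlangTail_nonneg hr hT.le)) (by linarith)]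
  congr 1; ring

/-- The long-run rate of the peaks, once their contribution per period is known. -/
lemma tendsto_mdPeaks_div (hr : 0 < r) (hT : 0 < T) {φ : ℝ → ℝ≥0∞} (hφ : Measurable φ)
    {C : ℝ≥0∞} (hC : C ≠ ⊤) (hφC : ∀ y ≤ T, φ y ≤ C) {c : ℝ} (hc : 0 ≤ c)
    (h : ∀ k : ℕ, ∑' i, ∫⁻ ω, peakTerm T φ ((k + 1) * T) ((k + 2) * T) 0 i ω ∂(expPathLaw r) +
      ∑' i, ∫⁻ ω, peakTerm T φ ((k + 1) * T) ((k + 2) * T) 1 i ω ∂(expPathLaw r) =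
      ENNReal.ofReal c) :
    Tendsto (fun τ => mdPeaks r T φ τ / ENNReal.ofReal τ) atTop
      (𝓝 (ENNReal.ofReal (c / T))) := by
  refine tendsto_div_of_periodic_increments (mdPeaks_mono r T φ) (b := 0) hT hc 1 ?_ fun k hk => ?_
  · rw [Nat.cast_one, one_mul, zero_add]
    exact mdPeaks_first_ne_top hr hT hC hφC
  · obtain ⟨j, rfl⟩ : ∃ j, k = j + 1 := ⟨k - 1, by omega⟩
    push_cast
    rw [zero_add, zero_add, ← h j, show ((j : ℝ) + 1 + 1) * T = (j + 2) * T by ring]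
    exact mdPeaks_add hφ (by nlinarith)

lemma mdMeanPeak_nonneg (hr : 0 < r) {w : ℝ} (hw : 0 ≤ w) : 0 ≤ mdMeanPeak r w := by
  have hd : ∀ x, HasDerivAt (mdMeanPeak r)
      (erlangTail r x - (1 * Real.exp (-(r * x)) + x * (Real.exp (-(r * x)) * -(r * 1)))) x :=
    fun x => (hasDerivAt_mdMeanAge hr.ne' x).sub
      ((hasDerivAt_id x).mul (((hasDerivAt_id x).const_mul r).neg.exp))
  have h : MonotoneOn (mdMeanPeak r) (Set.Ici 0) :=
    monotoneOn_of_deriv_nonneg (convex_Ici 0)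
      (fun x _ => (hd x).continuousAt.continuousWithinAt)
      (fun x _ => (hd x).differentiableAt.differentiableWithinAt)
      (fun x hx => by
        rw [interior_Ici] at hx
        have hx' : 0 ≤ x := le_of_lt hx
        rw [(hd x).deriv, erlangTail]
        have : 0 ≤ r * x * Real.exp (-(r * x)) := by positivity
        linarith)
  have := h (Set.mem_Ici.2 le_rfl) (Set.mem_Ici.2 hw) hw
  simpa [mdMeanPeak, mdMeanAge] using this

lemma erlangTail_pos (hr : 0 < r) (hT : 0 < T) : 0 < erlangTail r T := by
  rw [erlangTail]; positivity

lemma integral_one_sub_exp_nonneg (hr : 0 < r) (hT : 0 < T) :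
    0 ≤ ∫ u in (0 : ℝ)..1, (1 - Real.exp (-(r * (T * (1 + u))))) :=
  intervalIntegral.integral_nonneg zero_le_one fun u hu => by
    have := hu.1
    rw [sub_nonneg, Real.exp_le_one_iff, neg_nonpos]
    positivity

lemma mdPeaksPerPeriod_pos (hr : 0 < r) (hT : 0 < T) : 0 < mdPeaksPerPeriod r T :=
  add_pos_of_nonneg_of_pos
    (mul_nonneg (mul_pos hr hT).le (integral_one_sub_exp_nonneg hr hT)) (erlangTail_pos hr hT)

lemma integral_mdMeanPeak_nonneg (hr : 0 < r) (hT : 0 < T) :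
    0 ≤ ∫ u in (0 : ℝ)..1, mdMeanPeak r (T * (1 + u)) :=
  intervalIntegral.integral_nonneg zero_le_one fun u hu =>
    mdMeanPeak_nonneg hr (mul_nonneg hT.le (by linarith [hu.1]))

lemma meanPeak_sensorB_nonneg (hr : 0 < r) (hT : 0 < T) :
    0 ≤ mdMeanAge r (2 * T) - (mdMeanAge r T - T * erlangTail r T) := by
  have h := monotoneOn_mdMeanAge hr (Set.mem_Ici.2 hT.le)
    (Set.mem_Ici.2 (by linarith : 0 ≤ 2 * T)) (by linarith)
  have := mul_pos hT (erlangTail_pos hr hT)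
  linarith

lemma mdPeakSumPerPeriod_nonneg (hr : 0 < r) (hT : 0 < T) : 0 ≤ mdPeakSumPerPeriod r T :=
  add_nonneg (mul_nonneg (mul_pos hr hT).le (integral_mdMeanPeak_nonneg hr hT))
    (meanPeak_sensorB_nonneg hr hT)

lemma tendsto_mdPeaks_one (hr : 0 < r) (hT : 0 < T) :
    Tendsto (fun τ => mdPeaks r T (fun _ => 1) τ / ENNReal.ofReal τ) atTop
      (𝓝 (ENNReal.ofReal (mdPeaksPerPeriod r T / T))) := by
  refine tendsto_mdPeaks_div hr hT measurable_const ENNReal.one_ne_top (fun _ _ => le_rfl)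
    (mdPeaksPerPeriod_pos hr hT).le fun k => ?_
  rw [tsum_peakTerm_zero_one hr hT, tsum_peakTerm_one hT]
  have h := lintegral_indicator_one (μ := expPathLaw r) (measurableSet_lt
    (measurable_const (a := T)) (measurable_ctsAgeBefore_at T ((k + 2) * T)))
  rw [measure_lt_ctsAgeBefore hr hT] at h
  rw [mdPeaksPerPeriod, ENNReal.ofReal_add
    (mul_nonneg (mul_pos hr hT).le (integral_one_sub_exp_nonneg hr hT))
    (erlangTail_pos hr hT).le, ← h]
  rfl

lemma tendsto_mdPeaks_ofReal (hr : 0 < r) (hT : 0 < T) :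
    Tendsto (fun τ => mdPeaks r T ENNReal.ofReal τ / ENNReal.ofReal τ) atTop
      (𝓝 (ENNReal.ofReal (mdPeakSumPerPeriod r T / T))) := by
  refine tendsto_mdPeaks_div hr hT ENNReal.measurable_ofReal (ENNReal.ofReal_ne_top (r := T))
    (fun _ hy => ENNReal.ofReal_le_ofReal hy) (mdPeakSumPerPeriod_nonneg hr hT) fun k => ?_
  rw [tsum_peakTerm_zero_ofReal hr hT, tsum_peakTerm_one hT, lintegral_peak_one hr hT,
    mdPeakSumPerPeriod, ENNReal.ofReal_add
      (mul_nonneg (mul_pos hr hT).le (integral_mdMeanPeak_nonneg hr hT))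
      (meanPeak_sensorB_nonneg hr hT)]

/-- The average peak age of the M-D system: expected sum of the peaks per period, divided by their
expected number. -/
lemma tendsto_mdMeanPAoI (hr : 0 < r) (hT : 0 < T) :
    Tendsto (mdMeanPAoI r (1 / T)) atTop
      (𝓝 (ENNReal.ofReal (mdPeakSumPerPeriod r T / mdPeaksPerPeriod r T))) := by
  have h := tendsto_quotient_of_rates (tendsto_mdPeaks_ofReal hr hT) (tendsto_mdPeaks_one hr hT)
    (div_pos (mdPeaksPerPeriod_pos hr hT) hT) (by
      filter_upwards [eventually_gt_atTop 0] with τ hτ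
      exact ⟨(ENNReal.ofReal_pos.2 hτ).ne', ENNReal.ofReal_ne_top⟩)
  rw [div_div_div_cancel_right₀ hT.ne'] at h
  refine h.congr fun τ => ?_
  have hs : mdServices (1 / T) = fun ω => services ω T := by
    funext ω
    rw [mdServices, one_div_one_div]
  rw [mdMeanPAoI, mdSumPeaks, mdNumPeaks, hs]
  rfl

end MD

/-! ### Values of the long-run averages -/

/-- `longRun` recovers a finite limit. -/
lemma tendsto_ofReal_longRun {ι : Type} [Preorder ι] [(atTop : Filter ι).NeBot] {m : ι → ℝ≥0∞}
    {a : ℝ} (h : Tendsto m atTop (𝓝 (ENNReal.ofReal a))) :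
    Tendsto m atTop (𝓝 (ENNReal.ofReal (longRun m))) := by
  rw [longRun, h.limsup_eq, ENNReal.ofReal_toReal ENNReal.ofReal_ne_top]
  exact h

lemma mdAvgAoI_eq {r T : ℝ} (hr : 0 < r) (hT : 0 < T) :
    mdAvgAoI r (1 / T) = ∫ u in (0 : ℝ)..1, mdMeanAge r (T * (1 + u)) :=
  longRun_eq (intervalIntegral.integral_nonneg zero_le_one fun u hu =>
    mdMeanAge_nonneg hr (mul_nonneg hT.le (by linarith [hu.1]))) (tendsto_mdMeanAoI hr hT)

lemma mdAvgPAoI_eq {r T : ℝ} (hr : 0 < r) (hT : 0 < T) :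
    mdAvgPAoI r (1 / T) = mdPeakSumPerPeriod r T / mdPeaksPerPeriod r T :=
  longRun_eq (div_nonneg (mdPeakSumPerPeriod_nonneg hr hT) (mdPeaksPerPeriod_pos hr hT).le)
    (tendsto_mdMeanPAoI hr hT)

lemma ceil_one_div_one_div (x : ℝ) : ⌈1 / (1 / x)⌉₊ = ⌈x⌉₊ := by rw [one_div_one_div]

end

end AoI

/-- Rates `lam / δ` and `1 / (δ * TM)` per slot of length `1 / δ`.  The first two parts say that the
long-run averages exist as finite limits, for the Geo-D systems and for the M-D system; the last
part is the convergence of the Geo-D averages, converted to seconds, to the M-D averages. -/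
theorem theorem2 (lam TM : ℝ) (hlam : 0 < lam) (hTM : 0 < TM) :
    (∀ δ : ℝ, lam ≤ δ →
      Tendsto (AoI.geoDMeanAoI (lam / δ) (1 / (δ * TM))) atTop
        (𝓝 (ENNReal.ofReal (AoI.geoDAvgAoI (lam / δ) (1 / (δ * TM))))) ∧
      Tendsto (AoI.geoDMeanPAoI (lam / δ) (1 / (δ * TM))) atTop
        (𝓝 (ENNReal.ofReal (AoI.geoDAvgPAoI (lam / δ) (1 / (δ * TM)))))) ∧
    (Tendsto (AoI.mdMeanAoI lam (1 / TM)) atTop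
        (𝓝 (ENNReal.ofReal (AoI.mdAvgAoI lam (1 / TM)))) ∧
      Tendsto (AoI.mdMeanPAoI lam (1 / TM)) atTop
        (𝓝 (ENNReal.ofReal (AoI.mdAvgPAoI lam (1 / TM))))) ∧
    (Tendsto (fun δ : ℝ => 1 / δ * AoI.geoDAvgAoI (lam / δ) (1 / (δ * TM))) atTop
        (𝓝 (AoI.mdAvgAoI lam (1 / TM))) ∧
      Tendsto (fun δ : ℝ => 1 / δ * AoI.geoDAvgPAoI (lam / δ) (1 / (δ * TM))) atTop
        (𝓝 (AoI.mdAvgPAoI lam (1 / TM)))) := by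
  refine ⟨fun δ hδ => ?_, ⟨AoI.tendsto_ofReal_longRun (AoI.tendsto_mdMeanAoI hlam hTM),
    AoI.tendsto_ofReal_longRun (AoI.tendsto_mdMeanPAoI hlam hTM)⟩, ?_, ?_⟩
  · have hδ0 : 0 < δ := hlam.trans_le hδ
    have hp : 0 < lam / δ := div_pos hlam hδ0
    have hp1 : lam / δ ≤ 1 := (div_le_one hδ0).2 hδ
    have hT : 0 < ⌈δ * TM⌉₊ := Nat.ceil_pos.2 (mul_pos hδ0 hTM)
    have hμ := AoI.ceil_one_div_one_div (δ * TM)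
    exact ⟨AoI.tendsto_ofReal_longRun (AoI.tendsto_geoDMeanAoI hp hp1 hT hμ),
      AoI.tendsto_ofReal_longRun (AoI.tendsto_geoDMeanPAoI hp hp1 hT hμ)⟩
  · rw [AoI.mdAvgAoI_eq hlam hTM]
    refine (AoI.tendsto_geoAgePerPeriod hlam hTM).congr' ?_
    filter_upwards [AoI.eventually_rate hlam] with δ ⟨hp, hp1, hδ⟩
    rw [AoI.geoDAvgAoI_eq hp hp1 (Nat.ceil_pos.2 (mul_pos hδ hTM))
      (AoI.ceil_one_div_one_div (δ * TM))]
  · rw [AoI.mdAvgPAoI_eq hlam hTM]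
    refine ((AoI.tendsto_geoPeakSumPerPeriod hlam hTM).div
      (AoI.tendsto_geoPeaksPerPeriod hlam hTM) (AoI.mdPeaksPerPeriod_pos hlam hTM).ne').congr' ?_
    filter_upwards [AoI.eventually_rate hlam] with δ ⟨hp, hp1, hδ⟩
    rw [AoI.geoDAvgPAoI_eq hp hp1 (Nat.ceil_pos.2 (mul_pos hδ hTM))
      (AoI.ceil_one_div_one_div (δ * TM)), Pi.div_apply, mul_div_assoc]
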